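/- For integers $r,s,t$ put $S_{r,s,t}:=\sum_{s\le i_1<\dots<i_r\le t}\frac{1}{i_1\cdots i_r}$, with $S_{0,s,t}:=1$ if $t\ge s-1$, and $S_{r,s,t}:=0$ if $r<0$ or $t<r+s-1$. Let $B_k$ be the Bernoulli numbers (with $B_1=-\tfrac12$), $\gamma$ Euler's constant, $H_q=\sum_{j=1}^q \frac1j$, $\zeta$ the Riemann zeta function and $\zeta^{(p)}$ its $p$-th derivative. All asymptotic statements are for $n\to\infty$ with the other parameters fixed. (1) For every integer $q\ge 2$ and every integer $m\ge 0$, $$\sum_{k=1}^{n-1}\frac{\log k}{(n-k)^q}=\zeta(q)\log n-\sum_{i=1}^{q-2}\frac{\zeta(q-i)}{i\,n^i}-\frac{2\log n+C_{q-1}}{(q-1)\,n^{q-1}}+\sum_{k=1}^m\Big(\frac{(-1)^kB_k}{k(k+q-1)}-\binom{k+q-2}{q-1}\zeta'(1-k)\Big)\frac1{n^{k+q-1}}+O\Big(\frac1{n^{m+q}}\Big),$$ where $C_q:=\gamma-H_q+\frac2q$. In particular there is no constant term: $\sum_{k=1}^{n-1}\frac{\log k}{(n-k)^q}-\zeta(q)\log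 n\to 0$. (2) For all integers $q\ge2$, $p\ge1$ and $m\ge 0$, \begin{align*} \sum_{k=1}^{n-1}\frac{(\log k)^p}{(n-k)^q}&=\zeta(q)(\log n)^p+\sum_{i=1}^{q-2}\frac{\zeta(q-i)}{i\,n^i}\sum_{r=1}^{\min(i,p)}c_{p,i,r}(\log n)^{p-r}+\frac{1}{(q-1)\,n^{q-1}}\sum_{r=0}^p d_{p,q,r}(\log n)^{p-r}\\ &\quad-\sum_{k=1}^m\bigg(\frac{(-1)^kB_k}{k(k+q-1)}\sum_{r=1}^p c_{p,k+q-1,r}(\log n)^{p-r}-(-1)^p\binom{k+q-2}{q-1}\zeta^{(p)}(1-k)\bigg)\frac1{n^{k+q-1}}+O\Big(\frac{(\log n)^{p-1}}{n^{m+q}}\Big), \end{align*} where $c_{p,i,r}:=\frac{(-1)^rp!}{(p-r)!}S_{r-1,1,i-1}$ and $$d_{p,q,r}:=\frac{(-1)^rp!}{(p-r)!}\times\begin{cases}D_{r,q}-(p-r)S_{r,1,q-2}+S_{r-1,1,q-2}\,\gamma+\sum_{s=2}^rS_{r-s,1,q-2}\,\zeta(s)&\text{for }0\le r\le q-1,\\[2pt]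 \sum_{s=r-q+2}^rS_{r-s,1,q-2}\,\zeta(s)&\text{for } q\le r\le p,\end{cases}$$ with the rational numbers $$D_{r,q}:=\sum_{u=0}^{r-2}\sum_{j=1}^{q-r+u}\frac{S_{u,1,j-1}}{j}\bigg(\frac{S_{r-2-u,1,q-j-2}}{j}-\sum_{v=1}^{q-j-2}\frac{\sum_{i=0}^{v-1}(-1)^iS_{i,1,v-1}\,S_{r-3-u-i,1,q-j-2-v}}{v(v+j)}\bigg)+\frac{S_{r-1,1,q-2}}{q-1}-S_{r,1,q-2}.$$ In particular there is no constant term: $\sum_{k=1}^{n-1}\frac{(\log k)^p}{(n-k)^q}-\zeta(q)(\log n)^p\to0$. -/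

import Mathlib

open Filter Asymptotics
open scoped Nat

noncomputable section

/-- `S_{r,s,t} = ∑_{s ≤ i₁ < ⋯ < i_r ≤ t} 1 / (i₁ ⋯ i_r)`, with `S_{0,s,t} = 1` for `t ≥ s - 1`,
and the value `0` for `r < 0` and for `t < s - 1`. -/
def multHarm (r s t : ℤ) : ℚ :=
  if r < 0 ∨ t < s - 1 then 0
  else ∑ A ∈ (Finset.Icc s t).powersetCard r.toNat, ∏ i ∈ A, 1 / (i : ℚ)

/-- `c_{p,i,r} = (-1)^r p! / (p-r)! · S_{r-1,1,i-1}`, for `r ≤ p`. -/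
def coeffC (p i r : ℕ) : ℚ :=
  (-1) ^ r * ((p ! : ℚ) / ((p - r)! : ℚ)) * multHarm ((r : ℤ) - 1) 1 ((i : ℤ) - 1)

/-- The rational numbers `D_{r,q}`. -/
def ratD (r q : ℤ) : ℚ :=
  (∑ u ∈ Finset.Icc 0 (r - 2), ∑ j ∈ Finset.Icc 1 (q - r + u),
    multHarm u 1 (j - 1) / (j : ℚ) *
      (multHarm (r - 2 - u) 1 (q - j - 2) / (j : ℚ) -
        ∑ v ∈ Finset.Icc 1 (q - j - 2),
          (∑ i ∈ Finset.Icc 0 (v - 1),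
            (-1) ^ i * multHarm i 1 (v - 1) * multHarm (r - 3 - u - i) 1 (q - j - 2 - v)) /
          ((v : ℚ) * ((v : ℚ) + (j : ℚ)))))
  + multHarm (r - 1) 1 (q - 2) / ((q : ℚ) - 1) - multHarm r 1 (q - 2)

/-- `d_{p,q,r}`, for `r ≤ p` and `q ≥ 2`. -/
def coeffD (p q r : ℕ) : ℂ :=
  (-1) ^ r * ((p ! : ℂ) / ((p - r)! : ℂ)) *
    if r < q then
      (ratD r q : ℂ) - ((p : ℂ) - (r : ℂ)) * (multHarm r 1 ((q : ℤ) - 2) : ℂ)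
        + (multHarm ((r : ℤ) - 1) 1 ((q : ℤ) - 2) : ℂ) * (Real.eulerMascheroniConstant : ℂ)
        + ∑ s ∈ Finset.Icc 2 r, (multHarm ((r : ℤ) - (s : ℤ)) 1 ((q : ℤ) - 2) : ℂ) * riemannZeta s
    else
      ∑ s ∈ Finset.Icc (r - q + 2) r,
        (multHarm ((r : ℤ) - (s : ℤ)) 1 ((q : ℤ) - 2) : ℂ) * riemannZeta s

/-- `C_q = γ - H_q + 2 / q`. -/
def constC (q : ℕ) : ℝ :=
  Real.eulerMascheroniConstant - (harmonic q : ℝ) + 2 / (q : ℝ)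

/-- `∑_{k=1}^{n-1} (log k)^p / (n-k)^q`. -/
def logPowSum (p q n : ℕ) : ℝ :=
  ∑ k ∈ Finset.Ico 1 n, Real.log (k : ℝ) ^ p / ((n : ℝ) - (k : ℝ)) ^ q

/-- `ζ^{(p)}(s)`. -/
def zetaDeriv (p : ℕ) (s : ℂ) : ℂ := iteratedDeriv p riemannZeta s

end

/-! Since `(log k)^p` is `(-1)^p` times the `p`-th derivative of `k^(-s)` at `s = 0`, it suffices to
expand `F_q(s, n) = ∑ k^(-s) / (n-k)^q` (`powConv`) uniformly for `s` in a disc around `0`. Cauchy's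
estimate then differentiates the expansion without loss in the power of `n`
(`norm_logPowSum_sub_le`).

The expansion of `F_q` has one family of terms for each end of the summation range. Expanding
`k^(-s)` about `k = n` gives `n^(-s) ∑ (s)_i / i! · ζ(q-i) n^(-i)`; expanding `(n-k)^(-q)` about `k
= 0` gives `∑ binom(q+j-1, j) ζ(s-j) n^(-q-j)`. At `i = q-1` the pole of `ζ` is replaced by a term
in `log n`, `γ` and `∑ (1/(k-s) - 1/k) = -γ - ψ(1-s)` (`logCoeff`). The only term with no negative
power of `n` at `s = 0` is `i = 0`, whose coefficient `ζ(q)` does not depend on `s`; hence there is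
no constant term.

For `Re s` very negative the expansion is proved directly (`norm_powConv_sub_le_of_re_le`). With `y
= (n-k)/n`, remove from `(1-y)^(-s)` its Taylor polynomial of order `q`. The remainder divided by
`y^q` is smooth enough on `[0,1]` for Euler–Maclaurin summation, and the removed terms are sums `∑
k^(-a)`, which Euler–Maclaurin also expands. The second family is then below the error. The way back
to `s = 0` is the recurrence `n F_{q+1}(s) = F_{q+1}(s-1) + F_q(s)`, which the formal expansion
satisfies as well; the induction starts from `F_0`, a partial sum of the zeta series
(`norm_powConv_sub_shift_le`).

It remains to read off Taylor coefficients at `s = 0`. The rising factorial is `s/(m+1) · ∏ (1 +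
s/l)`, with coefficients `S_{r-1,1,m}/(m+1)`, and the digamma series has coefficients `ζ(r+1)`. This
yields `H_{q-1} S_{r-1,1,q-2} - (r+1) S_{r,1,q-2}` where the theorem has `D_{r,q}`; the two agree by
a polynomial identity resting on `(1-y)^(-s) (1-y)^s = 1` (`ratD_eq`). -/

/-! ### Euler–Maclaurin summation with a uniform constant. -/

open MeasureTheory intervalIntegral Set in
-- Repeated integration by parts against Bernoulli polynomials, `f j` being the `j`-th derivative.
-- Derivatives are asked for only in the open interval, because the Taylor quotients used later are
-- differentiated only there.
theorem euler_maclaurin_unit (f : ℕ → ℝ → ℂ) (a : ℝ) (K : ℕ)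
    (hc : ∀ j ≤ K + 1, ContinuousOn (f j) (Icc a (a + 1)))
    (hd : ∀ j ≤ K, ∀ x ∈ Ioo a (a + 1), HasDerivAt (f j) (f (j + 1) x) x) :
    f 0 a = (∫ x in a..(a + 1), f 0 x)
      + ∑ j ∈ Finset.range (K + 1),
          (bernoulli (j + 1) : ℂ) / ((j + 1)! : ℂ) * (f j (a + 1) - f j a)
      + (-1) ^ K / ((K + 1)! : ℂ) *
          ∫ x in a..(a + 1), (bernoulliFun (K + 1) (x - a) : ℂ) * f (K + 1) x := by
  have hu : uIcc a (a + 1) = Icc a (a + 1) := uIcc_of_le (by linarith)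
  have parts : ∀ j ≤ K, ∫ x in a..(a + 1), (bernoulliFun (j + 1) (x - a) : ℂ) * f (j + 1) x
      = (bernoulliFun (j + 1) 1 : ℂ) * f j (a + 1) - (bernoulliFun (j + 1) 0 : ℂ) * f j a
        - (j + 1) * ∫ x in a..(a + 1), (bernoulliFun j (x - a) : ℂ) * f j x := by
    intro j hj
    have hB : ∀ m : ℕ, Continuous fun x : ℝ => (bernoulliFun m (x - a) : ℂ) := fun m =>
      Complex.continuous_ofReal.comp
        ((continuous_bernoulliFun m).comp (continuous_id.sub continuous_const))
    rw [integral_mul_deriv_eq_deriv_mul_of_hasDerivAt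
      (u' := fun x => ((j + 1 : ℕ) * bernoulliFun j (x - a) : ℝ)) (v := f j)]
    · simp only [add_sub_cancel_left, sub_self]
      congr 1
      rw [← intervalIntegral.integral_const_mul]
      congr 1; ext x; push_cast; ring
    · exact (hB _).continuousOn
    · rw [hu]; exact hc j (by omega)
    · intro x _
      have := (hasDerivAt_bernoulliFun (j + 1) (x - a)).comp x ((hasDerivAt_id x).sub_const a)
      simpa [Function.comp_def] using this.ofReal_comp
    · intro x hx
      rw [min_eq_left (by linarith), max_eq_right (by linarith)] at hx
      exact hd j hj x hx
    · apply Continuous.intervalIntegrable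
      have := hB j
      push_cast
      fun_prop
    · apply ContinuousOn.intervalIntegrable
      rw [hu]; exact hc _ (by omega)
  induction K with
  | zero =>
    have := parts 0 le_rfl
    simp only [bernoulliFun_eval_one, bernoulliFun_eval_zero] at this
    simp [bernoulli_one, bernoulliFun_zero] at this ⊢
    rw [this]; ring
  | succ K ih =>
    rw [Finset.sum_range_succ]
    have h1 := ih (fun j hj => hc j (by omega)) (fun j hj => hd j (by omega))
      (fun j hj => parts j (by omega))
    have h2 := parts (K + 1) le_rfl
    rw [bernoulliFun_eval_one, bernoulliFun_eval_zero, if_neg (by omega), add_zero] at h2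
    rw [h2]
    conv_lhs => rw [h1]
    rw [Nat.factorial_succ (K + 1)]
    have h3 : (((K + 1 : ℕ)! : ℕ) : ℂ) ≠ 0 := by exact_mod_cast Nat.factorial_ne_zero _
    have h4 : ((K : ℂ) + 1 + 1) ≠ 0 := by exact_mod_cast Nat.succ_ne_zero (K + 1)
    have h5 : (bernoulli (K + 1 + 1) : ℂ) * (1 + (-1) ^ (K + 1)) = 0 := by
      rcases Nat.even_or_odd (K + 1) with h | h
      · rw [bernoulli_eq_zero_of_odd h.add_one (by omega)]; simp
      · rw [h.neg_one_pow]; ring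
    push_cast
    field_simp
    rw [pow_succ] at h5 ⊢
    linear_combination (f (K + 1) a - f (K + 1) (a + 1)) * h5
open MeasureTheory intervalIntegral Set in
-- Unit steps are added up. The constant is a bound for one Bernoulli polynomial on `[0,1]`, so it
-- depends on `K` alone; all later uniformity in `s` and `n` starts here.
theorem euler_maclaurin (K : ℕ) : ∃ C : ℝ, 0 ≤ C ∧ ∀ (f : ℕ → ℝ → ℂ) (A B : ℕ), A ≤ B →
    (∀ j ≤ K + 1, ContinuousOn (f j) (Icc (A : ℝ) B)) →
    (∀ j ≤ K, ∀ x ∈ Ioo (A : ℝ) B, HasDerivAt (f j) (f (j + 1) x) x) →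
    ‖(∑ k ∈ Finset.Ico A B, f 0 k) - (∫ x in (A : ℝ)..B, f 0 x)
      - ∑ j ∈ Finset.range (K + 1),
          (bernoulli (j + 1) : ℂ) / ((j + 1)! : ℂ) * (f j B - f j A)‖
      ≤ C * ∫ x in (A : ℝ)..B, ‖f (K + 1) x‖ := by
  obtain ⟨C, hC⟩ := isCompact_Icc.exists_bound_of_continuousOn
    (f := bernoulliFun (K + 1)) (s := Icc (0 : ℝ) 1) (continuous_bernoulliFun _).continuousOn
  have hC0 : 0 ≤ C := (norm_nonneg _).trans (hC 0 (by simp))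
  refine ⟨C, hC0, ?_⟩
  intro f A B hAB
  induction B, hAB using Nat.le_induction with
  | base => intro _ _; simp
  | succ B hAB ih =>
    intro hc hd
    have hAB' : (A : ℝ) ≤ B := by exact_mod_cast hAB
    have hs1 : Icc (A : ℝ) B ⊆ Icc (A : ℝ) (B + 1 : ℕ) :=
      Icc_subset_Icc_right (by push_cast; linarith)
    have hs2 : Icc (B : ℝ) (B + 1) ⊆ Icc (A : ℝ) (B + 1 : ℕ) := by
      push_cast; exact Icc_subset_Icc_left hAB'
    have h1 := ih (fun j hj => (hc j hj).mono hs1)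
      (fun j hj x hx => hd j hj x ⟨hx.1, hx.2.trans (by push_cast; linarith)⟩)
    have h2 := euler_maclaurin_unit f B K (fun j hj => (hc j hj).mono hs2)
      (fun j hj x hx => hd j hj x ⟨hAB'.trans_lt hx.1, by push_cast; exact hx.2⟩)
    have hi1 : ∀ j ≤ K + 1, IntervalIntegrable (f j) volume A B := fun j hj =>
      ContinuousOn.intervalIntegrable (by rw [uIcc_of_le hAB']; exact (hc j hj).mono hs1)
    have hi2 : ∀ j ≤ K + 1, IntervalIntegrable (f j) volume B (B + 1) := fun j hj =>
      ContinuousOn.intervalIntegrable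
        (by rw [uIcc_of_le (by linarith)]; exact (hc j hj).mono hs2)
    have h3 : ‖(-1) ^ K / ((K + 1)! : ℂ) *
          ∫ x in (B : ℝ)..(B + 1), (bernoulliFun (K + 1) (x - B) : ℂ) * f (K + 1) x‖
        ≤ C * ∫ x in (B : ℝ)..(B + 1), ‖f (K + 1) x‖ := by
      rw [norm_mul]
      have h4 : ‖((-1 : ℂ)) ^ K / ((K + 1)! : ℂ)‖ ≤ 1 := by
        rw [norm_div, norm_pow, norm_neg, norm_one, one_pow, Complex.norm_natCast]
        exact div_le_one_of_le₀ (by exact_mod_cast Nat.succ_le_of_lt (Nat.factorial_pos _))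
          (by positivity)
      refine (mul_le_of_le_one_left (norm_nonneg _) h4).trans ?_
      rw [← intervalIntegral.integral_const_mul]
      apply intervalIntegral.norm_integral_le_of_norm_le (by linarith)
      · refine ae_of_all _ fun x hx => ?_
        rw [norm_mul, Complex.norm_real]
        exact mul_le_mul_of_nonneg_right (hC _ ⟨by linarith [hx.1], by linarith [hx.2]⟩)
          (norm_nonneg _)
      · exact (hi2 _ le_rfl).norm.const_mul _
    rw [Finset.sum_Ico_succ_top hAB]
    push_cast
    rw [← integral_add_adjacent_intervals (hi1 0 (by omega)) (hi2 0 (by omega)),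
      ← integral_add_adjacent_intervals (hi1 (K + 1) le_rfl).norm (hi2 (K + 1) le_rfl).norm,
      mul_add]
    refine le_trans (le_of_eq ?_) ((norm_add_le _ _).trans (add_le_add h1 h3))
    congr 1
    rw [h2]
    have : ∀ j, (bernoulli (j + 1) : ℂ) / ((j + 1)! : ℂ) * (f j (B + 1) - f j A)
      = (bernoulli (j + 1) : ℂ) / ((j + 1)! : ℂ) * (f j (B + 1) - f j B) +
        (bernoulli (j + 1) : ℂ) / ((j + 1)! : ℂ) * (f j B - f j A) := fun j => by ring
    simp only [this, Finset.sum_add_distrib]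
    ring

/-! ### Rising factorials and partial sums of the zeta series. -/

/-- The coefficient `(s)_i / i!` of `y ^ i` in `(1 - y) ^ (-s)`. -/
noncomputable def risingCoeff (i : ℕ) (s : ℂ) : ℂ := ∏ l ∈ Finset.range i, (s + l) / (l + 1)

@[simp] theorem risingCoeff_zero (s : ℂ) : risingCoeff 0 s = 1 := by simp [risingCoeff]

theorem risingCoeff_succ (i : ℕ) (s : ℂ) :
    (i + 1) * risingCoeff (i + 1) s = (s + i) * risingCoeff i s := by
  have : (i : ℂ) + 1 ≠ 0 := by exact_mod_cast Nat.succ_ne_zero i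
  rw [risingCoeff, Finset.prod_range_succ, ← risingCoeff]
  field_simp

theorem risingCoeff_succ' (i : ℕ) (s : ℂ) :
    (i + 1) * risingCoeff (i + 1) s = s * risingCoeff i (s + 1) := by
  induction i with
  | zero => simp [risingCoeff]
  | succ i ih =>
    have h1 := risingCoeff_succ (i + 1) s
    have h2 := risingCoeff_succ i (s + 1)
    have : (i : ℂ) + 1 ≠ 0 := by exact_mod_cast Nat.succ_ne_zero i
    apply mul_left_cancel₀ this
    push_cast at *
    linear_combination ((i : ℂ) + 1) * h1 - s * h2 + (s + i + 1) * ih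

/-- Coefficient comparison in `(1-y) (1-y)^(-s) = (1-y)^(-(s-1))`. -/
theorem risingCoeff_pascal (i : ℕ) (s : ℂ) :
    risingCoeff (i + 1) s = risingCoeff (i + 1) (s - 1) + risingCoeff i s := by
  have : (i : ℂ) + 1 ≠ 0 := by exact_mod_cast Nat.succ_ne_zero i
  apply mul_left_cancel₀ this
  have h1 := risingCoeff_succ i s
  have h2 := risingCoeff_succ' i (s - 1)
  rw [sub_add_cancel] at h2
  linear_combination h1 - h2

theorem differentiable_risingCoeff (i : ℕ) : Differentiable ℂ (risingCoeff i) := by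
  unfold risingCoeff
  fun_prop

/-- The `j`-th derivative of `x^(-s)` is `(-1)^j j! risingCoeff j s · x^(-s-j)`, so this converts
the Euler–Maclaurin coefficients of `x^(-s)` into zeta values. -/
theorem riemannZeta_neg_nat_mul_risingCoeff (j : ℕ) (s : ℂ) :
    (bernoulli (j + 1) : ℂ) / ((j + 1)! : ℂ) * ((-1) ^ j * (j ! : ℂ) * risingCoeff j s)
      = riemannZeta (-j) * risingCoeff j s := by
  rw [riemannZeta_neg_nat_eq_bernoulli, Nat.factorial_succ]
  have h3 : ((j ! : ℕ) : ℂ) ≠ 0 := by exact_mod_cast Nat.factorial_ne_zero _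
  have h4 : ((j : ℂ) + 1) ≠ 0 := by exact_mod_cast Nat.succ_ne_zero j
  push_cast
  field_simp

theorem hasDerivAt_ofReal_cpow_neg (s : ℂ) {x : ℝ} (hx : 0 < x) :
    HasDerivAt (fun x : ℝ => (x : ℂ) ^ (-s)) (-s * (x : ℂ) ^ (-s - 1)) x := by
  have h := (Complex.hasStrictDerivAt_cpow_const (c := -s)
    (Or.inl (by simpa using hx) : (x : ℂ) ∈ Complex.slitPlane)).hasDerivAt.comp_ofReal
  simpa using h

open MeasureTheory intervalIntegral Set in
theorem norm_sum_cpow_Ico_sub_le (K : ℕ) : ∃ C : ℝ, 0 ≤ C ∧ ∀ (s : ℂ) (n N : ℕ), 1 ≤ n → n ≤ N →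
    ‖(∑ k ∈ Finset.Ico n N, (k : ℂ) ^ (-s)) - (∫ x in (n : ℝ)..N, (x : ℂ) ^ (-s))
      - ∑ j ∈ Finset.range (K + 1), riemannZeta (-j) * risingCoeff j s *
          ((N : ℂ) ^ (-s - j) - (n : ℂ) ^ (-s - j))‖
      ≤ C * ‖risingCoeff (K + 1) s‖ * ∫ x in (n : ℝ)..N, x ^ (-s.re - (K + 1)) := by
  obtain ⟨C, hC, h⟩ := euler_maclaurin K
  refine ⟨C * ((K + 1)! : ℝ), by positivity, fun s n N hn hnN => ?_⟩
  have hn0 : (0 : ℝ) < n := by exact_mod_cast hn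
  have hder : ∀ j : ℕ, ∀ x : ℝ, 0 < x →
      HasDerivAt (fun x : ℝ => (-1) ^ j * (j ! : ℂ) * risingCoeff j s * (x : ℂ) ^ (-s - j))
      ((-1) ^ (j + 1) * ((j + 1)! : ℂ) * risingCoeff (j + 1) s * (x : ℂ) ^ (-s - (j + 1 : ℕ))) x := by
    intro j x hx
    have h1 := (hasDerivAt_ofReal_cpow_neg (s + j) hx).const_mul
      ((-1) ^ j * (j ! : ℂ) * risingCoeff j s)
    have e1 : -(s + (j : ℂ)) = -s - j := by ring
    have e2 : -s - (j : ℂ) - 1 = -s - (j + 1 : ℕ) := by push_cast; ring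
    rw [e1, e2] at h1
    refine h1.congr_deriv ?_
    have := risingCoeff_succ j s
    rw [Nat.factorial_succ]
    push_cast
    linear_combination (-(-1) ^ (j + 1) * (j ! : ℂ) * (x : ℂ) ^ (-s - (j + 1 : ℂ))) * this
  have h1 := h (fun j x => (-1) ^ j * (j ! : ℂ) * risingCoeff j s * (x : ℂ) ^ (-s - j)) n N hnN
    (fun j _ x hx => (hder j x (hn0.trans_le hx.1)).continuousAt.continuousWithinAt)
    (fun j _ x hx => hder j x (hn0.trans hx.1))
  refine le_trans (le_of_eq ?_) (h1.trans (le_of_eq ?_))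
  · congr 1
    congr 1
    · simp
    · refine Finset.sum_congr rfl fun j _ => ?_
      rw [← riemannZeta_neg_nat_mul_risingCoeff]
      push_cast; ring
  · rw [mul_assoc C, mul_assoc C]
    congr 1
    rw [← intervalIntegral.integral_const_mul]
    apply integral_congr
    intro x hx
    rw [uIcc_of_le (by exact_mod_cast hnN)] at hx
    have hx0 : 0 < x := hn0.trans_le hx.1
    simp only [norm_mul, norm_pow, norm_neg, norm_one, one_pow, one_mul, Complex.norm_natCast]
    rw [Complex.norm_cpow_eq_rpow_re_of_pos hx0]
    simp

open MeasureTheory intervalIntegral Set in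
theorem integral_rpow_neg_le {a : ℝ} (ha : 1 ≤ a) {n N : ℕ} (hn : 1 ≤ n) (hnN : n ≤ N) :
    ∫ x in (n : ℝ)..N, x ^ (-a - 1) ≤ (n : ℝ) ^ (-a) := by
  have hn0 : (0 : ℝ) < n := by exact_mod_cast hn
  have hN0 : (0 : ℝ) < N := hn0.trans_le (by exact_mod_cast hnN)
  have hle : (n : ℝ) ≤ N := by exact_mod_cast hnN
  rw [integral_rpow]
  · have e : -a - 1 + 1 = -a := by ring
    rw [e, div_neg, ← neg_div, neg_sub]
    refine (div_le_self ?_ ha).trans ?_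
    · exact sub_nonneg.2 (Real.rpow_le_rpow_of_nonpos hn0 hle (by linarith))
    · have := Real.rpow_nonneg hN0.le (-a)
      linarith
  · right
    refine ⟨by linarith, ?_⟩
    rw [uIcc_of_le hle]
    intro h
    exact absurd h.1 (not_le.2 hn0)

/-- `s - 1` times the partial sum of the zeta series, corrected by its Euler–Maclaurin terms. -/
noncomputable def correctedZetaSum (K : ℕ) (s : ℂ) (n : ℕ) : ℂ :=
  (s - 1) * ∑ k ∈ Finset.Ico 1 n, (k : ℂ) ^ (-s) + (n : ℂ) ^ (1 - s)
    - (s - 1) * ∑ j ∈ Finset.range (K + 1), riemannZeta (-j) * risingCoeff j s * (n : ℂ) ^ (-s - j)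

/-- The factor `s - 1` clears the denominator of the antiderivative `x^(1-s)/(1-s)`, so the
corrected sums are entire in `s` and the Cauchy estimate includes `s = 1`. -/
theorem norm_correctedZetaSum_sub_le (K : ℕ) : ∃ C : ℝ, 0 ≤ C ∧ ∀ (s : ℂ) (n N : ℕ),
    1 ≤ s.re + K → 1 ≤ n → n ≤ N →
    ‖correctedZetaSum K s N - correctedZetaSum K s n‖
      ≤ ‖s - 1‖ * (C * ‖risingCoeff (K + 1) s‖ * (n : ℝ) ^ (-(s.re + K))) := by
  obtain ⟨C, hC, h⟩ := norm_sum_cpow_Ico_sub_le K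
  refine ⟨C, hC, fun s n N hs hn hnN => ?_⟩
  rcases eq_or_ne s 1 with rfl | hs1
  · simp [correctedZetaSum]
  have hn0 : (0 : ℝ) < n := by exact_mod_cast hn
  have hle : (n : ℝ) ≤ N := by exact_mod_cast hnN
  have h1 := h s n N hn hnN
  have h2 := integral_rpow_neg_le hs hn hnN
  have e1 : -(s.re + (K : ℝ)) - 1 = -s.re - (K + 1) := by ring
  rw [e1] at h2
  have h3 := h1.trans (mul_le_mul_of_nonneg_left h2 (by positivity))
  refine le_trans (le_of_eq ?_) (mul_le_mul_of_nonneg_left h3 (norm_nonneg (s - 1)))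
  rw [← norm_mul]
  congr 1
  have hs0 : 1 - s ≠ 0 := sub_ne_zero.2 hs1.symm
  rw [integral_cpow]
  · have e2 : -s + 1 = 1 - s := by ring
    have hsplit := Finset.sum_Ico_consecutive (fun k : ℕ => (k : ℂ) ^ (-s)) hn hnN
    rw [e2]
    simp only [correctedZetaSum, ← hsplit, mul_sub, Finset.sum_sub_distrib, Complex.ofReal_natCast]
    field_simp
    ring
  · right
    refine ⟨fun h => hs1 (by simpa using congrArg Neg.neg h), ?_⟩
    rw [Set.uIcc_of_le hle]
    exact fun h => absurd h.1 (not_le.2 hn0)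

theorem differentiable_correctedZetaSum (K : ℕ) {n : ℕ} (hn : 1 ≤ n) :
    Differentiable ℂ fun s => correctedZetaSum K s n := by
  have hp : ∀ k : ℕ, 1 ≤ k → ∀ {g : ℂ → ℂ}, Differentiable ℂ g →
      Differentiable ℂ fun s => (k : ℂ) ^ g s := fun k hk g hg =>
    hg.const_cpow (Or.inl (by exact_mod_cast (by omega : k ≠ 0)))
  unfold correctedZetaSum
  refine ((((differentiable_id.sub_const 1).mul ?_).add (hp n hn (by fun_prop))).sub
    ((differentiable_id.sub_const 1).mul ?_))
  · exact Differentiable.fun_sum fun k hk => hp k (Finset.mem_Ico.1 hk).1 (by fun_prop)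
  · exact Differentiable.fun_sum fun j _ =>
      ((differentiable_risingCoeff j).const_mul _).mul (hp n hn (by fun_prop))

/-- The residue `1` of `ζ` makes the singularity removable. This entire function is the other side
of the identity theorem in `tendsto_correctedZetaSum`. -/
theorem differentiable_update_sub_one_mul_riemannZeta :
    Differentiable ℂ (Function.update (fun s : ℂ => (s - 1) * riemannZeta s) 1 1) := by
  rw [← differentiableOn_univ,
    ← Complex.differentiableOn_compl_singleton_and_continuousAt_iff (c := 1) univ_mem]
  constructor
  · intro s hs
    have hs1 : s ≠ 1 := hs.2
    have : DifferentiableAt ℂ (fun s : ℂ => (s - 1) * riemannZeta s) s :=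
      (differentiableAt_id.sub_const 1).mul (differentiableAt_riemannZeta hs1)
    refine (this.congr_of_eventuallyEq ?_).differentiableWithinAt
    filter_upwards [isOpen_ne.mem_nhds hs1] with t ht
    exact Function.update_of_ne ht _ _
  · exact continuousAt_update_same.2 riemannZeta_residue_one

theorem tendsto_natCast_cpow_zero {s : ℂ} (hs : s.re < 0) :
    Tendsto (fun n : ℕ => (n : ℂ) ^ s) atTop (nhds 0) := by
  rw [tendsto_zero_iff_norm_tendsto_zero]
  have := (tendsto_rpow_neg_atTop (y := -s.re) (by linarith)).comp tendsto_natCast_atTop_atTop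
  refine this.congr' ?_
  filter_upwards [eventually_ge_atTop 1] with n hn
  rw [Complex.norm_natCast_cpow_of_pos (by omega)]
  simp

theorem tendsto_sum_Ico_cpow {s : ℂ} (hs : 1 < s.re) :
    Tendsto (fun n : ℕ => ∑ k ∈ Finset.Ico 1 n, (k : ℂ) ^ (-s)) atTop (nhds (riemannZeta s)) := by
  have h1 := (Complex.summable_one_div_nat_cpow.2 hs).hasSum.tendsto_sum_nat
  rw [← zeta_eq_tsum_one_div_nat_cpow hs] at h1
  refine h1.congr' ?_
  filter_upwards [eventually_ge_atTop 1] with n hn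
  rw [Finset.range_eq_Ico, Finset.sum_eq_sum_Ico_succ_bot (by omega)]
  have : s ≠ 0 := by rintro rfl; simp at hs; linarith
  simp [Complex.zero_cpow this, Complex.cpow_neg]

theorem tendsto_correctedZetaSum_of_one_lt (K : ℕ) {s : ℂ} (hs : 1 < s.re) :
    Tendsto (correctedZetaSum K s) atTop (nhds ((s - 1) * riemannZeta s)) := by
  have h1 := (tendsto_sum_Ico_cpow hs).const_mul (s - 1)
  have h2 : Tendsto (fun n : ℕ => (n : ℂ) ^ (1 - s)) atTop (nhds 0) :=
    tendsto_natCast_cpow_zero (by simp; linarith)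
  have h3 : Tendsto (fun n : ℕ => (s - 1) * ∑ j ∈ Finset.range (K + 1),
      riemannZeta (-j) * risingCoeff j s * (n : ℂ) ^ (-s - j)) atTop
      (nhds ((s - 1) * ∑ j ∈ Finset.range (K + 1), riemannZeta (-j) * risingCoeff j s * 0)) :=
    (tendsto_finsetSum _ fun j _ => (tendsto_natCast_cpow_zero (by
      simp only [Complex.sub_re, Complex.neg_re, Complex.natCast_re]
      have : (0 : ℝ) ≤ j := by positivity
      linarith)).const_mul _).const_mul _
  have h4 := (h1.add h2).sub h3
  simp only [mul_zero, Finset.sum_const_zero, add_zero, sub_zero] at h4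
  exact h4

/-- Consecutive differences are `O(1/n^2)` locally uniformly, so the limit is holomorphic. It agrees
with `(s-1) ζ(s)` near `2`, where the series converges, hence everywhere on the region. -/
theorem tendsto_correctedZetaSum (K : ℕ) {s : ℂ} (hs : 2 < s.re + K) (hs1 : s ≠ 1) :
    Tendsto (correctedZetaSum K s) atTop (nhds ((s - 1) * riemannZeta s)) := by
  obtain ⟨C, hC, h⟩ := norm_correctedZetaSum_sub_le K
  set R : ℝ := ‖s‖ + 3 with hR
  -- Convexity supplies the connectedness for the identity theorem, boundedness a uniform bound on
  -- the rising factorial; the radius `‖s‖ + 3` leaves room for both `s` and `2`.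
  set W : Set ℂ := {w | 2 - (K : ℝ) < w.re} ∩ Metric.ball 0 R with hW
  have hWo : IsOpen W := (isOpen_lt continuous_const Complex.continuous_re).inter Metric.isOpen_ball
  have hWc : Convex ℝ W := (convex_halfSpace_re_gt _).inter (convex_ball 0 R)
  obtain ⟨P, hP⟩ := (isCompact_closedBall (0 : ℂ) R).exists_bound_of_continuousOn
    (differentiable_risingCoeff (K + 1)).continuous.continuousOn
  have hP0 : 0 ≤ P := (norm_nonneg _).trans (hP 0 (by simp; positivity))
  set F : ℕ → ℂ → ℂ := fun n w =>
    correctedZetaSum K w (n + 2) - correctedZetaSum K w (n + 1) with hF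
  have hFle : ∀ n, ∀ w ∈ W, ‖F n w‖ ≤ (R + 1) * (C * P) * (1 / ((n + 1 : ℕ) : ℝ) ^ 2) := by
    intro n w hw
    have hw1 : 2 - (K : ℝ) < w.re := hw.1
    have hw2 : ‖w‖ < R := by simpa using hw.2
    have h1 := h w (n + 1) (n + 2) (by linarith) (by omega) (by omega)
    refine h1.trans ?_
    have h2 : ‖w - 1‖ ≤ R + 1 := (norm_sub_le _ _).trans (by simp; exact hw2.le)
    have h3 : ‖risingCoeff (K + 1) w‖ ≤ P := hP w (by simpa using hw2.le)
    have h4 : (((n + 1 : ℕ) : ℝ)) ^ (-(w.re + K)) ≤ 1 / ((n + 1 : ℕ) : ℝ) ^ 2 := by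
      have : (1 : ℝ) ≤ ((n + 1 : ℕ) : ℝ) := by exact_mod_cast Nat.succ_le_succ (Nat.zero_le n)
      rw [one_div, ← Real.rpow_natCast, ← Real.rpow_neg (by positivity)]
      exact Real.rpow_le_rpow_of_exponent_le this (by push_cast; linarith)
    rw [mul_assoc (R + 1)]
    gcongr
  have hsum : Summable fun n : ℕ => (R + 1) * (C * P) * (1 / ((n + 1 : ℕ) : ℝ) ^ 2) := by
    apply Summable.mul_left
    exact (summable_nat_add_iff 1).2 (Real.summable_one_div_nat_pow.2 one_lt_two)
  have hFd : ∀ n, DifferentiableOn ℂ (F n) W := fun n =>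
    ((differentiable_correctedZetaSum K (by omega)).sub
      (differentiable_correctedZetaSum K (by omega))).differentiableOn
  have hdiff := Complex.differentiableOn_tsum_of_summable_norm hsum hFd hWo hFle
  have htend : ∀ w ∈ W, Tendsto (correctedZetaSum K w) atTop
      (nhds (correctedZetaSum K w 1 + ∑' n, F n w)) := by
    intro w hw
    have h1 : Summable fun n => F n w :=
      Summable.of_norm_bounded hsum fun n => hFle n w hw
    have h2 := h1.hasSum.tendsto_sum_nat.const_add (correctedZetaSum K w 1)
    rw [← tendsto_add_atTop_iff_nat 1]
    refine h2.congr fun n => ?_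
    have := Finset.sum_range_sub (fun n => correctedZetaSum K w (n + 1)) n
    simp only [hF]
    rw [this]; ring
  have hA : AnalyticOnNhd ℂ (fun w => correctedZetaSum K w 1 + ∑' n, F n w) W :=
    (((differentiable_correctedZetaSum K le_rfl).differentiableOn).add hdiff).analyticOnNhd hWo
  have hB : AnalyticOnNhd ℂ (Function.update (fun s : ℂ => (s - 1) * riemannZeta s) 1 1) W :=
    differentiable_update_sub_one_mul_riemannZeta.differentiableOn.analyticOnNhd hWo
  have hsW : s ∈ W := ⟨by simp; linarith, by simp [hR]⟩
  -- For `K = 0` the point `2` is on the boundary, but then `Re s > 2` and the series converges at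
  -- `s` itself.
  have h2W : (2 : ℂ) ∈ W ∨ K = 0 := by
    rcases Nat.eq_zero_or_pos K with h0 | h0
    · exact Or.inr h0
    · left
      have : (1 : ℝ) ≤ K := by exact_mod_cast h0
      refine ⟨by simp; linarith, ?_⟩
      simp [hR]; linarith [norm_nonneg s]
  rcases h2W with h2W | h0
  · have heq := hA.eqOn_of_preconnected_of_eventuallyEq hB hWc.isPreconnected h2W (by
      have : {w : ℂ | 1 < w.re} ∈ nhds (2 : ℂ) :=
        (isOpen_lt continuous_const Complex.continuous_re).mem_nhds (by simp)
      filter_upwards [this, hWo.mem_nhds h2W] with w hw hwW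
      have hw' : 1 < w.re := hw
      have hw1 : w ≠ 1 := by rintro rfl; simp at hw'
      rw [Function.update_of_ne hw1]
      exact tendsto_nhds_unique (htend w hwW) (tendsto_correctedZetaSum_of_one_lt K hw))
    have h3 := htend s hsW
    have h4 := heq hsW
    simp only [Function.update_of_ne hs1] at h4
    rwa [h4] at h3
  · apply tendsto_correctedZetaSum_of_one_lt
    subst h0; simp at hs; linarith

/-- The Euler–Maclaurin expansion of the partial sums of the zeta series. -/
theorem norm_sum_cpow_sub_riemannZeta_le (K : ℕ) : ∃ C : ℝ, 0 ≤ C ∧ ∀ (s : ℂ) (n : ℕ),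
    2 < s.re + K → s ≠ 1 → 1 ≤ n →
    ‖(∑ k ∈ Finset.Ico 1 n, (k : ℂ) ^ (-s)) - (riemannZeta s + (n : ℂ) ^ (1 - s) / (1 - s)
      + ∑ j ∈ Finset.range (K + 1), riemannZeta (-j) * risingCoeff j s * (n : ℂ) ^ (-s - j))‖
      ≤ C * ‖risingCoeff (K + 1) s‖ * (n : ℝ) ^ (-(s.re + K)) := by
  obtain ⟨C, hC, h⟩ := norm_correctedZetaSum_sub_le K
  refine ⟨C, hC, fun s n hs hs1 hn => ?_⟩
  have h1 : ‖(s - 1) * riemannZeta s - correctedZetaSum K s n‖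
      ≤ ‖s - 1‖ * (C * ‖risingCoeff (K + 1) s‖ * (n : ℝ) ^ (-(s.re + K))) := by
    refine le_of_tendsto ((tendsto_correctedZetaSum K hs hs1).sub_const _).norm ?_
    filter_upwards [eventually_ge_atTop n] with N hN
    exact h s n N (by linarith) hn hN
  have hs0 : 0 < ‖s - 1‖ := norm_pos_iff.2 (sub_ne_zero.2 hs1)
  refine le_of_mul_le_mul_left (le_trans (le_of_eq ?_) h1) hs0
  rw [← norm_mul, ← norm_neg]
  congr 1
  have : 1 - s ≠ 0 := sub_ne_zero.2 hs1.symm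
  unfold correctedZetaSum
  field_simp
  ring

/-- At `s = 1` the integral is a logarithm, and the constant is identified by letting the upper end
`N` go to infinity in the Euler–Maclaurin estimate. -/
theorem norm_sum_inv_sub_log_le (K : ℕ) : ∃ C : ℝ, 0 ≤ C ∧ ∀ n : ℕ, 1 ≤ n →
    ‖(∑ k ∈ Finset.Ico 1 n, (k : ℂ) ^ (-1 : ℂ)) - (Real.log n + Real.eulerMascheroniConstant
      + ∑ j ∈ Finset.range (K + 1), riemannZeta (-j) * risingCoeff j 1 * (n : ℂ) ^ (-1 - j : ℂ))‖
      ≤ C * (n : ℝ) ^ (-(1 + K : ℝ)) := by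
  obtain ⟨C, hC, h⟩ := norm_sum_cpow_Ico_sub_le K
  refine ⟨C * ‖risingCoeff (K + 1) 1‖, by positivity, fun n hn => ?_⟩
  set S : ℕ → ℂ := fun n => ∑ k ∈ Finset.Ico 1 n, (k : ℂ) ^ (-1 : ℂ)
  set E : ℕ → ℂ := fun n => ∑ j ∈ Finset.range (K + 1),
    riemannZeta (-j) * risingCoeff j 1 * (n : ℂ) ^ (-1 - j : ℂ)
  have hE : Tendsto E atTop (nhds 0) := by
    have : Tendsto E atTop
      (nhds (∑ j ∈ Finset.range (K + 1), riemannZeta (-j) * risingCoeff j 1 * 0)) :=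
      tendsto_finsetSum _ fun j _ => (tendsto_natCast_cpow_zero (by
        simp only [Complex.sub_re, Complex.neg_re, Complex.natCast_re, Complex.one_re]
        have : (0 : ℝ) ≤ j := by positivity
        linarith)).const_mul _
    simpa using this
  have hS : Tendsto (fun n : ℕ => S n - Real.log n) atTop
      (nhds (Real.eulerMascheroniConstant : ℂ)) := by
    have h1 := (Complex.continuous_ofReal.tendsto _).comp Real.tendsto_harmonic_sub_log
    have h2 : Tendsto (fun n : ℕ => (n : ℂ) ^ (-1 : ℂ)) atTop (nhds 0) :=
      tendsto_natCast_cpow_zero (by simp)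
    have h3 := h1.sub h2
    rw [sub_zero] at h3
    refine h3.congr' ?_
    filter_upwards [eventually_ge_atTop 1] with n hn
    simp only [Function.comp, S, harmonic_eq_sum_Icc]
    rw [← Finset.Ico_succ_right_eq_Icc]
    change ((((∑ i ∈ Finset.Ico 1 (n + 1), (i : ℚ)⁻¹ : ℚ) : ℝ) - Real.log n : ℝ) : ℂ) - _ = _
    rw [Finset.sum_Ico_succ_top hn]
    simp [Complex.cpow_neg_one]
    ring
  have hn0 : (0 : ℝ) < n := by exact_mod_cast hn
  have hlim : Tendsto (fun N : ℕ => (S N - Real.log N - E N) - (S n - Real.log n - E n)) atTop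
      (nhds ((Real.eulerMascheroniConstant : ℂ) - 0 - (S n - Real.log n - E n))) :=
    (hS.sub hE).sub_const _
  rw [← norm_neg]
  have e0 : -(S n - (Real.log n + Real.eulerMascheroniConstant + E n))
    = (Real.eulerMascheroniConstant : ℂ) - 0 - (S n - Real.log n - E n) := by ring
  rw [e0]
  refine le_of_tendsto hlim.norm ?_
  filter_upwards [eventually_ge_atTop n] with N hN
  have hle : (n : ℝ) ≤ N := by exact_mod_cast hN
  have h1 := h 1 n N hn hN
  have h2 := integral_rpow_neg_le (a := 1 + K) (by linarith [(Nat.cast_nonneg K : (0 : ℝ) ≤ K)])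
    hn hN
  have e1 : -(1 + (K : ℝ)) - 1 = -(1 : ℂ).re - (K + 1) := by simp; ring
  rw [e1] at h2
  refine le_trans (le_of_eq ?_) (h1.trans (mul_le_mul_of_nonneg_left h2 (by positivity)))
  congr 1
  have e2 : ∫ x in (n : ℝ)..N, (x : ℂ) ^ (-1 : ℂ) = Real.log N - Real.log n := by
    have : ∀ x : ℝ, (x : ℂ) ^ (-1 : ℂ) = ((x⁻¹ : ℝ) : ℂ) := fun x => by
      rw [Complex.cpow_neg_one, Complex.ofReal_inv]
    simp only [this]
    rw [intervalIntegral.integral_ofReal, integral_inv_of_pos hn0 (hn0.trans_le hle),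
      Real.log_div (hn0.trans_le hle).ne' hn0.ne']
    push_cast; ring
  have hsplit := Finset.sum_Ico_consecutive (fun k : ℕ => (k : ℂ) ^ (-1 : ℂ)) hn hN
  rw [e2]
  simp only [S, E, ← hsplit, mul_sub, Finset.sum_sub_distrib]
  ring

/-! ### Taylor quotients of `(1-y)^(-s)`: derivatives, bounds and endpoint values. -/

/-- The Taylor remainder of order `a` at `y = 0` of `(1 - y) ^ (-s)`. -/
noncomputable def binomRem (a : ℕ) (s : ℂ) (y : ℝ) : ℂ :=
  ((1 - y : ℝ) : ℂ) ^ (-s) - ∑ i ∈ Finset.range a, risingCoeff i s * (y : ℂ) ^ i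

/-- The Taylor remainder of order `a` of `(1 - y) ^ (-s)`, divided by `y ^ a`. -/
noncomputable def binomQuot (a : ℕ) (s : ℂ) (y : ℝ) : ℂ :=
  if y = 0 then risingCoeff a s else binomRem a s y / (y : ℂ) ^ a

theorem binomRem_eq_add (a : ℕ) (s : ℂ) (y : ℝ) :
    binomRem a s y = binomRem (a + 1) s y + risingCoeff a s * (y : ℂ) ^ a := by
  simp only [binomRem, Finset.sum_range_succ]; ring

theorem binomQuot_eq_add (a : ℕ) (s : ℂ) (y : ℝ) :
    binomQuot a s y = risingCoeff a s + y * binomQuot (a + 1) s y := by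
  rcases eq_or_ne y 0 with rfl | hy
  · simp [binomQuot]
  · have : (y : ℂ) ≠ 0 := by exact_mod_cast hy
    simp only [binomQuot, if_neg hy, binomRem_eq_add a]
    field_simp
    ring

theorem hasDerivAt_one_sub_cpow (s : ℂ) {y : ℝ} (hy : y < 1) :
    HasDerivAt (fun y : ℝ => ((1 - y : ℝ) : ℂ) ^ (-s)) (s * ((1 - y : ℝ) : ℂ) ^ (-(s + 1))) y := by
  have h := (hasDerivAt_ofReal_cpow_neg s (sub_pos.2 hy)).scomp y
    ((hasDerivAt_id y).const_sub 1)
  refine h.congr_deriv ?_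
  simp only [neg_smul, one_smul]
  rw [neg_add]
  ring_nf

theorem hasDerivAt_binomRem (a : ℕ) (s : ℂ) {y : ℝ} (hy : y < 1) :
    HasDerivAt (binomRem (a + 1) s) (s * binomRem a (s + 1) y) y := by
  have h2 : HasDerivAt (fun y : ℝ => ∑ i ∈ Finset.range (a + 1), risingCoeff i s * (y : ℂ) ^ i)
      (∑ i ∈ Finset.range (a + 1), risingCoeff i s * (i * (y : ℂ) ^ (i - 1))) y :=
    HasDerivAt.fun_sum fun i _ =>
      ((hasDerivAt_pow i (y : ℂ)).comp_ofReal).const_mul _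
  refine ((hasDerivAt_one_sub_cpow s hy).sub h2).congr_deriv ?_
  rw [Finset.sum_range_succ']
  simp only [binomRem, mul_sub, Finset.mul_sum]
  simp only [Nat.cast_zero, zero_mul, mul_zero, add_zero]
  congr 1
  refine Finset.sum_congr rfl fun i _ => ?_
  have := risingCoeff_succ' i s
  push_cast
  linear_combination (y : ℂ) ^ i * this

/-- The product rule gives two terms singular like `1/y`; they cancel by `risingCoeff_succ'`. What
is left are again Taylor quotients, so all derivatives stay in the family, at the price of raising
`a` or `s` by one. -/
theorem hasDerivAt_binomQuot (a : ℕ) (s : ℂ) {y : ℝ} (hy0 : 0 < y) (hy : y < 1) :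
    HasDerivAt (binomQuot (a + 1) s)
      (-(a + 1 : ℕ) * binomQuot (a + 2) s y + s * binomQuot (a + 1) (s + 1) y) y := by
  have hyc : (y : ℂ) ≠ 0 := by exact_mod_cast hy0.ne'
  have h1 := (hasDerivAt_binomRem a s hy).div ((hasDerivAt_pow (a + 1) (y : ℂ)).comp_ofReal)
    (pow_ne_zero _ hyc)
  have h2 : binomQuot (a + 1) s =ᶠ[nhds y] fun y => binomRem (a + 1) s y / (y : ℂ) ^ (a + 1) := by
    filter_upwards [lt_mem_nhds hy0] with t ht
    rw [binomQuot, if_neg ht.ne']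
  refine (h1.congr_of_eventuallyEq h2).congr_deriv ?_
  simp only [binomQuot, if_neg hy0.ne']
  rw [binomRem_eq_add a (s + 1), binomRem_eq_add (a + 1) s]
  have := risingCoeff_succ' a s
  push_cast
  field_simp
  linear_combination (-y ^ (3 * a + 3) : ℂ) * this

theorem continuous_one_sub_cpow {s : ℂ} (hs : s.re < 0) :
    Continuous fun y : ℝ => ((1 - y : ℝ) : ℂ) ^ (-s) :=
  (Complex.continuous_ofReal_cpow_const (by simpa using hs)).comp (continuous_const.sub continuous_id)

theorem continuous_binomRem (a : ℕ) {s : ℂ} (hs : s.re < 0) : Continuous (binomRem a s) := by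
  unfold binomRem
  have := continuous_one_sub_cpow hs
  fun_prop

/-- Mean value inequality and induction: the derivative of a remainder is `s` times the remainder of
one order less at `s + 1`. The condition `Re s + a ≤ 0` keeps the derivatives bounded up to `y = 1`.
-/
theorem norm_binomRem_le (a : ℕ) : ∀ {s : ℂ}, s.re + a ≤ 0 → s.re < 0 → ∀ y ∈ Set.Icc (0 : ℝ) 1,
    ‖binomRem a s y‖ ≤ (∏ l ∈ Finset.range a, ‖s + l‖) * y ^ a := by
  induction a with
  | zero =>
    intro s hs hs' y hy
    simp only [binomRem, Finset.range_zero, Finset.sum_empty, sub_zero, Finset.prod_empty,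
      pow_zero, mul_one]
    rcases eq_or_lt_of_le hy.2 with rfl | h1
    · rw [sub_self, Complex.ofReal_zero, Complex.zero_cpow]
      · simp
      · rintro h; simp [neg_eq_zero.1 h] at hs'
    · rw [Complex.norm_cpow_eq_rpow_re_of_pos (by linarith)]
      exact Real.rpow_le_one (by linarith) (by linarith [hy.1]) (by simpa using hs'.le)
  | succ a ih =>
    intro s hs hs' y hy
    push_cast at hs
    rcases eq_or_lt_of_le hy.1 with rfl | hy0
    · simp [binomRem, Finset.sum_range_succ']
    have hb : ∀ t ∈ Set.Ico (0 : ℝ) y,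
        ‖s * binomRem a (s + 1) t‖ ≤ ‖s‖ * ((∏ l ∈ Finset.range a, ‖s + 1 + l‖) * y ^ a) := by
      intro t ht
      rw [norm_mul]
      rcases Nat.eq_zero_or_pos a with rfl | ha
      · have h0 : s.re + 1 ≤ 0 := by simpa using hs
        simp only [binomRem, Finset.range_zero, Finset.sum_empty, sub_zero, Finset.prod_empty,
          pow_zero, mul_one]
        refine mul_le_of_le_one_right (norm_nonneg _) ?_
        rw [Complex.norm_cpow_eq_rpow_re_of_pos (by linarith [ht.2, hy.2])]
        exact Real.rpow_le_one (by linarith [ht.2, hy.2]) (by linarith [ht.1])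
          (by simp; linarith)
      · have ha' : (1 : ℝ) ≤ a := by exact_mod_cast ha
        have := ih (s := s + 1) (by simp; linarith) (by simp; linarith) t
          ⟨ht.1, (ht.2.le.trans hy.2)⟩
        refine mul_le_mul_of_nonneg_left (this.trans ?_) (norm_nonneg _)
        have := ht.1
        have := ht.2.le
        gcongr
    have h1 := norm_image_sub_le_of_norm_deriv_right_le_segment
      (f := binomRem (a + 1) s) (a := 0) (b := y)
      (continuous_binomRem (a + 1) hs').continuousOn
      (fun t ht => (hasDerivAt_binomRem a s (ht.2.trans_le hy.2)).hasDerivWithinAt) hb y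
      ⟨hy0.le, le_rfl⟩
    have h0 : binomRem (a + 1) s 0 = 0 := by simp [binomRem, Finset.sum_range_succ']
    rw [h0, sub_zero, sub_zero] at h1
    refine h1.trans (le_of_eq ?_)
    rw [Finset.prod_range_succ']
    simp only [Nat.cast_zero, add_zero, Nat.cast_add, Nat.cast_one]
    have : ∀ l : ℕ, s + 1 + (l : ℂ) = s + (l + 1) := fun l => by ring
    simp only [this]
    ring

theorem risingCoeff_bound (a : ℕ) (s : ℂ) :
    ‖risingCoeff a s‖ ≤ ∏ l ∈ Finset.range a, ‖s + l‖ := by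
  rw [risingCoeff, norm_prod]
  refine Finset.prod_le_prod (fun _ _ => norm_nonneg _) fun l _ => ?_
  rw [norm_div]
  refine div_le_self (norm_nonneg _) ?_
  have : (l : ℂ) + 1 = ((l + 1 : ℕ) : ℂ) := by push_cast; rfl
  rw [this, Complex.norm_natCast]
  exact_mod_cast Nat.succ_le_succ (Nat.zero_le l)

theorem norm_binomQuot_le (a : ℕ) {s : ℂ} (hs : s.re + a ≤ 0) (hs' : s.re < 0) {y : ℝ}
    (hy : y ∈ Set.Icc (0 : ℝ) 1) : ‖binomQuot a s y‖ ≤ ∏ l ∈ Finset.range a, ‖s + l‖ := by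
  rcases eq_or_lt_of_le hy.1 with rfl | hy0
  · simpa [binomQuot] using risingCoeff_bound a s
  · rw [binomQuot, if_neg hy0.ne', norm_div, norm_pow, Complex.norm_real, Real.norm_of_nonneg hy.1,
      div_le_iff₀ (by positivity)]
    exact norm_binomRem_le a hs hs' y hy

/-- At `y = 0` the deviation from the limit value is `y` times the next quotient, whose bound costs
one more unit of `Re s`. -/
theorem continuousOn_binomQuot (a : ℕ) {s : ℂ} (hs : s.re + a + 1 ≤ 0) :
    ContinuousOn (binomQuot a s) (Set.Icc 0 1) := by
  have ha : (0 : ℝ) ≤ a := by positivity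
  intro y hy
  rcases eq_or_lt_of_le hy.1 with rfl | hy0
  · have h1 : ∀ t ∈ Set.Icc (0 : ℝ) 1, ‖binomQuot a s t - binomQuot a s 0‖
        ≤ t * ∏ l ∈ Finset.range (a + 1), ‖s + l‖ := by
      intro t ht
      rw [binomQuot_eq_add a s t, binomQuot_eq_add a s 0]
      simp only [Complex.ofReal_zero, zero_mul, add_zero, add_sub_cancel_left, norm_mul,
        Complex.norm_real, Real.norm_of_nonneg ht.1]
      exact mul_le_mul_of_nonneg_left
        (norm_binomQuot_le (a + 1) (by push_cast; linarith) (by linarith) ht) ht.1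
    rw [ContinuousWithinAt, tendsto_iff_norm_sub_tendsto_zero]
    refine squeeze_zero' (Eventually.of_forall fun _ => norm_nonneg _)
      (eventually_mem_nhdsWithin.mono h1) ?_
    have : Tendsto (fun t : ℝ => t * ∏ l ∈ Finset.range (a + 1), ‖s + l‖) (nhds 0)
        (nhds (0 * ∏ l ∈ Finset.range (a + 1), ‖s + l‖)) := tendsto_id.mul_const _
    rw [zero_mul] at this
    exact this.mono_left nhdsWithin_le_nhds
  · have h2 : binomQuot a s =ᶠ[nhds y] fun y => binomRem a s y / (y : ℂ) ^ a := by
      filter_upwards [lt_mem_nhds hy0] with t ht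
      rw [binomQuot, if_neg ht.ne']
    refine ContinuousAt.continuousWithinAt (ContinuousAt.congr ?_ h2.symm)
    exact ((continuous_binomRem a (by linarith)).continuousAt).div
      (by fun_prop) (pow_ne_zero _ (by exact_mod_cast hy0.ne'))

theorem binomQuot_zero (a : ℕ) (s : ℂ) : binomQuot a s 0 = risingCoeff a s := by simp [binomQuot]

theorem binomQuot_one (a : ℕ) {s : ℂ} (hs : s.re < 0) :
    binomQuot a s 1 = -∑ i ∈ Finset.range a, risingCoeff i s := by
  have : -s ≠ 0 := by rintro h; simp [neg_eq_zero.1 h] at hs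
  simp [binomQuot, binomRem, Complex.zero_cpow this]

/-- The `j`-th derivative of `binomQuot a s`. -/
noncomputable def binomQuotDeriv : ℕ → ℕ → ℂ → ℝ → ℂ
  | 0, a, s, y => binomQuot a s y
  | j + 1, a, s, y => -(a : ℂ) * binomQuotDeriv j (a + 1) s y + s * binomQuotDeriv j a (s + 1) y

theorem hasDerivAt_binomQuotDeriv (j : ℕ) : ∀ (a : ℕ) (s : ℂ) {y : ℝ}, 1 ≤ a → 0 < y → y < 1 →
    HasDerivAt (binomQuotDeriv j a s) (binomQuotDeriv (j + 1) a s y) y := by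
  induction j with
  | zero =>
    intro a s y ha hy0 hy
    obtain ⟨a, rfl⟩ := Nat.exists_eq_add_of_le' ha
    exact hasDerivAt_binomQuot a s hy0 hy
  | succ j ih =>
    intro a s y ha hy0 hy
    exact ((ih (a + 1) s (by omega) hy0 hy).const_mul _).add ((ih a (s + 1) ha hy0 hy).const_mul _)

theorem continuousOn_binomQuotDeriv (j : ℕ) : ∀ (a : ℕ) {s : ℂ}, s.re + a + j + 1 ≤ 0 →
    ContinuousOn (binomQuotDeriv j a s) (Set.Icc 0 1) := by
  induction j with
  | zero => intro a s hs; exact continuousOn_binomQuot a (by simpa using hs)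
  | succ j ih =>
    intro a s hs
    push_cast at hs
    exact ((ih (a + 1) (by push_cast; linarith)).const_mul _).add
      ((ih a (by simp; linarith)).const_mul _)

theorem norm_binomQuotDeriv_le (j : ℕ) : ∀ (a : ℕ) (R : ℝ), 0 ≤ R → ∃ C : ℝ, 0 ≤ C ∧
    ∀ s : ℂ, ‖s‖ ≤ R → s.re + a + j + 1 ≤ 0 → ∀ y ∈ Set.Icc (0 : ℝ) 1,
      ‖binomQuotDeriv j a s y‖ ≤ C := by
  induction j with
  | zero =>
    intro a R hR
    refine ⟨∏ l ∈ Finset.range a, (R + l), by positivity, fun s hs hs' y hy => ?_⟩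
    have ha : (0 : ℝ) ≤ a := by positivity
    simp only [Nat.cast_zero, add_zero] at hs'
    refine (norm_binomQuot_le a (by linarith) (by linarith) hy).trans ?_
    refine Finset.prod_le_prod (fun _ _ => norm_nonneg _) fun l _ => ?_
    refine (norm_add_le _ _).trans ?_
    simpa using hs
  | succ j ih =>
    intro a R hR
    obtain ⟨C₁, hC₁, h₁⟩ := ih (a + 1) R hR
    obtain ⟨C₂, hC₂, h₂⟩ := ih a (R + 1) (by linarith)
    refine ⟨a * C₁ + R * C₂, by positivity, fun s hs hs' y hy => ?_⟩
    push_cast at hs'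
    refine (norm_add_le _ _).trans ?_
    rw [norm_mul, norm_mul, norm_neg, Complex.norm_natCast]
    have := h₁ s hs (by push_cast; linarith) y hy
    have := h₂ (s + 1) ((norm_add_le _ _).trans (by simpa using hs)) (by simp; linarith) y hy
    gcongr

theorem binomQuotDeriv_zero_right (j : ℕ) : ∀ (a : ℕ) (s : ℂ),
    binomQuotDeriv j a s 0 = (j ! : ℂ) * risingCoeff (a + j) s := by
  induction j with
  | zero => intro a s; simp [binomQuotDeriv, binomQuot_zero]
  | succ j ih =>
    intro a s
    rw [binomQuotDeriv, ih, ih, Nat.factorial_succ]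
    have h := risingCoeff_succ' (a + j) s
    have e : a + 1 + j = a + j + 1 := by ring
    rw [e, ← add_assoc]
    push_cast at *
    linear_combination (-(j ! : ℂ)) * h

/-- At `y = 1` the function `(1-y)^(-s)` vanishes to order greater than `j`, so only the derivatives
of the subtracted terms `risingCoeff i s · y^(i-a)` survive. -/
theorem binomQuotDeriv_one_right (j : ℕ) : ∀ (a : ℕ) {s : ℂ}, s.re + j < 0 →
    binomQuotDeriv j a s 1 = -∑ i ∈ Finset.range a,
      risingCoeff i s * ((-1) ^ j * (j ! : ℂ) * risingCoeff j ((a : ℂ) - i)) := by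
  induction j with
  | zero =>
    intro a s hs
    simp [binomQuotDeriv, binomQuot_one a (show s.re < 0 by simpa using hs)]
  | succ j ih =>
    intro a s hs
    push_cast at hs
    have e : ∑ i ∈ Finset.range a, s * (risingCoeff i (s + 1) *
          ((-1) ^ j * (j ! : ℂ) * risingCoeff j ((a : ℂ) - i)))
        = ∑ i ∈ Finset.range (a + 1), i * (risingCoeff i s *
          ((-1) ^ j * (j ! : ℂ) * risingCoeff j ((a : ℂ) + 1 - i))) := by
      rw [Finset.sum_range_succ']
      simp only [Nat.cast_zero, zero_mul, add_zero]
      refine Finset.sum_congr rfl fun i _ => ?_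
      have := risingCoeff_succ' i s
      have e1 : (a : ℂ) + 1 - (i + 1 : ℕ) = a - i := by push_cast; ring
      rw [e1]
      push_cast
      linear_combination (-((-1) ^ j * (j ! : ℂ) * risingCoeff j ((a : ℂ) - i))) * this
    rw [binomQuotDeriv, ih _ (by linarith), ih _ (by simp; linarith), mul_neg s, Finset.mul_sum, e,
      neg_mul_neg, Finset.mul_sum, ← sub_eq_add_neg, Nat.cast_add_one, ← Finset.sum_sub_distrib,
      Finset.sum_range_succ, ← Finset.sum_neg_distrib]
    rw [add_eq_left.2 (by ring)]
    refine Finset.sum_congr rfl fun i _ => ?_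
    have := risingCoeff_succ' j ((a : ℂ) - i)
    have e2 : (a : ℂ) - i + 1 = a + 1 - i := by ring
    rw [e2] at this
    rw [Nat.factorial_succ]
    push_cast
    linear_combination (-risingCoeff i s * ((-1) ^ j * (j ! : ℂ))) * this

/-! ### The digamma-type series and the integral of the Taylor quotient. -/

/-- `∑_{k ≥ 1} (1 / (k - s) - 1 / k)`. -/
noncomputable def harmonicSeries (s : ℂ) : ℂ := ∑' k : ℕ, (1 / ((k : ℂ) + 1 - s) - 1 / ((k : ℂ) + 1))

theorem half_mul_le_norm_sub {s : ℂ} (hs : s.re ≤ 1 / 2) (k : ℕ) :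
    ((k : ℝ) + 1) / 2 ≤ ‖(k : ℂ) + 1 - s‖ := by
  refine le_trans ?_ (Complex.re_le_norm _)
  have : (0 : ℝ) ≤ k := by positivity
  simp
  linarith

theorem add_one_sub_ne_zero {s : ℂ} (hs : s.re ≤ 1 / 2) (k : ℕ) : (k : ℂ) + 1 - s ≠ 0 := by
  have h := half_mul_le_norm_sub hs k
  intro h0
  rw [h0, norm_zero] at h
  have : (0 : ℝ) ≤ k := by positivity
  linarith

theorem norm_harmonicSeries_term_le {s : ℂ} (hs : s.re ≤ 1 / 2) (k : ℕ) :
    ‖1 / ((k : ℂ) + 1 - s) - 1 / ((k : ℂ) + 1)‖ ≤ 2 * ‖s‖ * (1 / ((k + 1 : ℕ) : ℝ) ^ 2) := by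
  have h1 := half_mul_le_norm_sub hs k
  have h2 : (k : ℂ) + 1 ≠ 0 := by exact_mod_cast Nat.succ_ne_zero k
  have h3 := add_one_sub_ne_zero hs k
  have h4 : 1 / ((k : ℂ) + 1 - s) - 1 / ((k : ℂ) + 1) = s / (((k : ℂ) + 1 - s) * ((k + 1 : ℕ) : ℂ)) := by
    push_cast
    field_simp
    ring
  have hk : (0 : ℝ) < (k : ℝ) + 1 := by positivity
  rw [h4, norm_div, norm_mul, Complex.norm_natCast]
  push_cast
  rw [div_le_iff₀ (by have := norm_pos_iff.2 h3; positivity)]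
  calc ‖s‖ = 2 * ‖s‖ * (1 / ((k : ℝ) + 1) ^ 2) * (((k : ℝ) + 1) / 2 * ((k : ℝ) + 1)) := by
        field_simp
    _ ≤ _ := by gcongr

theorem summable_inv_succ_sq (c : ℝ) : Summable fun k : ℕ => c * (1 / ((k + 1 : ℕ) : ℝ) ^ 2) :=
  ((summable_nat_add_iff 1).2 (Real.summable_one_div_nat_pow.2 one_lt_two)).mul_left c

theorem hasSum_harmonicSeries {s : ℂ} (hs : s.re ≤ 1 / 2) :
    HasSum (fun k : ℕ => 1 / ((k : ℂ) + 1 - s) - 1 / ((k : ℂ) + 1)) (harmonicSeries s) :=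
  (Summable.of_norm_bounded (summable_inv_succ_sq _)
    (fun k => norm_harmonicSeries_term_le hs k)).hasSum

theorem harmonicSeries_sub_one {s : ℂ} (hs : s.re ≤ 1 / 2) :
    harmonicSeries (s - 1) = harmonicSeries s - 1 / (1 - s) := by
  have h1 := (hasSum_harmonicSeries hs).tendsto_sum_nat
  have h2 := (hasSum_harmonicSeries (s := s - 1) (by simp; linarith)).tendsto_sum_nat
  have h3 : Tendsto (fun k : ℕ => 1 / ((k : ℂ) + 1 - s)) atTop (nhds 0) := by
    refine squeeze_zero_norm (a := fun k : ℕ => 2 / ((k : ℝ) + 1)) (fun k => ?_) ?_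
    · have h1 := half_mul_le_norm_sub hs k
      have hk : (0 : ℝ) < (k : ℝ) + 1 := by positivity
      rw [norm_div, norm_one]
      calc 1 / ‖(k : ℂ) + 1 - s‖ ≤ 1 / (((k : ℝ) + 1) / 2) := by gcongr
        _ = _ := by field_simp
    · have := (tendsto_one_div_add_atTop_nhds_zero_nat (𝕜 := ℝ)).const_mul 2
      rw [mul_zero] at this
      exact this.congr fun k => by ring
  have h4 := (h1.add h3).sub_const (1 / (1 - s))
  rw [add_zero] at h4
  refine tendsto_nhds_unique h2 (h4.congr fun n => ?_)
  induction n with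
  | zero => simp
  | succ n ih =>
    rw [Finset.sum_range_succ, Finset.sum_range_succ, ← ih]
    have e : (n : ℂ) + 1 - (s - 1) = (n + 1 : ℕ) + 1 - s := by push_cast; ring
    rw [e]
    ring

theorem differentiableOn_harmonicSeries :
    DifferentiableOn ℂ harmonicSeries (Metric.ball 0 (1 / 2)) := by
  have hre : ∀ w ∈ Metric.ball (0 : ℂ) (1 / 2), w.re ≤ 1 / 2 := fun w hw =>
    (Complex.re_le_norm w).trans (by simpa using (mem_ball_zero_iff.1 hw).le)
  refine Complex.differentiableOn_tsum_of_summable_norm (summable_inv_succ_sq 1) (fun k => ?_)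
    Metric.isOpen_ball (fun k w hw => ?_)
  · intro w hw
    have := add_one_sub_ne_zero (hre w hw) k
    refine DifferentiableAt.differentiableWithinAt ?_
    exact (DifferentiableAt.div (by fun_prop) (by fun_prop) this).sub_const _
  · refine (norm_harmonicSeries_term_le (hre w hw) k).trans ?_
    have : 2 * ‖w‖ ≤ 1 := by linarith [mem_ball_zero_iff.1 hw]
    gcongr

open MeasureTheory Set in
-- Write `1/y = ∑ (1-y)^k` and integrate termwise. The remainder is at most `‖s‖ y`, so the `k`-th
-- integral is at most `‖s‖ / ((k+1)(k+2))` and the exchange is legitimate.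
theorem integral_binomQuot_one {s : ℂ} (hs : s.re + 2 ≤ 0) :
    ∫ y in (0 : ℝ)..1, binomQuot 1 s y = harmonicSeries s := by
  set F : ℕ → ℝ → ℂ := fun k y => ((1 - y : ℝ) : ℂ) ^ k * binomRem 1 s y with hF
  have hsre : s.re < 0 := by linarith
  have hFc : ∀ k, Continuous (F k) := fun k => by
    have := continuous_binomRem 1 hsre
    simp only [hF]
    fun_prop
  have hFi : ∀ k, Integrable (F k) (volume.restrict (Ioc 0 1)) := fun k =>
    (hFc k).integrableOn_Ioc
  have hFn : ∀ k, ∀ y ∈ Ioc (0 : ℝ) 1, ‖F k y‖ ≤ ‖s‖ * ((1 - y) ^ k * y) := by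
    intro k y hy
    have h1 := norm_binomRem_le 1 (s := s) (by push_cast; linarith) hsre y ⟨hy.1.le, hy.2⟩
    have h2 : (0 : ℝ) ≤ 1 - y := by linarith [hy.2]
    simp only [Finset.prod_range_one, Nat.cast_zero, add_zero, pow_one] at h1
    rw [norm_mul, norm_pow, Complex.norm_real, Real.norm_of_nonneg h2]
    calc _ ≤ (1 - y) ^ k * (‖s‖ * y) := by gcongr
      _ = _ := by ring
  have hpoly : ∀ k : ℕ, ∫ y in Ioc (0 : ℝ) 1, ‖s‖ * ((1 - y) ^ k * y)
      ≤ ‖s‖ * (1 / ((k + 1 : ℕ) : ℝ) ^ 2) := by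
    intro k
    rw [← intervalIntegral.integral_of_le zero_le_one, intervalIntegral.integral_const_mul]
    refine mul_le_mul_of_nonneg_left ?_ (norm_nonneg _)
    have e := intervalIntegral.integral_comp_sub_left (a := 0) (b := 1)
      (fun x : ℝ => x ^ k * (1 - x)) 1
    simp only [sub_sub_cancel, sub_self, sub_zero] at e
    rw [e]
    have e2 : ∀ x : ℝ, x ^ k * (1 - x) = x ^ k - x ^ (k + 1) := fun x => by ring
    simp only [e2]
    rw [intervalIntegral.integral_sub (Continuous.intervalIntegrable (by fun_prop) _ _)
      (Continuous.intervalIntegrable (by fun_prop) _ _), integral_pow, integral_pow]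
    push_cast
    simp
    have hk : (0 : ℝ) < (k : ℝ) + 1 := by positivity
    rw [← sub_nonneg]
    have : (((k : ℝ) + 1) ^ 2)⁻¹ - (((k : ℝ) + 1)⁻¹ - ((k : ℝ) + 1 + 1)⁻¹)
      = 1 / (((k : ℝ) + 1) ^ 2 * ((k : ℝ) + 1 + 1)) := by field_simp; ring
    linarith [show 0 ≤ 1 / (((k : ℝ) + 1) ^ 2 * ((k : ℝ) + 1 + 1)) by positivity]
  have hsum : Summable fun k => ∫ y in Ioc (0 : ℝ) 1, ‖F k y‖ := by
    refine Summable.of_nonneg_of_le (fun k => integral_nonneg fun _ => norm_nonneg _)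
      (fun k => ?_) (summable_inv_succ_sq ‖s‖)
    refine le_trans ?_ (hpoly k)
    refine setIntegral_mono_on (hFi k).norm ?_ measurableSet_Ioc (hFn k)
    exact Continuous.integrableOn_Ioc (by fun_prop)
  have h1 := hasSum_integral_of_summable_integral_norm hFi hsum
  have h2 : ∀ k, ∫ y in Ioc (0 : ℝ) 1, F k y = 1 / ((k : ℂ) + 1 - s) - 1 / ((k : ℂ) + 1) := by
    intro k
    rw [← intervalIntegral.integral_of_le zero_le_one]
    have e := intervalIntegral.integral_comp_sub_left (a := 0) (b := 1)
      (fun x : ℝ => (x : ℂ) ^ k * ((x : ℂ) ^ (-s) - 1)) 1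
    simp only [sub_self, sub_zero] at e
    have e1 : ∀ y, F k y = ((1 - y : ℝ) : ℂ) ^ k * (((1 - y : ℝ) : ℂ) ^ (-s) - 1) := fun y => by
      simp [hF, binomRem]
    simp only [e1]
    rw [e]
    have e2 : ∫ x in (0 : ℝ)..1, (x : ℂ) ^ k * ((x : ℂ) ^ (-s) - 1)
        = ∫ x in (0 : ℝ)..1, ((x : ℂ) ^ ((k : ℂ) - s) - (x : ℂ) ^ (k : ℂ)) := by
      apply intervalIntegral.integral_congr_ae
      refine ae_of_all _ fun x hx => ?_
      rw [uIoc_of_le zero_le_one] at hx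
      have hx0 : (x : ℂ) ≠ 0 := by exact_mod_cast hx.1.ne'
      rw [sub_eq_add_neg (k : ℂ), Complex.cpow_add _ _ hx0, Complex.cpow_natCast]
      ring
    have hk : (0 : ℝ) ≤ k := by positivity
    have hr1 : -1 < ((k : ℂ) - s).re := by simp; linarith
    have hr2 : -1 < ((k : ℂ)).re := by simp; linarith
    rw [e2, intervalIntegral.integral_sub (intervalIntegral.intervalIntegrable_cpow' hr1)
      (intervalIntegral.intervalIntegrable_cpow' hr2), integral_cpow (Or.inl hr1),
      integral_cpow (Or.inl hr2)]
    have n1 : (k : ℂ) + 1 ≠ 0 := by exact_mod_cast Nat.succ_ne_zero k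
    have n2 : (k : ℂ) - s + 1 ≠ 0 := by
      have := add_one_sub_ne_zero (s := s) (by linarith) k
      rwa [show (k : ℂ) - s + 1 = k + 1 - s by ring]
    simp only [Complex.ofReal_one, Complex.one_cpow, Complex.ofReal_zero, Complex.zero_cpow n1,
      Complex.zero_cpow n2, sub_zero]
    rw [show (k : ℂ) - s + 1 = k + 1 - s by ring]
  simp only [h2] at h1
  rw [(hasSum_harmonicSeries (by linarith : s.re ≤ 1 / 2)).unique h1,
    intervalIntegral.integral_of_le zero_le_one]
  refine setIntegral_congr_fun measurableSet_Ioc fun y hy => ?_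
  have hg : HasSum (fun k : ℕ => ((1 - y : ℝ) : ℂ) ^ k) (1 - ((1 - y : ℝ) : ℂ))⁻¹ := by
    apply hasSum_geometric_of_norm_lt_one
    rw [Complex.norm_real, Real.norm_of_nonneg (by linarith [hy.2])]
    linarith [hy.1]
  have := (hg.mul_right (binomRem 1 s y)).tsum_eq
  simp only [hF, binomQuot, if_neg hy.1.ne']
  rw [this]
  push_cast
  rw [sub_sub_cancel, pow_one]
  field_simp

theorem succ_mul_deriv_risingCoeff (N : ℕ) (s : ℂ) :
    (N + 1) * deriv (risingCoeff (N + 1)) s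
      = risingCoeff N (s + 1) + s * deriv (risingCoeff N) (s + 1) := by
  have h1 : HasDerivAt (fun s => ((N : ℂ) + 1) * risingCoeff (N + 1) s)
      ((N + 1) * deriv (risingCoeff (N + 1)) s) s :=
    ((differentiable_risingCoeff (N + 1)) s).hasDerivAt.const_mul _
  have h2 : HasDerivAt (fun s => s * risingCoeff N (s + 1))
      (1 * risingCoeff N (s + 1) + s * deriv (risingCoeff N) (s + 1)) s :=
    (hasDerivAt_id s).mul (((differentiable_risingCoeff N) (s + 1)).hasDerivAt.comp_add_const s 1)
  simp only [risingCoeff_succ', one_mul] at h1 h2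
  exact h1.unique h2

open MeasureTheory Set in
-- Integrating the formula of `hasDerivAt_binomQuot` over `[0,1]` reduces order `N + 2` at `s` to
-- order `N + 1` at `s + 1`. The derivative of the rising factorial appears because differentiating
-- `risingCoeff_succ'` in `s` produces the same recursion.
theorem integral_binomQuot (N : ℕ) : ∀ {s : ℂ}, s.re + N + 2 ≤ 0 →
    ∫ y in (0 : ℝ)..1, binomQuot (N + 1) s y
      = ∑ i ∈ Finset.range N, risingCoeff i s / ((N : ℂ) - i)
        + risingCoeff N s * ((harmonic N : ℂ) + harmonicSeries s) - deriv (risingCoeff N) s := by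
  induction N with
  | zero =>
    intro s hs
    have e : risingCoeff 0 = fun _ => (1 : ℂ) := funext risingCoeff_zero
    rw [integral_binomQuot_one (by simpa using hs)]
    simp [e]
  | succ N ih =>
    intro s hs
    push_cast at hs
    have hN : (0 : ℝ) ≤ N := by positivity
    have hs0 : s ≠ 0 := by rintro rfl; simp at hs; linarith
    have hs0' : s.re < 0 := by linarith
    have hc1 := continuousOn_binomQuot (N + 1) (s := s) (by push_cast; linarith)
    have hc2 := continuousOn_binomQuot (N + 2) (s := s) (by push_cast; linarith)
    have hc3 := continuousOn_binomQuot (N + 1) (s := s + 1) (by simp; linarith)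
    have hi2 : IntervalIntegrable (binomQuot (N + 2) s) volume 0 1 :=
      ContinuousOn.intervalIntegrable (by rwa [uIcc_of_le zero_le_one])
    have hi3 : IntervalIntegrable (binomQuot (N + 1) (s + 1)) volume 0 1 :=
      ContinuousOn.intervalIntegrable (by rwa [uIcc_of_le zero_le_one])
    have ftc := intervalIntegral.integral_eq_sub_of_hasDerivAt_of_le zero_le_one hc1
      (fun y hy => hasDerivAt_binomQuot N s hy.1 hy.2)
      ((hi2.const_mul (-((N + 1 : ℕ) : ℂ))).add (hi3.const_mul s))
    rw [intervalIntegral.integral_add (hi2.const_mul _) (hi3.const_mul s),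
      intervalIntegral.integral_const_mul, intervalIntegral.integral_const_mul,
      ih (s := s + 1) (by simp; linarith), binomQuot_zero, binomQuot_one _ hs0'] at ftc
    have hx := harmonicSeries_sub_one (s := s + 1) (by simp; linarith)
    rw [add_sub_cancel_right] at hx
    have hx' : harmonicSeries (s + 1) = harmonicSeries s - 1 / s := by
      have e0 : 1 - (s + 1) = -s := by ring
      rw [e0] at hx
      rw [hx]; ring
    have hd := succ_mul_deriv_risingCoeff N s
    have hp := risingCoeff_succ' N s
    have hn : (N : ℂ) + 1 ≠ 0 := by exact_mod_cast Nat.succ_ne_zero N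
    have e1 : s * ∑ i ∈ Finset.range N, risingCoeff i (s + 1) / ((N : ℂ) - i)
        = ∑ i ∈ Finset.range (N + 1), i * risingCoeff i s / ((N : ℂ) + 1 - i) := by
      rw [Finset.sum_range_succ', Finset.mul_sum]
      simp only [Nat.cast_zero, zero_mul, zero_div, add_zero]
      refine Finset.sum_congr rfl fun i _ => ?_
      push_cast
      rw [risingCoeff_succ', add_sub_add_right_eq_sub]
      ring
    -- The second sum is minus the value of the quotient at `y = 1`; the identity is `i/(N+1-i) + 1
    -- = (N+1)/(N+1-i)`.
    have e2 : ∑ i ∈ Finset.range (N + 1), i * risingCoeff i s / ((N : ℂ) + 1 - i)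
        + ∑ i ∈ Finset.range (N + 1), risingCoeff i s
        = (N + 1) * ∑ i ∈ Finset.range (N + 1), risingCoeff i s / ((N : ℂ) + 1 - i) := by
      rw [← Finset.sum_add_distrib, Finset.mul_sum]
      refine Finset.sum_congr rfl fun i hi => ?_
      have : (N : ℂ) + 1 - i ≠ 0 := by
        rw [sub_ne_zero]
        have := Finset.mem_range.1 hi
        exact_mod_cast (by omega : N + 1 ≠ i)
      field_simp
      ring
    rw [mul_sub, mul_add, e1, hx'] at ftc
    apply mul_left_cancel₀ hn
    rw [harmonic_succ]
    push_cast at ftc ⊢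
    have h3 : s * (risingCoeff N (s + 1) * ((harmonic N : ℂ) + (harmonicSeries s - 1 / s)))
      = (N + 1) * risingCoeff (N + 1) s * ((harmonic N : ℂ) + harmonicSeries s)
        - risingCoeff N (s + 1) := by
      rw [hp]; field_simp; ring
    rw [h3] at ftc
    have h4 : ((N : ℂ) + 1) * (risingCoeff (N + 1) s *
        ((harmonic N : ℂ) + ((N : ℂ) + 1)⁻¹ + harmonicSeries s))
      = (N + 1) * risingCoeff (N + 1) s * ((harmonic N : ℂ) + harmonicSeries s)
        + risingCoeff (N + 1) s := by
      field_simp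
      ring
    rw [mul_sub, mul_add, h4, ← e2]
    linear_combination -ftc + hd

/-! ### Expansions of power sums and of Riemann sums of the Taylor quotient. -/

theorem riemannZeta_neg_nat_eq_neg_bernoulli_sub (j : ℕ) :
    riemannZeta (-j) = -(bernoulli (j + 1) : ℂ) / (j + 1) - if j = 0 then 1 else 0 := by
  rcases Nat.eq_zero_or_pos j with rfl | hj
  · simp [riemannZeta_zero]; norm_num
  · rw [riemannZeta_neg_nat_eq_bernoulli, if_neg hj.ne', sub_zero]
    rcases Nat.even_or_odd j with h | h
    · rw [bernoulli_eq_zero_of_odd h.add_one (by omega)]; simp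
    · rw [h.neg_one_pow]; ring

theorem natCast_pow_mul_cpow_neg {n : ℕ} (hn : 1 ≤ n) (a j : ℕ) :
    (n : ℂ) ^ a * (n : ℂ) ^ (-(a : ℂ) - j) = 1 / (n : ℂ) ^ j := by
  have hn0 : (n : ℂ) ≠ 0 := by exact_mod_cast (by omega : n ≠ 0)
  rw [← neg_add', Complex.cpow_neg, ← Nat.cast_add, Complex.cpow_natCast, pow_add]
  field_simp

/-- The Euler–Maclaurin expansion of `n ^ a * ∑_{k < n} k ^ (-a)`. -/
theorem norm_pow_mul_sum_inv_pow_sub_le (a K : ℕ) (ha : 1 ≤ a) (hK : 1 ≤ K) : ∃ C : ℝ, 0 ≤ C ∧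
    ∀ n : ℕ, 1 ≤ n → ‖(n : ℂ) ^ a * (∑ k ∈ Finset.Ico 1 n, 1 / (k : ℂ) ^ a)
      - ((if a = 1 then (n : ℂ) * (Real.log n + Real.eulerMascheroniConstant)
            else riemannZeta a * (n : ℂ) ^ a - n / ((a : ℂ) - 1))
        + ∑ j ∈ Finset.range (K + 1), riemannZeta (-j) * risingCoeff j a * (1 / (n : ℂ) ^ j))‖
      ≤ C * (1 / (n : ℝ) ^ K) := by
  have key : ∃ C : ℝ, 0 ≤ C ∧ ∀ n : ℕ, 1 ≤ n → ‖(∑ k ∈ Finset.Ico 1 n, (k : ℂ) ^ (-(a : ℂ)))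
      - ((if a = 1 then (Real.log n + Real.eulerMascheroniConstant : ℂ)
            else riemannZeta a + (n : ℂ) ^ (1 - (a : ℂ)) / (1 - (a : ℂ)))
        + ∑ j ∈ Finset.range (K + 1),
            riemannZeta (-j) * risingCoeff j a * (n : ℂ) ^ (-(a : ℂ) - j))‖
      ≤ C * (n : ℝ) ^ (-((a : ℝ) + K)) := by
    rcases eq_or_ne a 1 with rfl | ha1
    · obtain ⟨C, hC, h⟩ := norm_sum_inv_sub_log_le K
      refine ⟨C, hC, fun n hn => ?_⟩
      simpa using h n hn
    · obtain ⟨C, hC, h⟩ := norm_sum_cpow_sub_riemannZeta_le K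
      refine ⟨C * ‖risingCoeff (K + 1) a‖, by positivity, fun n hn => ?_⟩
      have h2 : (2 : ℝ) ≤ a := by exact_mod_cast (by omega : 2 ≤ a)
      have h1 : (1 : ℝ) ≤ K := by exact_mod_cast hK
      have := h a n (by simp; linarith) (by exact_mod_cast ha1) hn
      simpa [ha1] using this
  obtain ⟨C, hC, h⟩ := key
  refine ⟨C, hC, fun n hn => ?_⟩
  have hn0 : (0 : ℝ) < n := by exact_mod_cast hn
  have hnc : (n : ℂ) ≠ 0 := by exact_mod_cast (by omega : n ≠ 0)
  have h1 := mul_le_mul_of_nonneg_left (h n hn) (by positivity : (0 : ℝ) ≤ ‖(n : ℂ) ^ a‖)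
  rw [← norm_mul] at h1
  refine le_trans (le_of_eq ?_) (h1.trans (le_of_eq ?_))
  · congr 1
    rw [mul_sub, mul_add ((n : ℂ) ^ a), Finset.mul_sum (Finset.range (K + 1))]
    congr 1
    · congr 1
      refine Finset.sum_congr rfl fun k _ => ?_
      rw [Complex.cpow_neg, Complex.cpow_natCast, one_div]
    · congr 1
      · split_ifs with h
        · subst h; simp
        · have e : 1 - (a : ℂ) ≠ 0 := by
            rw [sub_ne_zero]; exact_mod_cast (Ne.symm h)
          have e' : (a : ℂ) - 1 ≠ 0 := by
            rw [sub_ne_zero]; exact_mod_cast h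
          rw [Complex.cpow_sub _ _ hnc, Complex.cpow_one, Complex.cpow_natCast]
          field_simp
          ring
      · refine Finset.sum_congr rfl fun j _ => ?_
        rw [← natCast_pow_mul_cpow_neg hn a j]; ring
  · rw [norm_pow, Complex.norm_natCast, neg_add, Real.rpow_add hn0, Real.rpow_neg hn0.le,
      Real.rpow_neg hn0.le, Real.rpow_natCast, Real.rpow_natCast]
    field_simp

open MeasureTheory Set in
-- Euler–Maclaurin on `[0,n]` for the quotient at `x/n`: each derivative gains `1/n`, and the length
-- `n` of the interval takes one factor back. The inner sum over `i` comes from `y = 1` and will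
-- cancel against the power sums.
theorem norm_sum_binomQuot_sub_le (q K : ℕ) (hq : 1 ≤ q) (R : ℝ) (hR : 0 ≤ R) : ∃ C : ℝ, 0 ≤ C ∧
    ∀ (s : ℂ) (n : ℕ), ‖s‖ ≤ R → s.re + q + K + 2 ≤ 0 → 1 ≤ n →
    ‖(∑ k ∈ Finset.Ico 1 n, binomQuot q s ((k : ℝ) / n))
      - (n * (∫ y in (0 : ℝ)..1, binomQuot q s y)
        + ∑ j ∈ Finset.range (K + 1), riemannZeta (-j) * (risingCoeff (q + j) s
            - ∑ i ∈ Finset.range q, risingCoeff i s * risingCoeff j ((q : ℂ) - i))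
              * (1 / (n : ℂ) ^ j))‖
      ≤ C * (1 / (n : ℝ) ^ K) := by
  obtain ⟨C, hC, h⟩ := euler_maclaurin K
  obtain ⟨C', hC', h'⟩ := norm_binomQuotDeriv_le (K + 1) q R hR
  refine ⟨C * C', by positivity, fun s n hsR hs hn => ?_⟩
  have hn0 : (0 : ℝ) < n := by exact_mod_cast hn
  have hnc : (n : ℂ) ≠ 0 := by exact_mod_cast (by omega : n ≠ 0)
  have hq0 : (1 : ℝ) ≤ q := by exact_mod_cast hq
  have hmaps : MapsTo (fun x : ℝ => x / n) (Icc ((0 : ℕ) : ℝ) n) (Icc 0 1) := fun x hx => by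
    have := hx.1
    push_cast at this
    exact ⟨by positivity, (div_le_one hn0).2 hx.2⟩
  have h1 := h (fun j x => 1 / (n : ℂ) ^ j * binomQuotDeriv j q s (x / n)) 0 n (Nat.zero_le n)
    (fun j hj => by
      have hj' : (j : ℝ) ≤ K + 1 := by exact_mod_cast hj
      exact ((continuousOn_binomQuotDeriv j q (s := s) (by linarith)).comp
        (by fun_prop) hmaps).const_mul _)
    (fun j hj x hx => by
      have hx0 : 0 < x := by simpa using hx.1
      have hd := hasDerivAt_binomQuotDeriv j q s (y := x / n) hq (by positivity)
        ((div_lt_one hn0).2 hx.2)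
      have := (hd.scomp x ((hasDerivAt_id x).div_const (n : ℝ))).const_mul (1 / (n : ℂ) ^ j)
      refine this.congr_deriv ?_
      rw [Complex.real_smul, pow_succ]
      push_cast
      field_simp)
  have hint : ∫ x in ((0 : ℕ) : ℝ)..n, ‖1 / (n : ℂ) ^ (K + 1) * binomQuotDeriv (K + 1) q s (x / n)‖
      ≤ C' * (1 / (n : ℝ) ^ K) := by
    have h2 : ∀ x ∈ uIoc ((0 : ℕ) : ℝ) n,
        ‖‖1 / (n : ℂ) ^ (K + 1) * binomQuotDeriv (K + 1) q s (x / n)‖‖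
          ≤ C' * (1 / (n : ℝ) ^ (K + 1)) := by
      intro x hx
      rw [uIoc_of_le (by simp)] at hx
      rw [norm_norm, norm_mul, norm_div, norm_one, norm_pow, Complex.norm_natCast, mul_comm]
      exact mul_le_mul_of_nonneg_right
        (h' s hsR (by push_cast; linarith) _ (hmaps ⟨hx.1.le, hx.2⟩)) (by positivity)
    refine (le_abs_self _).trans ((intervalIntegral.norm_integral_le_of_norm_le_const h2).trans
      (le_of_eq ?_))
    rw [Nat.cast_zero, sub_zero, abs_of_pos hn0, pow_succ]
    field_simp
  have h2 := h1.trans (mul_le_mul_of_nonneg_left hint hC)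
  refine le_trans (le_of_eq ?_) (h2.trans (le_of_eq (by ring)))
  congr 1
  have e1 : ∫ x in ((0 : ℕ) : ℝ)..n, 1 / (n : ℂ) ^ 0 * binomQuotDeriv 0 q s (x / n)
      = n * ∫ y in (0 : ℝ)..1, binomQuot q s y := by
    simp only [pow_zero, div_one, one_mul, binomQuotDeriv]
    rw [intervalIntegral.integral_comp_div _ hn0.ne']
    simp [hn0.ne']
  have e2 : ∑ k ∈ Finset.Ico 0 n, 1 / (n : ℂ) ^ 0 * binomQuotDeriv 0 q s ((k : ℝ) / n)
      = risingCoeff q s + ∑ k ∈ Finset.Ico 1 n, binomQuot q s ((k : ℝ) / n) := by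
    rw [Finset.sum_eq_sum_Ico_succ_bot (by omega)]
    simp [binomQuotDeriv, binomQuot_zero]
  have e3 : ∑ j ∈ Finset.range (K + 1), riemannZeta (-j) * (risingCoeff (q + j) s
            - ∑ i ∈ Finset.range q, risingCoeff i s * risingCoeff j ((q : ℂ) - i))
              * (1 / (n : ℂ) ^ j)
      = ∑ j ∈ Finset.range (K + 1), (bernoulli (j + 1) : ℂ) / ((j + 1)! : ℂ) *
          (1 / (n : ℂ) ^ j * binomQuotDeriv j q s (n / n)
            - 1 / (n : ℂ) ^ j * binomQuotDeriv j q s (((0 : ℕ) : ℝ) / n)) - risingCoeff q s := by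
    -- The term `k = 0`, absent from the sum on the left, is exactly the discrepancy at `j = 0`
    -- between `-B_{j+1}/(j+1)` and `ζ(-j)`.
    have e4 : risingCoeff q s = ∑ j ∈ Finset.range (K + 1),
        (if j = 0 then 1 else 0) * risingCoeff (q + j) s * (1 / (n : ℂ) ^ j) := by
      rw [Finset.sum_range_succ']; simp
    conv_rhs => rw [e4]
    rw [← Finset.sum_sub_distrib]
    refine Finset.sum_congr rfl fun j hj => ?_
    have hj' : (j : ℝ) ≤ K := by exact_mod_cast Nat.lt_succ_iff.1 (Finset.mem_range.1 hj)
    rw [div_self hn0.ne', Nat.cast_zero, zero_div, binomQuotDeriv_zero_right,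
      binomQuotDeriv_one_right j q (by linarith), mul_sub, Finset.mul_sum]
    have e5 : ∀ i, riemannZeta (-j) * (risingCoeff i s * risingCoeff j ((q : ℂ) - i))
      = (bernoulli (j + 1) : ℂ) / ((j + 1)! : ℂ) *
          (risingCoeff i s * ((-1) ^ j * (j ! : ℂ) * risingCoeff j ((q : ℂ) - i))) := fun i => by
      linear_combination (-risingCoeff i s) *
        riemannZeta_neg_nat_mul_risingCoeff j ((q : ℂ) - i)
    simp only [e5]
    rw [← Finset.mul_sum, riemannZeta_neg_nat_eq_neg_bernoulli_sub, Nat.factorial_succ]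
    have h3 : ((j ! : ℕ) : ℂ) ≠ 0 := by exact_mod_cast Nat.factorial_ne_zero _
    have h4 : ((j : ℂ) + 1) ≠ 0 := by exact_mod_cast Nat.succ_ne_zero j
    push_cast
    field_simp
    ring_nf
  rw [e1, e2, e3]
  ring

/-! ### The convolution sum, its formal expansion, and their common recurrence. -/

/-- `∑_{k=1}^{n-1} k ^ (-s) / (n - k) ^ q`. -/
noncomputable def powConv (q : ℕ) (s : ℂ) (n : ℕ) : ℂ :=
  ∑ k ∈ Finset.Ico 1 n, (k : ℂ) ^ (-s) / ((n : ℂ) - k) ^ q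

/-- The coefficient of `n ^ (-s - N)` in the expansion of `powConv (N + 1) s n`. -/
noncomputable def logCoeff (N : ℕ) (s : ℂ) (n : ℕ) : ℂ :=
  risingCoeff N s * (Real.log n + Real.eulerMascheroniConstant + (harmonic N : ℂ)
    + harmonicSeries s) - deriv (risingCoeff N) s

/-- The coefficient of `n ^ (-s - i)` in the expansion of `powConv q s n`. -/
noncomputable def expansionCoeff (q i : ℕ) (s : ℂ) (n : ℕ) : ℂ :=
  if i + 1 = q then logCoeff i s n else risingCoeff i s * riemannZeta ((q : ℂ) - i)

/-- The truncated asymptotic expansion of `powConv q s n`. -/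
noncomputable def powConvExpansion (q : ℕ) (s : ℂ) (n I J : ℕ) : ℂ :=
  (n : ℂ) ^ (-s) * (∑ i ∈ Finset.range I, expansionCoeff q i s n * (1 / (n : ℂ) ^ i)
      + if q = 0 then (n : ℂ) / (1 - s) else 0)
    + ∑ j ∈ Finset.range J, ((q + j - 1).choose j : ℂ) * riemannZeta (s - j) * (1 / (n : ℂ) ^ (q + j))

theorem natCast_cpow_one_sub {n : ℕ} (hn : 1 ≤ n) (s : ℂ) :
    (n : ℂ) ^ (-(s - 1)) = n * (n : ℂ) ^ (-s) := by
  have hnc : (n : ℂ) ≠ 0 := by exact_mod_cast (by omega : n ≠ 0)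
  rw [show -(s - 1) = 1 + -s by ring, Complex.cpow_add _ _ hnc, Complex.cpow_one]

/-- Write `n = k + (n - k)` in each summand. -/
theorem mul_powConv_succ (q : ℕ) (s : ℂ) (n : ℕ) :
    n * powConv (q + 1) s n = powConv (q + 1) (s - 1) n + powConv q s n := by
  simp only [powConv]
  rw [Finset.mul_sum, ← Finset.sum_add_distrib]
  refine Finset.sum_congr rfl fun k hk => ?_
  rw [Finset.mem_Ico] at hk
  have h : (n : ℂ) - k ≠ 0 := by
    rw [sub_ne_zero]; exact_mod_cast hk.2.ne'
  rw [natCast_cpow_one_sub hk.1, pow_succ]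
  field_simp
  ring

theorem logCoeff_zero_sub_one {s : ℂ} (hs : s.re ≤ 1 / 2) (n : ℕ) :
    logCoeff 0 s n = logCoeff 0 (s - 1) n + 1 / (1 - s) := by
  have e : risingCoeff 0 = fun _ => (1 : ℂ) := funext risingCoeff_zero
  simp only [logCoeff, harmonicSeries_sub_one hs, e, deriv_const]
  ring

/-- Pascal's rule survives at the pole: the change `1/(1-s)` of the digamma series under `s ↦ s - 1`
is compensated by the step `1/(N+1)` of the harmonic number. -/
theorem logCoeff_succ {s : ℂ} (hs : s.re ≤ 1 / 2) (N n : ℕ) :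
    logCoeff (N + 1) s n = logCoeff (N + 1) (s - 1) n + logCoeff N s n := by
  have h1 := risingCoeff_pascal N s
  have h2 : deriv (risingCoeff (N + 1)) s
      = deriv (risingCoeff (N + 1)) (s - 1) + deriv (risingCoeff N) s := by
    have hd : HasDerivAt (risingCoeff (N + 1))
        (deriv (risingCoeff (N + 1)) (s - 1) + deriv (risingCoeff N) s) s := by
      rw [show risingCoeff (N + 1) = fun s => risingCoeff (N + 1) (s - 1) + risingCoeff N s from
        funext (risingCoeff_pascal N)]
      refine HasDerivAt.add ?_ ((differentiable_risingCoeff N) s).hasDerivAt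
      rw [← show risingCoeff (N + 1) = fun s => risingCoeff (N + 1) (s - 1) + risingCoeff N s from
        funext (risingCoeff_pascal N)]
      exact ((differentiable_risingCoeff (N + 1)) (s - 1)).hasDerivAt.comp_sub_const s 1
    exact hd.deriv
  have h3 := risingCoeff_succ' N (s - 1)
  rw [sub_add_cancel] at h3
  have hn : (N : ℂ) + 1 ≠ 0 := by exact_mod_cast Nat.succ_ne_zero N
  have hs1 : 1 - s ≠ 0 := by
    intro h
    have := congrArg Complex.re h
    simp at this
    linarith
  have h4 : risingCoeff (N + 1) (s - 1) * (1 / (1 - s)) + risingCoeff N s * ((N : ℂ) + 1)⁻¹ = 0 := by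
    field_simp
    linear_combination h3
  simp only [logCoeff, harmonicSeries_sub_one hs, harmonic_succ, h2]
  push_cast
  rw [h1]
  linear_combination h4

theorem expansionCoeff_succ {s : ℂ} (hs : s.re ≤ 1 / 2) (q i n : ℕ) :
    expansionCoeff (q + 1) (i + 1) s n
      = expansionCoeff (q + 1) (i + 1) (s - 1) n + expansionCoeff q i s n := by
  unfold expansionCoeff
  rcases eq_or_ne (i + 1) q with h | h
  · rw [if_pos (by omega), if_pos (by omega), if_pos h, logCoeff_succ hs]
  · rw [if_neg (by omega), if_neg (by omega), if_neg h, risingCoeff_pascal]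
    push_cast
    rw [add_sub_add_right_eq_sub]
    ring

/-- Only for `q = 0` is the leading coefficient regularised; its jump `1/(1-s)` matches the integral
term `n/(1-s)` in the expansion of weight zero. -/
theorem expansionCoeff_zero {s : ℂ} (hs : s.re ≤ 1 / 2) (q n : ℕ) :
    expansionCoeff (q + 1) 0 s n
      = expansionCoeff (q + 1) 0 (s - 1) n + if q = 0 then 1 / (1 - s) else 0 := by
  unfold expansionCoeff
  rcases eq_or_ne q 0 with h | h
  · subst h; simpa using logCoeff_zero_sub_one hs n
  · rw [if_neg (by omega), if_neg (by omega), if_neg h]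
    simp

/-- Formal counterpart of `mul_powConv_succ`, by Pascal's rule in both families. Since `ζ((s-1)-j) =
ζ(s-(j+1))`, the expansion at `s - 1` needs one zeta term fewer. -/
theorem mul_powConvExpansion_succ {s : ℂ} (hs : s.re ≤ 1 / 2) (q I J : ℕ) {n : ℕ} (hn : 1 ≤ n) :
    n * powConvExpansion (q + 1) s n (I + 1) (J + 1)
      = powConvExpansion (q + 1) (s - 1) n (I + 1) J + powConvExpansion q s n I (J + 1) := by
  have hnc : (n : ℂ) ≠ 0 := by exact_mod_cast (by omega : n ≠ 0)
  have h1 : (n : ℂ) * ((n : ℂ) ^ (-s) *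
        (∑ i ∈ Finset.range (I + 1), expansionCoeff (q + 1) i s n * (1 / (n : ℂ) ^ i)))
      = (n : ℂ) ^ (-(s - 1)) *
        (∑ i ∈ Finset.range (I + 1), expansionCoeff (q + 1) i (s - 1) n * (1 / (n : ℂ) ^ i))
        + (n : ℂ) ^ (-s) * (∑ i ∈ Finset.range I, expansionCoeff q i s n * (1 / (n : ℂ) ^ i)
      + if q = 0 then (n : ℂ) / (1 - s) else 0) := by
    rw [natCast_cpow_one_sub hn]
    simp only [Finset.sum_range_succ', expansionCoeff_succ hs, expansionCoeff_zero hs]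
    simp only [add_mul, Finset.sum_add_distrib]
    have e : ∑ i ∈ Finset.range I, expansionCoeff q i s n * (1 / (n : ℂ) ^ i)
        = n * ∑ i ∈ Finset.range I, expansionCoeff q i s n * (1 / (n : ℂ) ^ (i + 1)) := by
      rw [Finset.mul_sum]
      refine Finset.sum_congr rfl fun i _ => ?_
      rw [pow_succ]
      field_simp
    rw [e]
    split_ifs <;> simp <;> ring
  have h2 : (n : ℂ) * ∑ j ∈ Finset.range (J + 1),
        ((q + 1 + j - 1).choose j : ℂ) * riemannZeta (s - j) * (1 / (n : ℂ) ^ (q + 1 + j))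
      = ∑ j ∈ Finset.range J,
        ((q + 1 + j - 1).choose j : ℂ) * riemannZeta (s - 1 - j) * (1 / (n : ℂ) ^ (q + 1 + j))
      + ∑ j ∈ Finset.range (J + 1),
        ((q + j - 1).choose j : ℂ) * riemannZeta (s - j) * (1 / (n : ℂ) ^ (q + j)) := by
    rw [Finset.sum_range_succ', Finset.sum_range_succ', ← add_assoc, ← Finset.sum_add_distrib,
      mul_add, Finset.mul_sum]
    congr 1
    · refine Finset.sum_congr rfl fun j _ => ?_
      have e1 : q + 1 + (j + 1) - 1 = (q + j) + 1 := by omega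
      have e2 : q + 1 + j - 1 = q + j := by omega
      have e3 : q + (j + 1) - 1 = q + j := by omega
      have e4 : s - ((j + 1 : ℕ) : ℂ) = s - 1 - j := by push_cast; ring
      rw [e1, e2, e3, e4, Nat.choose_succ_succ]
      push_cast
      rw [show q + 1 + (j + 1) = (q + 1 + j) + 1 by ring, show q + (j + 1) = q + 1 + j by ring,
        pow_succ (n : ℂ) (q + 1 + j)]
      field_simp
    · simp only [Nat.choose_zero_right, add_zero, pow_succ]
      field_simp
  unfold powConvExpansion
  rw [mul_add, h2, if_neg (Nat.succ_ne_zero q), if_neg (Nat.succ_ne_zero q), add_zero, add_zero, h1]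
  ring

theorem powConv_eq_sum_binomQuot (q : ℕ) (s : ℂ) {n : ℕ} (hn : 1 ≤ n) :
    powConv q s n = (n : ℂ) ^ (-s) * (1 / (n : ℂ) ^ q) *
      (∑ k ∈ Finset.Ico 1 n, binomQuot q s ((k : ℝ) / n)
        + ∑ i ∈ Finset.range q, risingCoeff i s *
            ((n : ℂ) ^ (q - i) * ∑ k ∈ Finset.Ico 1 n, 1 / (k : ℂ) ^ (q - i))) := by
  have hn0 : (0 : ℝ) < n := by exact_mod_cast hn
  have hnc : (n : ℂ) ≠ 0 := by exact_mod_cast (by omega : n ≠ 0)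
  have h1 : powConv q s n = ∑ k ∈ Finset.Ico 1 n, ((n : ℂ) - k) ^ (-s) / (k : ℂ) ^ q := by
    have hr := Finset.sum_Ico_reflect (fun k : ℕ => (k : ℂ) ^ (-s) / ((n : ℂ) - k) ^ q) 1
      (Nat.le_succ n)
    rw [show n + 1 - n = 1 by omega, show n + 1 - 1 = n by omega] at hr
    rw [powConv, ← hr]
    refine Finset.sum_congr rfl fun k hk => ?_
    rw [Finset.mem_Ico] at hk
    rw [Nat.cast_sub hk.2.le, sub_sub_cancel]
  rw [h1]
  have h2 : ∑ i ∈ Finset.range q, risingCoeff i s *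
            ((n : ℂ) ^ (q - i) * ∑ k ∈ Finset.Ico 1 n, 1 / (k : ℂ) ^ (q - i))
      = ∑ k ∈ Finset.Ico 1 n, ∑ i ∈ Finset.range q,
          risingCoeff i s * ((n : ℂ) ^ (q - i) * (1 / (k : ℂ) ^ (q - i))) := by
    rw [Finset.sum_comm]
    simp only [Finset.mul_sum]
  rw [h2, ← Finset.sum_add_distrib, Finset.mul_sum]
  refine Finset.sum_congr rfl fun k hk => ?_
  rw [Finset.mem_Ico] at hk
  have hk0 : (0 : ℝ) < k := by exact_mod_cast hk.1
  have hkc : (k : ℂ) ≠ 0 := by exact_mod_cast (by omega : k ≠ 0)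
  have hkn : (k : ℝ) / n ≤ 1 := (div_le_one hn0).2 (by exact_mod_cast hk.2.le)
  have e1 : (n : ℂ) - k = (n : ℝ) * ((1 - (k : ℝ) / n : ℝ) : ℂ) := by
    push_cast; field_simp
  rw [e1, Complex.mul_cpow_ofReal_nonneg hn0.le (by linarith),
    binomQuot, if_neg (by positivity), binomRem]
  have e2 : ∑ i ∈ Finset.range q, risingCoeff i s * ((n : ℂ) ^ (q - i) * (1 / (k : ℂ) ^ (q - i)))
      = (∑ i ∈ Finset.range q, risingCoeff i s * (((k : ℝ) / n : ℝ) : ℂ) ^ i)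
          / (((k : ℝ) / n : ℝ) : ℂ) ^ q := by
    rw [Finset.sum_div]
    refine Finset.sum_congr rfl fun i hi => ?_
    have hi' : i ≤ q := (Finset.mem_range.1 hi).le
    obtain ⟨d, rfl⟩ := Nat.exists_eq_add_of_le hi'
    rw [Nat.add_sub_cancel_left]
    push_cast
    rw [pow_add, div_pow, div_pow]
    field_simp
  rw [e2, ← add_div, sub_add_cancel]
  push_cast
  rw [div_pow]
  field_simp

/-- The expansion of `powConv q s n` when `s` has very negative real part. -/
theorem norm_powConv_sub_le_of_re_le (q K : ℕ) (hq : 1 ≤ q) (hK : 1 ≤ K) (R : ℝ) (hR : 0 ≤ R) :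
    ∃ C : ℝ, 0 ≤ C ∧ ∀ (s : ℂ) (n : ℕ), ‖s‖ ≤ R → s.re + q + K + 2 ≤ 0 → 1 ≤ n →
      ‖powConv q s n - powConvExpansion q s n (q + K + 1) 0‖
        ≤ C * ((n : ℝ) ^ (-s.re) * (1 / (n : ℝ) ^ (q + K))) := by
  obtain ⟨C₁, hC₁, h₁⟩ := norm_sum_binomQuot_sub_le q K hq R hR
  have hz : ∀ a : ℕ, ∃ C : ℝ, 0 ≤ C ∧ (1 ≤ a → ∀ n : ℕ, 1 ≤ n →
      ‖(n : ℂ) ^ a * (∑ k ∈ Finset.Ico 1 n, 1 / (k : ℂ) ^ a)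
      - ((if a = 1 then (n : ℂ) * (Real.log n + Real.eulerMascheroniConstant)
            else riemannZeta a * (n : ℂ) ^ a - n / ((a : ℂ) - 1))
        + ∑ j ∈ Finset.range (K + 1), riemannZeta (-j) * risingCoeff j a * (1 / (n : ℂ) ^ j))‖
      ≤ C * (1 / (n : ℝ) ^ K)) := by
    intro a
    rcases Nat.eq_zero_or_pos a with rfl | ha
    · exact ⟨0, le_rfl, fun h => absurd h (by omega)⟩
    · obtain ⟨C, hC, h⟩ := norm_pow_mul_sum_inv_pow_sub_le a K ha hK
      exact ⟨C, hC, fun _ => h⟩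
  choose Z hZ0 hZ using hz
  have hp : ∀ i : ℕ, ∃ P : ℝ, 0 ≤ P ∧ ∀ s : ℂ, ‖s‖ ≤ R → ‖risingCoeff i s‖ ≤ P := by
    intro i
    obtain ⟨P, hP⟩ := (isCompact_closedBall (0 : ℂ) R).exists_bound_of_continuousOn
      (differentiable_risingCoeff i).continuous.continuousOn
    exact ⟨P, (norm_nonneg _).trans (hP 0 (by simpa using hR)), fun s hs => hP s (by simpa using hs)⟩
  choose P hP0 hP using hp
  refine ⟨C₁ + ∑ i ∈ Finset.range q, P i * Z (q - i),
    add_nonneg hC₁ (Finset.sum_nonneg fun i _ => mul_nonneg (hP0 i) (hZ0 _)), fun s n hsR hs hn => ?_⟩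
  have hn0 : (0 : ℝ) < n := by exact_mod_cast hn
  have hnc : (n : ℂ) ≠ 0 := by exact_mod_cast (by omega : n ≠ 0)
  obtain ⟨N, rfl⟩ := Nat.exists_eq_add_of_le' hq
  set A : ℕ → ℂ := fun i =>
    (if N + 1 - i = 1 then (n : ℂ) * (Real.log n + Real.eulerMascheroniConstant)
      else riemannZeta (N + 1 - i : ℕ) * (n : ℂ) ^ (N + 1 - i) - n / (((N + 1 - i : ℕ) : ℂ) - 1))
    + ∑ j ∈ Finset.range (K + 1),
        riemannZeta (-j) * risingCoeff j (N + 1 - i : ℕ) * (1 / (n : ℂ) ^ j) with hA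
  set B : ℂ := n * (∫ y in (0 : ℝ)..1, binomQuot (N + 1) s y)
        + ∑ j ∈ Finset.range (K + 1), riemannZeta (-j) * (risingCoeff (N + 1 + j) s
            - ∑ i ∈ Finset.range (N + 1), risingCoeff i s * risingCoeff j (((N + 1 : ℕ) : ℂ) - i))
              * (1 / (n : ℂ) ^ j) with hB
  -- In the sum the contributions of `y = 1` in `B` cancel against the Euler–Maclaurin terms in `A`,
  -- and the fractions `risingCoeff i s / (N-i)` of the integral against the terms `n/(a-1)`. No
  -- zeta terms are needed: here the allowed error is at least of order `n^2`.
  have hmain : powConvExpansion (N + 1) s n (N + 1 + K + 1) 0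
      = (n : ℂ) ^ (-s) * (1 / (n : ℂ) ^ (N + 1)) *
        (B + ∑ i ∈ Finset.range (N + 1), risingCoeff i s * A i) := by
    have e0 : ∑ i ∈ Finset.range (N + 1), risingCoeff i s * A i
        = (∑ i ∈ Finset.range N, (risingCoeff i s * riemannZeta ((N + 1 : ℕ) - i : ℂ) * (n : ℂ) ^ (N + 1 - i)
            - n * (risingCoeff i s / ((N : ℂ) - i)))
          + risingCoeff N s * ((n : ℂ) * (Real.log n + Real.eulerMascheroniConstant)))
          + ∑ j ∈ Finset.range (K + 1), riemannZeta (-j) *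
            (∑ i ∈ Finset.range (N + 1), risingCoeff i s * risingCoeff j (((N + 1 : ℕ) : ℂ) - i))
              * (1 / (n : ℂ) ^ j) := by
      simp only [hA, mul_add, Finset.sum_add_distrib]
      congr 1
      · rw [Finset.sum_range_succ]
        congr 1
        · refine Finset.sum_congr rfl fun i hi => ?_
          have hi' := Finset.mem_range.1 hi
          rw [if_neg (by omega), Nat.cast_sub (by omega)]
          push_cast
          rw [show (N : ℂ) + 1 - i - 1 = N - i by ring]
          ring
        · rw [if_pos (by omega)]; ring
      · simp only [Finset.mul_sum, Finset.sum_mul]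
        rw [Finset.sum_comm]
        refine Finset.sum_congr rfl fun j _ => Finset.sum_congr rfl fun i hi => ?_
        have hi' := Finset.mem_range.1 hi
        rw [Nat.cast_sub (by omega)]
        ring
    have e1 : ∑ i ∈ Finset.range (N + 1 + K + 1), expansionCoeff (N + 1) i s n * (1 / (n : ℂ) ^ i)
        = (1 / (n : ℂ) ^ (N + 1)) * (∑ i ∈ Finset.range N,
            risingCoeff i s * riemannZeta ((N + 1 : ℕ) - i : ℂ) * (n : ℂ) ^ (N + 1 - i)
          + n * logCoeff N s n
          + ∑ j ∈ Finset.range (K + 1),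
              riemannZeta (-j) * risingCoeff (N + 1 + j) s * (1 / (n : ℂ) ^ j)) := by
      rw [show N + 1 + K + 1 = (N + 1) + (K + 1) by ring, Finset.sum_range_add,
        Finset.sum_range_succ, mul_add, mul_add, Finset.mul_sum, Finset.mul_sum]
      congr 1
      · congr 1
        · refine Finset.sum_congr rfl fun i hi => ?_
          have hi' := Finset.mem_range.1 hi
          rw [expansionCoeff, if_neg (by omega)]
          obtain ⟨d, hd⟩ := Nat.exists_eq_add_of_le (show i ≤ N + 1 by omega)
          rw [hd, Nat.add_sub_cancel_left, pow_add]
          field_simp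
        · rw [expansionCoeff, if_pos rfl, pow_succ]
          field_simp
      · refine Finset.sum_congr rfl fun j _ => ?_
        rw [expansionCoeff, if_neg (by omega), pow_add]
        rw [show ((N + 1 : ℕ) : ℂ) - (N + 1 + j : ℕ) = -j by push_cast; ring]
        field_simp
    have hint := integral_binomQuot N (s := s) (by push_cast at hs; linarith)
    rw [powConvExpansion, if_neg (Nat.succ_ne_zero N), add_zero, Finset.sum_range_zero, add_zero,
      e1, hB, e0, hint, logCoeff]
    simp only [mul_sub, sub_mul, Finset.sum_sub_distrib, ← Finset.mul_sum]
    ring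
  rw [hmain, powConv_eq_sum_binomQuot (N + 1) s hn, ← mul_sub, norm_mul]
  have hpre : ‖(n : ℂ) ^ (-s) * (1 / (n : ℂ) ^ (N + 1))‖
      = (n : ℝ) ^ (-s.re) * (1 / (n : ℝ) ^ (N + 1)) := by
    rw [norm_mul, Complex.norm_natCast_cpow_of_pos (by omega), norm_div, norm_one, norm_pow,
      Complex.norm_natCast, Complex.neg_re]
  have hrest : ‖(∑ k ∈ Finset.Ico 1 n, binomQuot (N + 1) s ((k : ℝ) / n)
        + ∑ i ∈ Finset.range (N + 1), risingCoeff i s * ((n : ℂ) ^ (N + 1 - i)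
          * ∑ k ∈ Finset.Ico 1 n, 1 / (k : ℂ) ^ (N + 1 - i)))
        - (B + ∑ i ∈ Finset.range (N + 1), risingCoeff i s * A i)‖
      ≤ (C₁ + ∑ i ∈ Finset.range (N + 1), P i * Z (N + 1 - i)) * (1 / (n : ℝ) ^ K) := by
    rw [add_sub_add_comm, ← Finset.sum_sub_distrib, add_mul, Finset.sum_mul]
    refine (norm_add_le _ _).trans (add_le_add (h₁ s n hsR hs hn) ?_)
    refine (norm_sum_le _ _).trans (Finset.sum_le_sum fun i hi => ?_)
    have hi' := Finset.mem_range.1 hi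
    rw [← mul_sub, norm_mul, mul_assoc]
    exact mul_le_mul (hP i s hsR) (hZ (N + 1 - i) (by omega) n hn) (norm_nonneg _) (hP0 i)
  rw [hpre]
  refine (mul_le_mul_of_nonneg_left hrest (by positivity)).trans (le_of_eq ?_)
  rw [pow_add (n : ℝ) (N + 1) K]
  field_simp

/-! ### Transport of the expansion from the far left to a disc around `0`. -/

theorem natCast_rpow_neg_re_le {n : ℕ} (hn : 1 ≤ n) {s : ℂ} (hs : ‖s‖ ≤ 1 / 2) (T : ℕ) :
    (n : ℝ) ^ (-(s - T).re) ≤ (n : ℝ) ^ (T + 1) := by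
  rw [← Real.rpow_natCast]
  refine Real.rpow_le_rpow_of_exponent_le (by exact_mod_cast hn) ?_
  have := neg_le_of_abs_le (Complex.abs_re_le_norm s)
  simp
  linarith

theorem exists_bound_risingCoeff_sub (i T : ℕ) : ∃ P : ℝ, 0 ≤ P ∧
    ∀ s : ℂ, ‖s‖ ≤ 1 / 2 → ‖risingCoeff i (s - T)‖ ≤ P := by
  obtain ⟨P, hP⟩ := (isCompact_closedBall (0 : ℂ) (1 / 2)).exists_bound_of_continuousOn
    (f := fun s => risingCoeff i (s - T))
    ((differentiable_risingCoeff i).continuous.comp (continuous_sub_right _)).continuousOn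
  exact ⟨P, (norm_nonneg _).trans (hP 0 (by simp)), fun s hs => hP s (by simpa using hs)⟩

theorem norm_powConv_zero_sub_le (K J T : ℕ) (hJ : 1 ≤ J) : ∃ C : ℝ, 0 ≤ C ∧
    ∀ (s : ℂ) (n : ℕ), ‖s‖ ≤ 1 / 2 → 1 ≤ n →
      ‖powConv 0 (s - T) n - powConvExpansion 0 (s - T) n (K + 1) J‖
        ≤ C * ((n : ℝ) ^ (T + 1) * (1 / (n : ℝ) ^ K)) := by
  -- Order `K + T + 3` ensures `2 < Re (s - T) + (K + T + 3)` on the disc; the terms beyond index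
  -- `K` are moved into the error.
  obtain ⟨C, hC, h⟩ := norm_sum_cpow_sub_riemannZeta_le (K + T + 3)
  choose P hP0 hP using fun i => exists_bound_risingCoeff_sub i T
  refine ⟨C * P (K + T + 3 + 1) + ∑ i ∈ Finset.range (T + 3),
    ‖riemannZeta (-(K + 1 + i : ℕ))‖ * P (K + 1 + i), ?_, fun s n hs hn => ?_⟩
  · exact add_nonneg (mul_nonneg hC (hP0 _))
      (Finset.sum_nonneg fun i _ => mul_nonneg (norm_nonneg _) (hP0 _))
  have hre : s.re ≤ 1 / 2 := (Complex.re_le_norm s).trans hs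
  have hre' := neg_le_of_abs_le (Complex.abs_re_le_norm s)
  have hT : (0 : ℝ) ≤ T := by positivity
  have hKr : (0 : ℝ) ≤ K := by positivity
  have hn0 : (0 : ℝ) < n := by exact_mod_cast hn
  have hn1 : (1 : ℝ) ≤ n := by exact_mod_cast hn
  have hnc : (n : ℂ) ≠ 0 := by exact_mod_cast (by omega : n ≠ 0)
  set w : ℂ := s - T with hw
  have hw1 : w ≠ 1 := by
    intro h
    have := congrArg Complex.re h
    simp [hw] at this
    linarith
  have h1 := h w n (by simp [hw]; linarith) hw1 hn
  have hpow := natCast_rpow_neg_re_le hn hs T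
  rw [← hw] at hpow
  have hsplit : powConv 0 w n - powConvExpansion 0 w n (K + 1) J
      = ((∑ k ∈ Finset.Ico 1 n, (k : ℂ) ^ (-w)) - (riemannZeta w + (n : ℂ) ^ (1 - w) / (1 - w)
        + ∑ j ∈ Finset.range (K + T + 3 + 1),
            riemannZeta (-j) * risingCoeff j w * (n : ℂ) ^ (-w - j)))
        + ∑ i ∈ Finset.range (T + 3), riemannZeta (-(K + 1 + i : ℕ)) * risingCoeff (K + 1 + i) w
            * (n : ℂ) ^ (-w - (K + 1 + i : ℕ)) := by
    rw [show K + T + 3 + 1 = (K + 1) + (T + 3) by ring, Finset.sum_range_add]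
    obtain ⟨J, rfl⟩ := Nat.exists_eq_add_of_le' hJ
    -- For `q = 0` the binomial coefficient is `binom(j-1, j)` with truncated subtraction, so only
    -- the term `j = 0`, equal to `ζ(w)`, survives.
    rw [powConvExpansion, Finset.sum_range_succ' _ J,
      Finset.sum_eq_zero (s := Finset.range J) (fun j _ => by
        rw [Nat.choose_eq_zero_of_lt (by omega)]; simp)]
    have e1 : ∀ i : ℕ, (n : ℂ) ^ (-w - i) = (n : ℂ) ^ (-w) * (1 / (n : ℂ) ^ i) := fun i => by
      rw [Complex.cpow_sub _ _ hnc, Complex.cpow_natCast]; ring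
    have e2 : (n : ℂ) ^ (1 - w) = n * (n : ℂ) ^ (-w) := by
      rw [← natCast_cpow_one_sub hn, neg_sub]
    have e3 : ∑ i ∈ Finset.range (K + 1), expansionCoeff 0 i w n * (1 / (n : ℂ) ^ i)
        = ∑ i ∈ Finset.range (K + 1), riemannZeta (-i) * risingCoeff i w * (1 / (n : ℂ) ^ i) := by
      refine Finset.sum_congr rfl fun i _ => ?_
      rw [expansionCoeff, if_neg (by omega), Nat.cast_zero, zero_sub]
      ring
    have e4 : ∑ i ∈ Finset.range (K + 1), riemannZeta (-i) * risingCoeff i w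
          * ((n : ℂ) ^ (-w) * (1 / (n : ℂ) ^ i))
        = (n : ℂ) ^ (-w) *
          ∑ i ∈ Finset.range (K + 1), riemannZeta (-i) * risingCoeff i w * (1 / (n : ℂ) ^ i) := by
      rw [Finset.mul_sum]
      exact Finset.sum_congr rfl fun i _ => by ring
    simp only [e1, e2, e3, e4, powConv]
    simp
    ring
  rw [hsplit, add_mul, Finset.sum_mul]
  refine (norm_add_le _ _).trans (add_le_add (h1.trans ?_) ?_)
  · refine mul_le_mul (mul_le_mul_of_nonneg_left (hP _ s hs) hC) ?_ (by positivity)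
      (mul_nonneg hC (hP0 _))
    rw [neg_add, Real.rpow_add hn0]
    refine mul_le_mul hpow ?_ (by positivity) (by positivity)
    rw [Real.rpow_neg hn0.le, Real.rpow_natCast, ← one_div]
    exact one_div_le_one_div_of_le (by positivity) (pow_le_pow_right₀ hn1 (by omega))
  · refine (norm_sum_le _ _).trans (Finset.sum_le_sum fun i _ => ?_)
    rw [norm_mul, norm_mul]
    refine mul_le_mul (mul_le_mul_of_nonneg_left (hP _ s hs) (norm_nonneg _)) ?_ (norm_nonneg _)
      (mul_nonneg (norm_nonneg _) (hP0 _))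
    rw [Complex.cpow_sub _ _ hnc, Complex.cpow_natCast, norm_div,
      Complex.norm_natCast_cpow_of_pos (by omega), norm_pow, Complex.norm_natCast,
      Complex.neg_re, div_eq_mul_one_div]
    refine mul_le_mul hpow ?_ (by positivity) (by positivity)
    exact one_div_le_one_div_of_le (by positivity) (pow_le_pow_right₀ hn1 (by omega))

/-- Induction on `q` and, inside it, on the number `t = J - T` of zeta terms. At `T = J` the bound
on `J` puts `s - J` in the far-left region; each application of the recurrence lowers `T` by one and
divides the error by `n`. -/
theorem norm_powConv_sub_shift_le (K J : ℕ) (hK : 1 ≤ K) (q : ℕ) : q + K + 3 ≤ J → ∀ T < J,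
    ∃ C : ℝ, 0 ≤ C ∧ ∀ (s : ℂ) (n : ℕ), ‖s‖ ≤ 1 / 2 → 1 ≤ n →
      ‖powConv q (s - T) n - powConvExpansion q (s - T) n (q + K + 1) (J - T)‖
        ≤ C * ((n : ℝ) ^ (T + 1) * (1 / (n : ℝ) ^ (q + K))) := by
  induction q with
  | zero =>
    intro _ T hT
    simpa using norm_powConv_zero_sub_le K (J - T) T (by omega)
  | succ q ih =>
    intro hJ
    have ih' := ih (by omega)
    have key : ∀ t ≤ J, ∃ C : ℝ, 0 ≤ C ∧ ∀ (s : ℂ) (n : ℕ), ‖s‖ ≤ 1 / 2 → 1 ≤ n →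
        ‖powConv (q + 1) (s - (J - t : ℕ)) n
          - powConvExpansion (q + 1) (s - (J - t : ℕ)) n (q + 1 + K + 1) t‖
          ≤ C * ((n : ℝ) ^ (J - t + 1) * (1 / (n : ℝ) ^ (q + 1 + K))) := by
      intro t
      induction t with
      | zero =>
        intro _
        obtain ⟨C, hC, h⟩ := norm_powConv_sub_le_of_re_le (q + 1) K (by omega) hK (1 / 2 + J)
          (by positivity)
        refine ⟨C, hC, fun s n hs hn => ?_⟩
        rw [Nat.sub_zero]
        have hre : s.re ≤ 1 / 2 := (Complex.re_le_norm s).trans hs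
        have hJ' : ((q + 1 : ℕ) : ℝ) + K + 3 ≤ J := by exact_mod_cast hJ
        refine (h (s - J) n ((norm_sub_le _ _).trans (by simpa using hs))
          (by simp at hJ' ⊢; linarith) hn).trans ?_
        have := natCast_rpow_neg_re_le hn hs J
        gcongr
      | succ t iht =>
        intro ht
        obtain ⟨C₁, hC₁, h₁⟩ := iht (by omega)
        obtain ⟨C₂, hC₂, h₂⟩ := ih' (J - (t + 1)) (by omega)
        refine ⟨C₁ + C₂, by positivity, fun s n hs hn => ?_⟩
        have hre : s.re ≤ 1 / 2 := (Complex.re_le_norm s).trans hs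
        have hn0 : (0 : ℝ) < n := by exact_mod_cast hn
        set T := J - (t + 1) with hT
        have hTr : (0 : ℝ) ≤ T := by positivity
        have e1 : J - t = T + 1 := by omega
        have e2 : J - T = t + 1 := by omega
        have h1 := h₁ s n hs hn
        have h2 := h₂ s n hs hn
        rw [e1] at h1
        rw [e2] at h2
        have e3 : s - ((T + 1 : ℕ) : ℂ) = s - T - 1 := by push_cast; ring
        rw [e3] at h1
        have hrec := mul_powConv_succ q (s - T) n
        have hrec' := mul_powConvExpansion_succ (s := s - T) (by simp; linarith) q (q + K + 1) t hn
        have e4 : q + 1 + K + 1 = q + K + 1 + 1 := by ring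
        rw [e4] at h1 ⊢
        refine le_of_mul_le_mul_left ?_ hn0
        calc (n : ℝ) * ‖powConv (q + 1) (s - T) n
              - powConvExpansion (q + 1) (s - T) n (q + K + 1 + 1) (t + 1)‖
            = ‖(powConv (q + 1) (s - T - 1) n
                - powConvExpansion (q + 1) (s - T - 1) n (q + K + 1 + 1) t)
              + (powConv q (s - T) n - powConvExpansion q (s - T) n (q + K + 1) (t + 1))‖ := by
              rw [← Complex.norm_natCast, ← norm_mul, mul_sub, hrec, hrec']
              congr 1; ring
          _ ≤ _ := (norm_add_le _ _).trans (add_le_add h1 h2)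
          _ = _ := by
              rw [show q + 1 + K = q + K + 1 by ring, pow_succ (n : ℝ) (q + K),
                pow_succ (n : ℝ) (T + 1)]
              field_simp
    intro T hT
    obtain ⟨C, hC, h⟩ := key (J - T) (by omega)
    refine ⟨C, hC, fun s n hs hn => ?_⟩
    have := h s n hs hn
    rwa [show J - (J - T) = T by omega] at this

/-- The expansion of `powConv q s n`, uniformly for `s` in a disc around `0`. -/
theorem norm_powConv_sub_le (q K : ℕ) (hK : 1 ≤ K) :
    ∃ C : ℝ, 0 ≤ C ∧ ∀ (s : ℂ) (n : ℕ), ‖s‖ ≤ 1 / 2 → 1 ≤ n →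
      ‖powConv q s n - powConvExpansion q s n (q + K + 1) (q + K + 3)‖
        ≤ C * ((n : ℝ) * (1 / (n : ℝ) ^ (q + K))) := by
  simpa using norm_powConv_sub_shift_le K (q + K + 3) hK q le_rfl 0 (by omega)

/-! ### Taylor coefficients at `s = 0`. -/

/-- The `r`-th Taylor coefficient of `f` at `0`. -/
noncomputable def taylorCoeff (r : ℕ) (f : ℂ → ℂ) : ℂ := iteratedDeriv r f 0 / (r ! : ℂ)

theorem factorial_mul_taylorCoeff (r : ℕ) (f : ℂ → ℂ) :
    (r ! : ℂ) * taylorCoeff r f = iteratedDeriv r f 0 := by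
  have : (r ! : ℂ) ≠ 0 := by exact_mod_cast Nat.factorial_ne_zero r
  rw [taylorCoeff]
  field_simp

theorem taylorCoeff_eq_of_hasSum {f : ℂ → ℂ} {c : ℕ → ℂ}
    (h : ∀ᶠ s in nhds 0, HasSum (fun r => s ^ r * c r) (f s)) (r : ℕ) : taylorCoeff r f = c r := by
  have h1 : HasFPowerSeriesAt f (FormalMultilinearSeries.ofScalars ℂ c) 0 := by
    rw [hasFPowerSeriesAt_iff']
    simpa using h
  have h2 := h1.analyticAt.hasFPowerSeriesAt.eq_formalMultilinearSeries h1
  have h3 := congrArg (fun p => p.coeff r) h2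
  simpa [FormalMultilinearSeries.coeff_ofScalars, taylorCoeff] using h3

theorem taylorCoeff_const_mul (r : ℕ) (c : ℂ) (f : ℂ → ℂ) :
    taylorCoeff r (fun s => c * f s) = c * taylorCoeff r f := by
  rw [taylorCoeff, iteratedDeriv_const_mul_field, taylorCoeff, mul_div_assoc]

theorem taylorCoeff_mul_const (r : ℕ) (c : ℂ) (f : ℂ → ℂ) :
    taylorCoeff r (fun s => f s * c) = taylorCoeff r f * c := by
  rw [← taylorCoeff_const_mul r c f |>.trans (mul_comm _ _)]
  simp only [mul_comm]

theorem taylorCoeff_add (r : ℕ) {f g : ℂ → ℂ} (hf : AnalyticAt ℂ f 0) (hg : AnalyticAt ℂ g 0) :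
    taylorCoeff r (fun s => f s + g s) = taylorCoeff r f + taylorCoeff r g := by
  have := iteratedDeriv_add (n := r) hf.contDiffAt hg.contDiffAt
  rw [taylorCoeff, taylorCoeff, taylorCoeff, ← add_div, ← this]
  rfl

theorem taylorCoeff_sub (r : ℕ) {f g : ℂ → ℂ} (hf : AnalyticAt ℂ f 0) (hg : AnalyticAt ℂ g 0) :
    taylorCoeff r (fun s => f s - g s) = taylorCoeff r f - taylorCoeff r g := by
  have := iteratedDeriv_sub (n := r) hf.contDiffAt hg.contDiffAt
  rw [taylorCoeff, taylorCoeff, taylorCoeff, ← sub_div, ← this]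
  rfl

theorem taylorCoeff_sum (r : ℕ) {ι : Type*} (I : Finset ι) {f : ι → ℂ → ℂ}
    (hf : ∀ i ∈ I, AnalyticAt ℂ (f i) 0) :
    taylorCoeff r (fun s => ∑ i ∈ I, f i s) = ∑ i ∈ I, taylorCoeff r (f i) := by
  simp only [taylorCoeff]
  rw [iteratedDeriv_fun_sum fun i hi => (hf i hi).contDiffAt, Finset.sum_div]

theorem taylorCoeff_mul (r : ℕ) {f g : ℂ → ℂ} (hf : AnalyticAt ℂ f 0) (hg : AnalyticAt ℂ g 0) :
    taylorCoeff r (fun s => f s * g s)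
      = ∑ i ∈ Finset.range (r + 1), taylorCoeff i f * taylorCoeff (r - i) g := by
  rw [taylorCoeff, iteratedDeriv_fun_mul hf.contDiffAt hg.contDiffAt, Finset.sum_div]
  refine Finset.sum_congr rfl fun i hi => ?_
  have hi' : i ≤ r := Nat.lt_succ_iff.1 (Finset.mem_range.1 hi)
  rw [← factorial_mul_taylorCoeff i, ← factorial_mul_taylorCoeff (r - i), Nat.cast_choose ℂ hi']
  have h1 : (r ! : ℂ) ≠ 0 := by exact_mod_cast Nat.factorial_ne_zero r
  have h2 : (i ! : ℂ) ≠ 0 := by exact_mod_cast Nat.factorial_ne_zero i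
  have h3 : ((r - i)! : ℂ) ≠ 0 := by exact_mod_cast Nat.factorial_ne_zero _
  field_simp

theorem taylorCoeff_deriv (r : ℕ) (f : ℂ → ℂ) :
    taylorCoeff r (deriv f) = (r + 1) * taylorCoeff (r + 1) f := by
  rw [taylorCoeff, taylorCoeff, iteratedDeriv_succ', Nat.factorial_succ]
  have h1 : (r ! : ℂ) ≠ 0 := by exact_mod_cast Nat.factorial_ne_zero r
  have h2 : (r : ℂ) + 1 ≠ 0 := by exact_mod_cast Nat.succ_ne_zero r
  push_cast
  field_simp

theorem iteratedDeriv_natCast_cpow_neg {k : ℕ} (hk : 1 ≤ k) (r : ℕ) :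
    iteratedDeriv r (fun s : ℂ => (k : ℂ) ^ (-s)) 0 = (-(Real.log k : ℂ)) ^ r := by
  have hkc : (k : ℂ) ≠ 0 := by exact_mod_cast (by omega : k ≠ 0)
  have e : (fun s : ℂ => (k : ℂ) ^ (-s)) = fun s => Complex.exp (-(Real.log k : ℂ) * s) := by
    funext s
    rw [Complex.cpow_def_of_ne_zero hkc, Complex.natCast_log]
    congr 1; ring
  rw [e, iteratedDeriv_cexp_const_mul]
  simp

theorem analyticAt_natCast_cpow_neg {k : ℕ} (hk : 1 ≤ k) (z : ℂ) :
    AnalyticAt ℂ (fun s : ℂ => (k : ℂ) ^ (-s)) z := by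
  have hkc : (k : ℂ) ≠ 0 := by exact_mod_cast (by omega : k ≠ 0)
  exact Differentiable.analyticAt (differentiable_neg.const_cpow (Or.inl hkc)) z

theorem taylorCoeff_aeval (P : Polynomial ℚ) (r : ℕ) :
    taylorCoeff r (fun s => Polynomial.aeval s P) = (P.coeff r : ℂ) := by
  refine taylorCoeff_eq_of_hasSum (c := fun r => (P.coeff r : ℂ)) (Eventually.of_forall fun s => ?_) r
  rw [Polynomial.aeval_eq_sum_range]
  have h1 : HasSum (fun r => s ^ r * (P.coeff r : ℂ))
      (∑ r ∈ Finset.range (P.natDegree + 1), s ^ r * (P.coeff r : ℂ)) :=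
    hasSum_sum_of_ne_finset_zero (fun i hi => by
      rw [Polynomial.coeff_eq_zero_of_natDegree_lt (by simpa [Nat.lt_succ_iff] using hi)]; simp)
  have h2 : ∑ i ∈ Finset.range (P.natDegree + 1), P.coeff i • s ^ i
      = ∑ r ∈ Finset.range (P.natDegree + 1), s ^ r * (P.coeff r : ℂ) :=
    Finset.sum_congr rfl fun i _ => by rw [Rat.smul_def, mul_comm]
  rw [h2]
  exact h1

/-- Each summand is a geometric series in `s/(k+1)`. The double series converges absolutely for `‖s‖
< 1/2`, and summing over `k` first gives the zeta values. -/
theorem taylorCoeff_harmonicSeries (r : ℕ) :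
    taylorCoeff r harmonicSeries = if r = 0 then 0 else riemannZeta ((r + 1 : ℕ) : ℂ) := by
  refine taylorCoeff_eq_of_hasSum
    (c := fun r => if r = 0 then 0 else riemannZeta ((r + 1 : ℕ) : ℂ)) ?_ r
  filter_upwards [Metric.ball_mem_nhds (0 : ℂ) (by norm_num : (0 : ℝ) < 1 / 2)] with s hs
  have hs' : ‖s‖ < 1 / 2 := by simpa using hs
  have hre : s.re ≤ 1 / 2 := (Complex.re_le_norm s).trans hs'.le
  set g : ℕ × ℕ → ℂ := fun p => s ^ (p.2 + 1) * (1 / ((p.1 : ℂ) + 1) ^ (p.2 + 2)) with hg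
  have hgs : Summable g := by
    have h1 := summable_inv_succ_sq 1
    have h2 : Summable fun j : ℕ => ‖s‖ ^ (j + 1) :=
      (summable_nat_add_iff 1).2 (summable_geometric_of_lt_one (norm_nonneg _) (by linarith))
    have h3 := h1.mul_of_nonneg h2 (fun k => by positivity) (fun j => by positivity)
    refine Summable.of_norm_bounded h3 fun p => ?_
    have e : (p.1 : ℂ) + 1 = ((p.1 + 1 : ℕ) : ℂ) := by push_cast; rfl
    simp only [hg]
    rw [e, norm_mul, norm_div, norm_one, norm_pow, norm_pow, Complex.norm_natCast, one_mul, mul_comm]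
    refine mul_le_mul_of_nonneg_right ?_ (by positivity)
    refine one_div_le_one_div_of_le (by positivity) (pow_le_pow_right₀ ?_ (by omega))
    exact_mod_cast Nat.succ_le_succ (Nat.zero_le p.1)
  have hk : ∀ k : ℕ, HasSum (fun j => g (k, j)) (1 / ((k : ℂ) + 1 - s) - 1 / ((k : ℂ) + 1)) := by
    intro k
    have hk0 : (k : ℂ) + 1 ≠ 0 := by exact_mod_cast Nat.succ_ne_zero k
    have hk1 := add_one_sub_ne_zero hre k
    have hlt : ‖s / ((k : ℂ) + 1)‖ < 1 := by
      have e : (k : ℂ) + 1 = ((k + 1 : ℕ) : ℂ) := by push_cast; rfl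
      rw [norm_div, e, Complex.norm_natCast]
      have : (1 : ℝ) ≤ ((k + 1 : ℕ) : ℝ) := by exact_mod_cast Nat.succ_le_succ (Nat.zero_le k)
      rw [div_lt_one (by positivity)]
      linarith
    have h1 := (hasSum_geometric_of_norm_lt_one hlt).mul_left (s / ((k : ℂ) + 1) ^ 2)
    have e1 : s / ((k : ℂ) + 1) ^ 2 * (1 - s / ((k : ℂ) + 1))⁻¹
        = 1 / ((k : ℂ) + 1 - s) - 1 / ((k : ℂ) + 1) := by
      have : 1 - s / ((k : ℂ) + 1) = ((k : ℂ) + 1 - s) / ((k : ℂ) + 1) := by field_simp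
      rw [this]
      field_simp
      ring
    rw [e1] at h1
    have e2 : (fun j => g (k, j)) = fun i => s / ((k : ℂ) + 1) ^ 2 * (s / ((k : ℂ) + 1)) ^ i := by
      funext j
      simp only [hg]
      rw [div_pow, pow_add ((k : ℂ) + 1) j 2, pow_succ s]
      field_simp
    rw [e2]
    exact h1
  have hj : ∀ j : ℕ, HasSum (fun k => g (k, j)) (s ^ (j + 1) * riemannZeta ((j + 1 + 1 : ℕ) : ℂ)) := by
    intro j
    have h1 : 1 < (((j + 1 + 1 : ℕ) : ℂ)).re := by
      rw [Complex.natCast_re]; exact_mod_cast (by omega : 1 < j + 1 + 1)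
    have h2 := ((summable_nat_add_iff 1).2 (Complex.summable_one_div_nat_cpow.2 h1)).hasSum
    have h3 : riemannZeta ((j + 1 + 1 : ℕ) : ℂ)
        = ∑' k : ℕ, 1 / ((k + 1 : ℕ) : ℂ) ^ ((j + 1 + 1 : ℕ) : ℂ) := by
      rw [zeta_eq_tsum_one_div_nat_add_one_cpow h1]
      simp only [Nat.cast_add, Nat.cast_one]
    rw [← h3] at h2
    have e2 : (fun k => g (k, j))
        = fun k : ℕ => s ^ (j + 1) * (1 / ((k + 1 : ℕ) : ℂ) ^ ((j + 1 + 1 : ℕ) : ℂ)) := by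
      funext k
      rw [Complex.cpow_natCast]
      simp only [hg, Nat.cast_add, Nat.cast_one]
    rw [e2]
    exact h2.mul_left _
  have h1 := hgs.hasSum.prod_fiberwise hk
  have h2 := hgs.prod_symm.hasSum.prod_fiberwise hj
  rw [(hasSum_harmonicSeries hre).unique h1]
  have h3 : ∑' p, g p = ∑' p : ℕ × ℕ, g p.swap := ((Equiv.prodComm ℕ ℕ).tsum_eq g).symm
  rw [h3, ← hasSum_nat_add_iff' 1]
  simp only [Finset.sum_range_one, if_true, mul_zero, sub_zero]
  simpa using h2

/-! ### Multiple harmonic sums as polynomial coefficients. -/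

/-- The polynomial `∏_{l=1}^m (1 + X / l)`. -/
noncomputable def harmPoly (m : ℕ) : Polynomial ℚ :=
  ∏ l ∈ Finset.range m, (1 + Polynomial.C (1 / ((l : ℚ) + 1)) * Polynomial.X)

theorem harmPoly_eq_prod_Icc (m : ℕ) : harmPoly m
    = ∏ i ∈ Finset.Icc (1 : ℤ) m, (1 + Polynomial.C (1 / (i : ℚ)) * Polynomial.X) := by
  induction m with
  | zero => simp [harmPoly]
  | succ m ih =>
    have e : Finset.Icc (1 : ℤ) (m + 1 : ℕ) = insert ((m : ℤ) + 1) (Finset.Icc (1 : ℤ) m) := by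
      ext x; simp; omega
    rw [e, Finset.prod_insert (by simp), ← ih, harmPoly, Finset.prod_range_succ, ← harmPoly, mul_comm]
    push_cast
    rfl

theorem coeff_harmPoly (m r : ℕ) : (harmPoly m).coeff r = multHarm r 1 m := by
  rw [harmPoly_eq_prod_Icc, Finset.prod_one_add, Polynomial.finsetSum_coeff, multHarm,
    if_neg (by omega), Int.toNat_natCast, Finset.powersetCard_eq_filter, Finset.sum_filter]
  refine Finset.sum_congr rfl fun A _ => ?_
  rw [Finset.prod_mul_distrib, Finset.prod_const, ← map_prod, Polynomial.coeff_C_mul_X_pow]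
  simp only [eq_comm]

theorem multHarm_of_neg {r : ℤ} (hr : r < 0) (s t : ℤ) : multHarm r s t = 0 := by
  rw [multHarm, if_pos (Or.inl hr)]

theorem multHarm_of_lt {r m : ℕ} (h : m < r) : multHarm r 1 m = 0 := by
  rw [multHarm, if_neg (by omega), Int.toNat_natCast, Finset.powersetCard_eq_empty.2 (by simpa using h)]
  simp

theorem multHarm_zero (m : ℕ) : multHarm 0 1 m = 1 := by
  rw [multHarm, if_neg (by omega)]; simp

theorem aeval_harmPoly_succ (m : ℕ) (s : ℂ) :
    Polynomial.aeval s (harmPoly (m + 1)) = Polynomial.aeval s (harmPoly m) * (1 + s / (m + 1)) := by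
  rw [harmPoly, Finset.prod_range_succ, ← harmPoly, map_mul]
  congr 1
  simp
  ring

theorem risingCoeff_eq_aeval (m : ℕ) (s : ℂ) :
    risingCoeff (m + 1) s = s * Polynomial.aeval s (harmPoly m) * (1 / (m + 1)) := by
  induction m with
  | zero => simp [risingCoeff, harmPoly]
  | succ m ih =>
    have h1 : (m : ℂ) + 1 ≠ 0 := by exact_mod_cast Nat.succ_ne_zero m
    have h2 : (m : ℂ) + 1 + 1 ≠ 0 := by exact_mod_cast Nat.succ_ne_zero (m + 1)
    have := risingCoeff_succ (m + 1) s
    apply mul_left_cancel₀ h2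
    push_cast at *
    rw [this, ih, aeval_harmPoly_succ]
    field_simp
    ring

/-- The factor `s` of the rising factorial shifts the index by one; at `r = 0` the convention for
negative index gives the required zero. -/
theorem taylorCoeff_risingCoeff (m r : ℕ) :
    taylorCoeff r (risingCoeff (m + 1)) = (multHarm ((r : ℤ) - 1) 1 m : ℂ) * (1 / (m + 1)) := by
  have e : risingCoeff (m + 1)
      = fun s => Polynomial.aeval s (Polynomial.X * harmPoly m) * (1 / ((m : ℂ) + 1)) := by
    funext s; rw [risingCoeff_eq_aeval]; simp
  rw [e, taylorCoeff_mul_const, taylorCoeff_aeval]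
  rcases Nat.eq_zero_or_pos r with rfl | hr
  · rw [multHarm_of_neg (by simp)]; simp
  · obtain ⟨r, rfl⟩ := Nat.exists_eq_add_of_le' hr
    rw [Polynomial.coeff_X_mul, coeff_harmPoly]
    simp

theorem taylorCoeff_risingCoeff_zero (r : ℕ) :
    taylorCoeff r (risingCoeff 0) = if r = 0 then 1 else 0 := by
  have e : risingCoeff 0 = fun _ => (1 : ℂ) := funext risingCoeff_zero
  rw [e, taylorCoeff, iteratedDeriv_const]
  split_ifs with h
  · subst h; simp
  · simp

theorem sum_Icc_int_eq_sum_range {M : Type*} [AddCommMonoid M] (f : ℤ → M) (a b : ℤ) (n : ℕ)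
    (h : a + n = b + 1) : ∑ j ∈ Finset.Icc a b, f j = ∑ i ∈ Finset.range n, f (a + i) := by
  refine (Finset.sum_bij (fun (i : ℕ) _ => a + (i : ℤ)) ?_ ?_ ?_ ?_).symm
  · intro i hi; simp only [Finset.mem_range, Finset.mem_Icc] at *; omega
  · intro i _ j _ h; simpa using h
  · intro j hj
    simp only [Finset.mem_Icc] at hj
    exact ⟨(j - a).toNat, by simp only [Finset.mem_range]; omega, by omega⟩
  · intro i _; rfl

/-! ### The closed form of `D_{r,q}`. -/

/-- Coefficient of `y^(N+1)` in `(1-y)^(-s) (1-y)^s = 1`. Splitting the weight `N + 1` as the sum of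
the two indices and applying `risingCoeff_succ` to each half leaves `N` times the preceding sum. -/
theorem sum_antidiagonal_risingCoeff_mul_neg (N : ℕ) (s : ℂ) :
    ∑ p ∈ Finset.HasAntidiagonal.antidiagonal (N + 1), risingCoeff p.1 s * risingCoeff p.2 (-s) = 0 := by
  have step : ∀ N : ℕ, ((N : ℂ) + 1) *
      ∑ p ∈ Finset.HasAntidiagonal.antidiagonal (N + 1), risingCoeff p.1 s * risingCoeff p.2 (-s)
      = N * ∑ p ∈ Finset.HasAntidiagonal.antidiagonal N, risingCoeff p.1 s * risingCoeff p.2 (-s) := by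
    intro N
    have e1 : ((N : ℂ) + 1) *
        ∑ p ∈ Finset.HasAntidiagonal.antidiagonal (N + 1), risingCoeff p.1 s * risingCoeff p.2 (-s)
        = ∑ p ∈ Finset.HasAntidiagonal.antidiagonal (N + 1), (p.1 : ℂ) * (risingCoeff p.1 s * risingCoeff p.2 (-s))
          + ∑ p ∈ Finset.HasAntidiagonal.antidiagonal (N + 1),
            (p.2 : ℂ) * (risingCoeff p.1 s * risingCoeff p.2 (-s)) := by
      rw [← Finset.sum_add_distrib, Finset.mul_sum]
      refine Finset.sum_congr rfl fun p hp => ?_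
      have : (p.1 : ℂ) + p.2 = N + 1 := by exact_mod_cast Finset.HasAntidiagonal.mem_antidiagonal.1 hp
      rw [← this]; ring
    rw [e1, Finset.Nat.sum_antidiagonal_succ, Finset.Nat.sum_antidiagonal_succ', Finset.mul_sum]
    simp only [Nat.cast_zero, zero_mul, zero_add]
    rw [← Finset.sum_add_distrib]
    refine Finset.sum_congr rfl fun p hp => ?_
    have h0 : (p.1 : ℂ) + p.2 = N := by exact_mod_cast Finset.HasAntidiagonal.mem_antidiagonal.1 hp
    have h1 := risingCoeff_succ p.1 s
    have h2 := risingCoeff_succ p.2 (-s)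
    rw [← h0]
    push_cast
    linear_combination risingCoeff p.2 (-s) * h1 + risingCoeff p.1 s * h2
  have hN : ∀ N : ℕ, (N : ℂ) + 1 ≠ 0 := fun N => by exact_mod_cast Nat.succ_ne_zero N
  induction N with
  | zero => have := step 0; simpa using this
  | succ N ih =>
    have := step (N + 1)
    rw [ih, mul_zero] at this
    exact (mul_eq_zero.1 this).resolve_left (by exact_mod_cast Nat.succ_ne_zero (N + 1))

theorem sum_risingCoeff_succ_mul_neg (N : ℕ) (s : ℂ) :
    ∑ k ∈ Finset.range (N + 1), risingCoeff (k + 1) s * risingCoeff (N - k) (-s)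
      = -risingCoeff (N + 1) (-s) := by
  have h := sum_antidiagonal_risingCoeff_mul_neg N s
  rw [Finset.Nat.sum_antidiagonal_eq_sum_range_succ
    (fun i j => risingCoeff i s * risingCoeff j (-s)), Finset.sum_range_succ'] at h
  simp only [risingCoeff_zero, one_mul, Nat.sub_zero, Nat.add_sub_add_right] at h
  linear_combination h

theorem succ_mul_aeval_harmPoly (m : ℕ) (s : ℂ) :
    ((m : ℂ) + 1) * Polynomial.aeval s (harmPoly (m + 1))
      = (m + 1 + s) * Polynomial.aeval s (harmPoly m) := by
  have h1 : (m : ℂ) + 1 ≠ 0 := by exact_mod_cast Nat.succ_ne_zero m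
  rw [aeval_harmPoly_succ]
  field_simp

theorem aeval_harmPoly_succ_sub (m : ℕ) (s : ℂ) :
    Polynomial.aeval s (harmPoly (m + 1)) - Polynomial.aeval s (harmPoly m)
      = risingCoeff (m + 1) s := by
  have h1 : (m : ℂ) + 1 ≠ 0 := by exact_mod_cast Nat.succ_ne_zero m
  rw [aeval_harmPoly_succ, risingCoeff_eq_aeval]
  field_simp
  ring

theorem succ_mul_aeval_derivative_harmPoly (m : ℕ) (s : ℂ) :
    ((m : ℂ) + 1) * Polynomial.aeval s (Polynomial.derivative (harmPoly (m + 1)))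
      = Polynomial.aeval s (harmPoly m)
        + (m + 1 + s) * Polynomial.aeval s (Polynomial.derivative (harmPoly m)) := by
  have h1 : (m : ℂ) + 1 ≠ 0 := by exact_mod_cast Nat.succ_ne_zero m
  rw [harmPoly, Finset.prod_range_succ, ← harmPoly, Polynomial.derivative_mul]
  simp
  field_simp
  ring

/-- The values of `harmPoly m` at `s` are the coefficients of `(1-y)^(-s-1)`, so the left side is a
convolution. Multiplying by `Q + 1` and using the recursion of `harmPoly` reduces it to the
preceding `Q`. -/
theorem sum_risingCoeff_neg_div_mul_harmPoly (Q : ℕ) (s : ℂ) :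
    ∑ N ∈ Finset.range Q,
      -(risingCoeff (N + 1) (-s) / (N + 1)) * Polynomial.aeval s (harmPoly (Q - 1 - N))
    = (harmonic Q : ℂ) * Polynomial.aeval s (harmPoly Q)
      - Polynomial.aeval s (Polynomial.derivative (harmPoly Q)) := by
  have hN : ∀ N : ℕ, (N : ℂ) + 1 ≠ 0 := fun N => by exact_mod_cast Nat.succ_ne_zero N
  induction Q with
  | zero => simp [harmPoly]
  | succ Q ih =>
    have e1 : ((Q : ℂ) + 1) * ∑ N ∈ Finset.range (Q + 1),
        -(risingCoeff (N + 1) (-s) / (N + 1)) * Polynomial.aeval s (harmPoly (Q + 1 - 1 - N))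
        = -(∑ N ∈ Finset.range (Q + 1),
            risingCoeff (N + 1) (-s) * Polynomial.aeval s (harmPoly (Q - N)))
          + ∑ N ∈ Finset.range Q, ((Q + 1 + s) *
            (-(risingCoeff (N + 1) (-s) / (N + 1)) * Polynomial.aeval s (harmPoly (Q - 1 - N)))
            + risingCoeff (N + 1) (-s) * Polynomial.aeval s (harmPoly (Q - 1 - N))) := by
      rw [Finset.sum_range_succ, Finset.sum_range_succ, mul_add, neg_add, Finset.mul_sum,
        ← Finset.sum_neg_distrib]
      have e2 : ∀ N ∈ Finset.range Q, ((Q : ℂ) + 1) * (-(risingCoeff (N + 1) (-s) / (N + 1)) *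
          Polynomial.aeval s (harmPoly (Q + 1 - 1 - N)))
          = -(risingCoeff (N + 1) (-s) * Polynomial.aeval s (harmPoly (Q - N))) + ((Q + 1 + s) *
            (-(risingCoeff (N + 1) (-s) / (N + 1)) * Polynomial.aeval s (harmPoly (Q - 1 - N)))
            + risingCoeff (N + 1) (-s) * Polynomial.aeval s (harmPoly (Q - 1 - N))) := by
        intro N hN'
        obtain ⟨M, rfl⟩ := Nat.exists_eq_add_of_lt (Finset.mem_range.1 hN')
        have h := succ_mul_aeval_harmPoly M s
        rw [show N + M + 1 + 1 - 1 - N = M + 1 by omega, show N + M + 1 - N = M + 1 by omega,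
          show N + M + 1 - 1 - N = M by omega]
        have := hN N
        push_cast
        field_simp
        linear_combination (-risingCoeff (N + 1) (-s)) * h
      rw [Finset.sum_congr rfl e2, Finset.sum_add_distrib]
      have := hN Q
      simp only [Nat.add_sub_cancel, Nat.sub_self]
      field_simp
      ring
    -- Consecutive `harmPoly` differ by a rising factorial, so the two sums differ by the
    -- convolution of `(1-y)^(-s)` with `(1-y)^s`.
    have e3 : ∑ N ∈ Finset.range (Q + 1),
            risingCoeff (N + 1) (-s) * Polynomial.aeval s (harmPoly (Q - N))
        = ∑ N ∈ Finset.range Q, risingCoeff (N + 1) (-s) * Polynomial.aeval s (harmPoly (Q - 1 - N))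
          - risingCoeff (Q + 1) s := by
      have h := sum_risingCoeff_succ_mul_neg Q (-s)
      rw [neg_neg] at h
      rw [Finset.sum_range_succ] at h ⊢
      have e4 : ∀ N ∈ Finset.range Q, risingCoeff (N + 1) (-s) * Polynomial.aeval s (harmPoly (Q - N))
          = risingCoeff (N + 1) (-s) * Polynomial.aeval s (harmPoly (Q - 1 - N))
            + risingCoeff (N + 1) (-s) * risingCoeff (Q - N) s := by
        intro N hN'
        obtain ⟨M, rfl⟩ := Nat.exists_eq_add_of_lt (Finset.mem_range.1 hN')
        rw [show N + M + 1 - N = M + 1 by omega, show N + M + 1 - 1 - N = M by omega,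
          ← aeval_harmPoly_succ_sub M s]
        ring
      rw [Finset.sum_congr rfl e4, Finset.sum_add_distrib]
      simp only [Nat.sub_self, risingCoeff_zero] at h ⊢
      simp only [harmPoly, Finset.range_zero, Finset.prod_empty, map_one]
      linear_combination h
    apply mul_left_cancel₀ (hN Q)
    rw [e1, Finset.sum_add_distrib, ← Finset.mul_sum, ih, e3]
    have h1 := succ_mul_aeval_harmPoly Q s
    have h2 := succ_mul_aeval_derivative_harmPoly Q s
    have h3 := risingCoeff_eq_aeval Q s
    have h4 := hN Q
    rw [harmonic_succ, h3]
    push_cast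
    field_simp
    linear_combination (-(Q + 1) * (harmonic Q : ℂ) - 1) * h1 + (Q + 1) * h2

/-- The polynomial whose coefficients are the inner brackets of `ratD`. -/
noncomputable def bracketPoly (M j : ℕ) : Polynomial ℚ :=
  Polynomial.C (1 / ((j : ℚ) + 1)) * harmPoly M
    - ∑ v ∈ Finset.range M, Polynomial.C (1 / (((v : ℚ) + 1) * (v + 1 + (j + 1)))) *
        (Polynomial.X * ((harmPoly v).comp (-Polynomial.X) * harmPoly (M - 1 - v)))

theorem risingCoeff_mul_aeval_bracketPoly (M j : ℕ) (s : ℂ) :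
    Polynomial.aeval s (bracketPoly M j) = ∑ v ∈ Finset.range (M + 1),
      risingCoeff v (-s) / (v + j + 1) * Polynomial.aeval s (harmPoly (M - v)) := by
  rw [Finset.sum_range_succ', bracketPoly, map_sub, map_sum, sub_eq_neg_add, ← Finset.sum_neg_distrib]
  congr 1
  · refine Finset.sum_congr rfl fun v hv => ?_
    have h1 : (v : ℂ) + 1 ≠ 0 := by exact_mod_cast Nat.succ_ne_zero v
    have h2 : (v : ℂ) + 1 + j + 1 ≠ 0 := by exact_mod_cast Nat.succ_ne_zero (v + 1 + j)
    rw [risingCoeff_eq_aeval, show M - (v + 1) = M - 1 - v by omega]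
    simp only [map_mul, Polynomial.aeval_C, Polynomial.aeval_X, Polynomial.aeval_comp, map_neg]
    simp
    have h3 : (v : ℂ) + 1 + (j + 1) ≠ 0 := by rwa [← add_assoc]
    field_simp
    ring
  · simp

/-- The factor `s` turns `harmPoly j / (j+1)` into `risingCoeff (j+1) s`. On the diagonal `j + v =
N` the denominator `v + j + 1` is constant, and the convolution identity collapses the diagonal to
`-risingCoeff (N+1) (-s)`. -/
theorem X_mul_sum_bracketPoly (Q : ℕ) (s : ℂ) :
    s * ∑ j ∈ Finset.range Q, 1 / ((j : ℂ) + 1) * (Polynomial.aeval s (harmPoly j) *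
        Polynomial.aeval s (bracketPoly (Q - 1 - j) j))
    = (harmonic Q : ℂ) * Polynomial.aeval s (harmPoly Q)
      - Polynomial.aeval s (Polynomial.derivative (harmPoly Q)) := by
  rw [← sum_risingCoeff_neg_div_mul_harmPoly, Finset.mul_sum]
  have e1 : ∀ j ∈ Finset.range Q, s * (1 / ((j : ℂ) + 1) * (Polynomial.aeval s (harmPoly j) *
        Polynomial.aeval s (bracketPoly (Q - 1 - j) j)))
      = ∑ v ∈ Finset.range (Q - j), risingCoeff (j + 1) s * (risingCoeff v (-s) / (v + j + 1) *
          Polynomial.aeval s (harmPoly (Q - 1 - (j + v)))) := by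
    intro j hj
    have := Finset.mem_range.1 hj
    rw [risingCoeff_mul_aeval_bracketPoly, risingCoeff_eq_aeval, ← Finset.mul_sum,
      show Q - 1 - j + 1 = Q - j by omega]
    simp only [Nat.sub_sub]
    ring_nf
  rw [Finset.sum_congr rfl e1, ← Finset.sum_range_diag_flip]
  refine Finset.sum_congr rfl fun N _ => ?_
  rw [neg_div', ← sum_risingCoeff_succ_mul_neg, Finset.sum_div, Finset.sum_mul]
  refine Finset.sum_congr rfl fun k hk => ?_
  have hk' : k ≤ N := Nat.lt_succ_iff.1 (Finset.mem_range.1 hk)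
  rw [show k + (N - k) = N by omega, Nat.cast_sub hk', sub_add_cancel]
  ring

theorem natDegree_harmPoly_le (m : ℕ) : (harmPoly m).natDegree ≤ m := by
  refine (Polynomial.natDegree_prod_le _ _).trans ?_
  refine (Finset.sum_le_card_nsmul _ _ 1 fun l _ => ?_).trans (by simp)
  refine (Polynomial.natDegree_add_le _ _).trans ?_
  simp only [Polynomial.natDegree_one, zero_le, sup_of_le_right]
  exact (Polynomial.natDegree_C_mul_le _ _).trans Polynomial.natDegree_X_le

theorem natDegree_harmPoly_comp_neg_X_le (m : ℕ) :
    ((harmPoly m).comp (-Polynomial.X)).natDegree ≤ m := by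
  rw [Polynomial.natDegree_comp]
  simpa using natDegree_harmPoly_le m

theorem coeff_harmPoly_comp_neg_X (m i : ℕ) :
    ((harmPoly m).comp (-Polynomial.X)).coeff i = (-1) ^ i * multHarm i 1 m := by
  have e : (-Polynomial.X : Polynomial ℚ) = Polynomial.C (-1) * Polynomial.X := by simp
  rw [e, Polynomial.comp_C_mul_X_coeff, coeff_harmPoly, mul_comm]

theorem natDegree_bracketPoly_le (M j : ℕ) : (bracketPoly M j).natDegree ≤ M := by
  refine (Polynomial.natDegree_sub_le _ _).trans (max_le ?_ ?_)
  · exact (Polynomial.natDegree_C_mul_le _ _).trans (natDegree_harmPoly_le M)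
  · refine Polynomial.natDegree_sum_le_of_forall_le _ _ fun v hv => ?_
    have := Finset.mem_range.1 hv
    refine (Polynomial.natDegree_C_mul_le _ _).trans (Polynomial.natDegree_mul_le.trans ?_)
    have h1 := Polynomial.natDegree_mul_le (p := (harmPoly v).comp (-Polynomial.X))
      (q := harmPoly (M - 1 - v))
    have h2 := natDegree_harmPoly_le (M - 1 - v)
    have h3 := natDegree_harmPoly_comp_neg_X_le v
    rw [Polynomial.natDegree_X]
    omega

theorem coeff_X_mul_mul_harmPoly {F : Polynomial ℚ} {v : ℕ} (hF : F.natDegree ≤ v) (m T : ℕ) :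
    (Polynomial.X * (F * harmPoly m)).coeff T
      = ∑ i ∈ Finset.range (v + 1), F.coeff i * multHarm ((T : ℤ) - 1 - i) 1 m := by
  have e : Polynomial.X * (F * harmPoly m)
      = ∑ i ∈ Finset.range (v + 1), Polynomial.C (F.coeff i) *
        (Polynomial.X ^ (i + 1) * harmPoly m) := by
    conv_lhs => rw [Polynomial.as_sum_range_C_mul_X_pow' F (Nat.lt_succ_of_le hF)]
    rw [Finset.sum_mul, Finset.mul_sum]
    refine Finset.sum_congr rfl fun i _ => ?_
    ring
  rw [e, Polynomial.finsetSum_coeff]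
  refine Finset.sum_congr rfl fun i _ => ?_
  rw [Polynomial.coeff_C_mul, Polynomial.coeff_X_pow_mul']
  congr 1
  split_ifs with h
  · rw [coeff_harmPoly]
    congr 1
    omega
  · rw [multHarm_of_neg (by omega)]

theorem coeff_bracketPoly (M j T : ℕ) : (bracketPoly M j).coeff T
    = multHarm T 1 M / ((j : ℚ) + 1) - ∑ v ∈ Finset.range M,
      (∑ i ∈ Finset.range (v + 1),
        (-1) ^ i * multHarm i 1 v * multHarm ((T : ℤ) - 1 - i) 1 ((M : ℤ) - 1 - v)) /
        (((v : ℚ) + 1) * (v + 1 + (j + 1))) := by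
  rw [bracketPoly, Polynomial.coeff_sub, Polynomial.coeff_C_mul, coeff_harmPoly,
    Polynomial.finsetSum_coeff]
  congr 1
  · ring
  · refine Finset.sum_congr rfl fun v hv => ?_
    have := Finset.mem_range.1 hv
    rw [Polynomial.coeff_C_mul, coeff_X_mul_mul_harmPoly (natDegree_harmPoly_comp_neg_X_le v),
      one_div, inv_mul_eq_div]
    congr 1
    refine Finset.sum_congr rfl fun i _ => ?_
    rw [coeff_harmPoly_comp_neg_X, show ((M - 1 - v : ℕ) : ℤ) = (M : ℤ) - 1 - v by omega]

theorem eq_of_forall_aeval_eq {P P' : Polynomial ℚ}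
    (h : ∀ s : ℂ, Polynomial.aeval s P = Polynomial.aeval s P') : P = P' := by
  ext r
  have := taylorCoeff_aeval P r
  rw [funext h, taylorCoeff_aeval] at this
  exact_mod_cast this.symm

theorem X_mul_sum_harmPoly_mul_bracketPoly (Q : ℕ) :
    Polynomial.X * ∑ j ∈ Finset.range Q, Polynomial.C (1 / ((j : ℚ) + 1)) *
      (harmPoly j * bracketPoly (Q - 1 - j) j)
    = Polynomial.C (harmonic Q) * harmPoly Q - Polynomial.derivative (harmPoly Q) := by
  refine eq_of_forall_aeval_eq fun s => ?_
  have := X_mul_sum_bracketPoly Q s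
  simp only [map_mul, map_sub, map_sum, Polynomial.aeval_X, Polynomial.aeval_C]
  simpa using this

/-- Constant coefficient of the preceding identity, whose left side is divisible by `X`. -/
theorem harmonic_eq_multHarm (Q : ℕ) : harmonic Q = multHarm 1 1 Q := by
  have h := congrArg (fun P => Polynomial.coeff P 0) (X_mul_sum_harmPoly_mul_bracketPoly Q)
  simp only [Polynomial.mul_coeff_zero, Polynomial.coeff_X_zero, zero_mul, Polynomial.coeff_sub,
    Polynomial.coeff_C_zero, Polynomial.coeff_derivative, coeff_harmPoly] at h
  simp only [Nat.cast_zero, multHarm_zero, zero_add, Nat.cast_one, mul_one] at h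
  linarith

theorem ratD_add_two (R Q : ℕ) (h : R < Q) : ratD ((R : ℤ) + 2) ((Q : ℤ) + 2)
    = (∑ j ∈ Finset.range Q, Polynomial.C (1 / ((j : ℚ) + 1)) *
      (harmPoly j * bracketPoly (Q - 1 - j) j)).coeff R
      + multHarm ((R : ℤ) + 1) 1 Q / ((Q : ℚ) + 1) - multHarm ((R : ℤ) + 2) 1 Q := by
  have e1 : (∑ j ∈ Finset.range Q, Polynomial.C (1 / ((j : ℚ) + 1)) *
      (harmPoly j * bracketPoly (Q - 1 - j) j)).coeff R
      = ∑ u ∈ Finset.range (R + 1), ∑ j ∈ Finset.range Q,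
        multHarm u 1 j / ((j : ℚ) + 1) * (bracketPoly (Q - 1 - j) j).coeff (R - u) := by
    rw [Polynomial.finsetSum_coeff, Finset.sum_comm]
    refine Finset.sum_congr rfl fun j _ => ?_
    rw [Polynomial.coeff_C_mul, Polynomial.coeff_mul,
      Finset.Nat.sum_antidiagonal_eq_sum_range_succ
        (fun a b => (harmPoly j).coeff a * (bracketPoly (Q - 1 - j) j).coeff b), Finset.mul_sum]
    refine Finset.sum_congr rfl fun u _ => ?_
    rw [coeff_harmPoly]
    ring
  rw [e1, ratD, sum_Icc_int_eq_sum_range _ _ _ (R + 1) (by push_cast; ring)]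
  have e2 : (((Q : ℤ) + 2 : ℤ) : ℚ) - 1 = (Q : ℚ) + 1 := by push_cast; ring
  rw [e2, show (R : ℤ) + 2 - 1 = R + 1 by ring, show (Q : ℤ) + 2 - 2 = Q by ring]
  congr 2
  refine Finset.sum_congr rfl fun u hu => ?_
  have hu' : u ≤ R := Nat.lt_succ_iff.1 (Finset.mem_range.1 hu)
  rw [sum_Icc_int_eq_sum_range _ _ _ (Q - R + u) (by push_cast [Nat.cast_sub h.le]; ring)]
  have hsub : Finset.range (Q - R + u) ⊆ Finset.range Q := Finset.range_subset_range.2 (by omega)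
  -- The definition of `ratD` stops at `j = q - r + u`. Beyond that, `bracketPoly` has degree at
  -- most `Q - 1 - j < R - u`, so the additional coefficients vanish.
  rw [← Finset.sum_subset hsub (fun j hj hj' => by
    rw [Finset.mem_range] at hj hj'
    rw [Polynomial.coeff_eq_zero_of_natDegree_lt
      ((natDegree_bracketPoly_le _ _).trans_lt (by omega)), mul_zero])]
  refine Finset.sum_congr rfl fun j hj => ?_
  have hj' : j < Q := by have := Finset.mem_range.1 hj; omega
  rw [coeff_bracketPoly]
  rw [sum_Icc_int_eq_sum_range _ _ _ (Q - 1 - j) (by omega)]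
  rw [show (1 : ℤ) + j - 1 = j by ring, show (0 : ℤ) + u = u by ring,
    show (R : ℤ) + 2 - 2 - u = ((R - u : ℕ) : ℤ) by omega,
    show (Q : ℤ) + 2 - (1 + j) - 2 = ((Q - 1 - j : ℕ) : ℤ) by omega]
  have e3 : (((1 : ℤ) + j : ℤ) : ℚ) = (j : ℚ) + 1 := by push_cast; ring
  rw [e3]
  congr 2
  refine Finset.sum_congr rfl fun v hv => ?_
  have hv' := Finset.mem_range.1 hv
  rw [sum_Icc_int_eq_sum_range _ _ _ (v + 1) (by push_cast; ring)]
  have e4 : (((1 : ℤ) + v : ℤ) : ℚ) = (v : ℚ) + 1 := by push_cast; ring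
  rw [e4]
  congr 1
  refine Finset.sum_congr rfl fun i _ => ?_
  rw [show (0 : ℤ) + i = i by ring, zpow_natCast, show (1 : ℤ) + v - 1 = v by ring,
    show (R : ℤ) + 2 - 3 - u - i = ((R - u : ℕ) : ℤ) - 1 - i by omega,
    show ((Q - 1 - j : ℕ) : ℤ) - (1 + v) = ((Q - 1 - j : ℕ) : ℤ) - 1 - v by ring]

/-- For `r ≥ 2` this is the coefficient of `X^(r-1)` in `X_mul_sum_harmPoly_mul_bracketPoly`; for `r
≤ 1` the double sum is empty. -/
theorem ratD_eq {r q : ℕ} (hq : 2 ≤ q) (hr : r < q) : ratD r q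
    = harmonic (q - 1) * multHarm ((r : ℤ) - 1) 1 ((q : ℤ) - 2)
      - (r + 1) * multHarm r 1 ((q : ℤ) - 2) := by
  obtain ⟨Q, rfl⟩ := Nat.exists_eq_add_of_le' hq
  have hQ : ((Q + 2 : ℕ) : ℤ) - 2 = Q := by push_cast; ring
  have hQ1 : (Q : ℚ) + 1 ≠ 0 := by exact_mod_cast Nat.succ_ne_zero Q
  rw [hQ, show Q + 2 - 1 = Q + 1 by omega, harmonic_succ]
  rcases r with _ | _ | R
  · rw [ratD]
    simp only [hQ]
    rw [Finset.Icc_eq_empty (by norm_num)]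
    simp [multHarm_of_neg, multHarm_zero]
  · rw [ratD]
    simp only [hQ]
    rw [Finset.Icc_eq_empty (by norm_num)]
    simp [multHarm_zero, harmonic_eq_multHarm]
    ring
  · have h := congrArg (fun P => Polynomial.coeff P (R + 1)) (X_mul_sum_harmPoly_mul_bracketPoly Q)
    simp only [Polynomial.coeff_X_mul, Polynomial.coeff_sub,
      Polynomial.coeff_C_mul, Polynomial.coeff_derivative, coeff_harmPoly] at h
    have := ratD_add_two R Q (by omega)
    push_cast at h this ⊢
    rw [show (R : ℤ) + 1 + 1 = R + 2 by ring] at h ⊢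
    rw [this, h, show (R : ℤ) + 2 - 1 = R + 1 by ring]
    ring

/-! ### Analyticity in `s` and passage to sums of powers of logarithms. -/

theorem analyticAt_expansionCoeff (q i n : ℕ) {z : ℂ} (hz : z ∈ Metric.ball (0 : ℂ) (1 / 2)) :
    AnalyticAt ℂ (fun s => expansionCoeff q i s n) z := by
  have h1 := (differentiable_risingCoeff i).analyticAt z
  have h2 : AnalyticAt ℂ harmonicSeries z :=
    differentiableOn_harmonicSeries.analyticAt (Metric.isOpen_ball.mem_nhds hz)
  unfold expansionCoeff logCoeff
  split_ifs
  · exact (h1.fun_mul (analyticAt_const.fun_add h2)).fun_sub h1.deriv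
  · exact h1.fun_mul analyticAt_const

theorem analyticAt_riemannZeta_sub (j : ℕ) {z : ℂ} (hz : z ∈ Metric.ball (0 : ℂ) (1 / 2)) :
    AnalyticAt ℂ (fun s => riemannZeta (s - j)) z := by
  refine DifferentiableOn.analyticAt (s := Metric.ball (0 : ℂ) (1 / 2)) (fun s hs => ?_)
    (Metric.isOpen_ball.mem_nhds hz)
  have hs1 : s - j ≠ 1 := by
    intro h
    have h1 : s = ((j + 1 : ℕ) : ℂ) := by push_cast; linear_combination h
    have h2 : ‖s‖ < 1 / 2 := by simpa using hs
    rw [h1, Complex.norm_natCast] at h2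
    have h3 : (1 : ℝ) ≤ ((j + 1 : ℕ) : ℝ) := by exact_mod_cast Nat.succ_le_succ (Nat.zero_le j)
    linarith
  exact ((differentiableAt_riemannZeta hs1).comp s
    (differentiableAt_id.sub_const _)).differentiableWithinAt

theorem powConvExpansion_eq {q : ℕ} (hq : 1 ≤ q) (s : ℂ) (n I J : ℕ) :
    powConvExpansion q s n I J
      = ∑ i ∈ Finset.range I, expansionCoeff q i s n * (n : ℂ) ^ (-s) * (1 / (n : ℂ) ^ i)
        + ∑ j ∈ Finset.range J, ((q + j - 1).choose j : ℂ) * riemannZeta (s - j)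
          * (1 / (n : ℂ) ^ (q + j)) := by
  rw [powConvExpansion, if_neg (by omega), add_zero, Finset.mul_sum]
  congr 1
  refine Finset.sum_congr rfl fun i _ => ?_
  ring

theorem analyticAt_powConvExpansion {q : ℕ} (hq : 1 ≤ q) {n : ℕ} (hn : 1 ≤ n) (I J : ℕ) {z : ℂ}
    (hz : z ∈ Metric.ball (0 : ℂ) (1 / 2)) :
    AnalyticAt ℂ (fun s => powConvExpansion q s n I J) z := by
  simp only [powConvExpansion_eq hq]
  refine AnalyticAt.fun_add (Finset.analyticAt_fun_sum _ fun i _ => ?_)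
    (Finset.analyticAt_fun_sum _ fun j _ => ?_)
  · exact ((analyticAt_expansionCoeff q i n hz).fun_mul
      (analyticAt_natCast_cpow_neg hn z)).fun_mul analyticAt_const
  · exact (analyticAt_const.fun_mul (analyticAt_riemannZeta_sub j hz)).fun_mul analyticAt_const

theorem analyticAt_powConv (q n : ℕ) (z : ℂ) : AnalyticAt ℂ (fun s => powConv q s n) z := by
  unfold powConv
  refine Finset.analyticAt_fun_sum _ fun k hk => ?_
  simp only [div_eq_mul_inv]
  exact (analyticAt_natCast_cpow_neg (Finset.mem_Ico.1 hk).1 z).fun_mul analyticAt_const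

theorem taylorCoeff_natCast_cpow_neg {k : ℕ} (hk : 1 ≤ k) (r : ℕ) :
    taylorCoeff r (fun s : ℂ => (k : ℂ) ^ (-s)) = (-1) ^ r * (Real.log k : ℂ) ^ r / (r ! : ℂ) := by
  rw [taylorCoeff, iteratedDeriv_natCast_cpow_neg hk, neg_pow]

theorem logPowSum_eq_taylorCoeff (p q n : ℕ) :
    (logPowSum p q n : ℂ) = (-1) ^ p * (p ! : ℂ) * taylorCoeff p (fun s => powConv q s n) := by
  have h1 : (p ! : ℂ) ≠ 0 := by exact_mod_cast Nat.factorial_ne_zero p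
  unfold powConv
  simp only [div_eq_mul_inv]
  rw [taylorCoeff_sum _ _ fun k hk =>
    (analyticAt_natCast_cpow_neg (Finset.mem_Ico.1 hk).1 0).fun_mul analyticAt_const, logPowSum]
  push_cast
  rw [Finset.mul_sum]
  refine Finset.sum_congr rfl fun k hk => ?_
  rw [taylorCoeff_mul_const, taylorCoeff_natCast_cpow_neg (Finset.mem_Ico.1 hk).1]
  have h2 : ((-1 : ℂ) ^ p) * (-1) ^ p = 1 := by rw [← mul_pow]; simp
  rw [← Complex.natCast_log]
  field_simp
  linear_combination (-((Real.log k : ℂ) ^ p * (((n : ℂ) - k) ^ q)⁻¹)) * h2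

/-- The coefficient of `1 / n ^ i`, a polynomial in `log n`, in the expansion of `logPowSum p q n`. -/
noncomputable def logPoly (p q i n : ℕ) : ℂ :=
  ∑ r ∈ Finset.range (p + 1), (-1) ^ r * ((p ! : ℂ) / ((p - r)! : ℂ)) *
    taylorCoeff r (fun s => expansionCoeff q i s n) * (Real.log n : ℂ) ^ (p - r)

/-- Leibniz rule: the Taylor coefficients of `n^(-s)` are powers of `-log n` over factorials, which
turns the first family into polynomials in `log n`; the second yields derivatives of `ζ`. -/
theorem taylorCoeff_powConvExpansion (p : ℕ) {q : ℕ} (hq : 1 ≤ q) {n : ℕ} (hn : 1 ≤ n) (I J : ℕ) :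
    (-1) ^ p * (p ! : ℂ) * taylorCoeff p (fun s => powConvExpansion q s n I J)
      = ∑ i ∈ Finset.range I, logPoly p q i n * (1 / (n : ℂ) ^ i)
        + ∑ j ∈ Finset.range J, (-1) ^ p * ((q + j - 1).choose j : ℂ) * zetaDeriv p (-(j : ℂ))
          * (1 / (n : ℂ) ^ (q + j)) := by
  have h0 : (0 : ℂ) ∈ Metric.ball (0 : ℂ) (1 / 2) := by simp
  have hA := fun i => analyticAt_expansionCoeff q i n h0
  have hB := analyticAt_natCast_cpow_neg hn 0
  have hZ := fun j => analyticAt_riemannZeta_sub j h0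
  simp only [powConvExpansion_eq hq]
  rw [taylorCoeff_add p
    (Finset.analyticAt_fun_sum _ fun i _ => ((hA i).fun_mul hB).fun_mul analyticAt_const)
    (Finset.analyticAt_fun_sum _ fun j _ =>
      (analyticAt_const.fun_mul (hZ j)).fun_mul analyticAt_const),
    taylorCoeff_sum _ _ (fun i _ => ((hA i).fun_mul hB).fun_mul analyticAt_const),
    taylorCoeff_sum _ _ (fun j _ => (analyticAt_const.fun_mul (hZ j)).fun_mul analyticAt_const),
    mul_add, Finset.mul_sum, Finset.mul_sum]
  congr 1
  · refine Finset.sum_congr rfl fun i _ => ?_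
    rw [taylorCoeff_mul_const, taylorCoeff_mul p (hA i) hB, ← mul_assoc]
    congr 1
    rw [logPoly, Finset.mul_sum]
    refine Finset.sum_congr rfl fun r hr => ?_
    have hr' : r ≤ p := Nat.lt_succ_iff.1 (Finset.mem_range.1 hr)
    rw [taylorCoeff_natCast_cpow_neg hn]
    have e : (-1 : ℂ) ^ p * (-1) ^ (p - r) = (-1) ^ r := by
      obtain ⟨d, rfl⟩ := Nat.exists_eq_add_of_le hr'
      rw [Nat.add_sub_cancel_left, pow_add, mul_assoc, ← mul_pow]; simp
    rw [← e]
    ring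
  · refine Finset.sum_congr rfl fun j _ => ?_
    rw [taylorCoeff_mul_const, taylorCoeff_const_mul, zetaDeriv]
    have h := factorial_mul_taylorCoeff p (fun s => riemannZeta (s - j))
    rw [iteratedDeriv_comp_sub_const] at h
    simp only [zero_sub] at h
    rw [← h]
    ring

/-- Cauchy's estimate on the circle of radius `1/4`, inside the disc where the error bound is
uniform. -/
theorem norm_logPowSum_sub_le (p : ℕ) {q : ℕ} (hq : 1 ≤ q) (m : ℕ) : ∃ C : ℝ, ∀ n : ℕ, 1 ≤ n →
    ‖(logPowSum p q n : ℂ) - (∑ i ∈ Finset.range (q + m + 2), logPoly p q i n * (1 / (n : ℂ) ^ i)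
        + ∑ j ∈ Finset.range (q + m + 4), (-1) ^ p * ((q + j - 1).choose j : ℂ)
          * zetaDeriv p (-(j : ℂ)) * (1 / (n : ℂ) ^ (q + j)))‖
      ≤ C * (1 / (n : ℝ) ^ (m + q)) := by
  -- Order `m + 1` makes up for the extra factor `n` in the uniform bound.
  obtain ⟨C, hC, h⟩ := norm_powConv_sub_le q (m + 1) (by omega)
  refine ⟨p ! * C / (1 / 4) ^ p, fun n hn => ?_⟩
  have hI : q + (m + 1) + 1 = q + m + 2 := by omega
  have hJ : q + (m + 1) + 3 = q + m + 4 := by omega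
  rw [hI, hJ] at h
  have h0 : (0 : ℂ) ∈ Metric.ball (0 : ℂ) (1 / 2) := by simp
  have hn0 : (n : ℝ) ≠ 0 := by exact_mod_cast (by omega : n ≠ 0)
  rw [logPowSum_eq_taylorCoeff, ← taylorCoeff_powConvExpansion p hq hn, ← mul_sub,
    ← taylorCoeff_sub p (analyticAt_powConv q n 0) (analyticAt_powConvExpansion hq hn _ _ h0),
    mul_assoc, factorial_mul_taylorCoeff, norm_mul, norm_pow, norm_neg, norm_one, one_pow, one_mul]
  have hd : DiffContOnCl ℂ
      (fun s => powConv q s n - powConvExpansion q s n (q + m + 2) (q + m + 4))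
      (Metric.ball 0 (1 / 4)) := by
    refine DifferentiableOn.diffContOnCl_ball (U := Metric.ball 0 (1 / 2)) (fun z hz => ?_)
      (Metric.closedBall_subset_ball (by norm_num))
    exact ((analyticAt_powConv q n z).fun_sub
      (analyticAt_powConvExpansion hq hn _ _ hz)).differentiableAt.differentiableWithinAt
  refine (Complex.norm_iteratedDeriv_le_of_forall_mem_sphere_norm_le p (by norm_num) hd
    (fun z hz => h z n ?_ hn)).trans (le_of_eq ?_)
  · have : ‖z‖ = 1 / 4 := by simpa using hz
    rw [this]; norm_num
  · have e : (n : ℝ) * (1 / (n : ℝ) ^ (q + (m + 1))) = 1 / (n : ℝ) ^ (m + q) := by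
      rw [show q + (m + 1) = (m + q) + 1 by ring, pow_succ]
      field_simp
    rw [e]
    ring

/-! ### Identification of the coefficients. -/

theorem logPoly_zero (p : ℕ) {q : ℕ} (hq : 2 ≤ q) (n : ℕ) :
    logPoly p q 0 n = riemannZeta q * (Real.log n : ℂ) ^ p := by
  have e : (fun s => expansionCoeff q 0 s n) = fun s => risingCoeff 0 s * riemannZeta q := by
    funext s
    rw [expansionCoeff, if_neg (by omega)]
    simp
  have h1 : (p ! : ℂ) ≠ 0 := by exact_mod_cast Nat.factorial_ne_zero p
  rw [logPoly, Finset.sum_range_succ', Finset.sum_eq_zero]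
  · rw [e, taylorCoeff_mul_const, taylorCoeff_risingCoeff_zero]
    simp [h1]
  · intro r _
    rw [e, taylorCoeff_mul_const, taylorCoeff_risingCoeff_zero]
    simp

theorem coeffC_zero (p i : ℕ) : coeffC p i 0 = 0 := by
  rw [coeffC, multHarm_of_neg (by simp), mul_zero]

theorem coeffC_of_lt (p : ℕ) {i r : ℕ} (hi : 1 ≤ i) (h : i < r) : coeffC p i r = 0 := by
  have h1 : multHarm ((r : ℤ) - 1) 1 ((i : ℤ) - 1) = 0 := by
    have := multHarm_of_lt (show i - 1 < r - 1 by omega)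
    rwa [Nat.cast_sub (by omega), Nat.cast_sub (by omega)] at this
  rw [coeffC, h1, mul_zero]

theorem logPoly_of_ne (p : ℕ) {q i : ℕ} (hi : 1 ≤ i) (hiq : i + 1 ≠ q) (n : ℕ) :
    logPoly p q i n = riemannZeta ((q : ℂ) - i) / i *
      ∑ r ∈ Finset.Icc 1 p, (coeffC p i r : ℂ) * (Real.log n : ℂ) ^ (p - r) := by
  have e : (fun s => expansionCoeff q i s n) = fun s => risingCoeff i s * riemannZeta ((q : ℂ) - i) := by
    funext s
    rw [expansionCoeff, if_neg hiq]
  have hr : Finset.range (p + 1) = insert 0 (Finset.Icc 1 p) := by ext x; simp; omega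
  have h2 : ∑ r ∈ Finset.Icc 1 p, (coeffC p i r : ℂ) * (Real.log n : ℂ) ^ (p - r)
      = ∑ r ∈ Finset.range (p + 1), (coeffC p i r : ℂ) * (Real.log n : ℂ) ^ (p - r) := by
    rw [hr, Finset.sum_insert (by simp), coeffC_zero]; simp
  rw [h2, logPoly, Finset.mul_sum]
  obtain ⟨m, rfl⟩ := Nat.exists_eq_add_of_le' hi
  refine Finset.sum_congr rfl fun r _ => ?_
  rw [e, taylorCoeff_mul_const, taylorCoeff_risingCoeff, coeffC,
    show ((m + 1 : ℕ) : ℤ) - 1 = m by push_cast; ring]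
  push_cast
  ring

theorem sum_multHarm_mul_taylorCoeff_harmonicSeries (Q r : ℕ) :
    ∑ i ∈ Finset.range (r + 1),
      (multHarm ((i : ℤ) - 1) 1 Q : ℂ) * taylorCoeff (r - i) harmonicSeries
    = ∑ s ∈ Finset.Icc 2 r, (multHarm ((r : ℤ) - (s : ℤ)) 1 Q : ℂ) * riemannZeta s := by
  rw [← Finset.sum_range_reflect]
  have hsub : Finset.Ico 1 r ⊆ Finset.range (r + 1) := fun x hx => by
    simp only [Finset.mem_Ico, Finset.mem_range] at *; omega
  rw [← Finset.sum_subset hsub]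
  · rw [show Finset.Icc 2 r = Finset.Ico (1 + 1) (r + 1) from rfl, ← Finset.sum_Ico_add']
    refine Finset.sum_congr rfl fun k hk => ?_
    rw [Finset.mem_Ico] at hk
    rw [show r - (r + 1 - 1 - k) = k by omega, taylorCoeff_harmonicSeries, if_neg (by omega),
      show ((r + 1 - 1 - k : ℕ) : ℤ) - 1 = (r : ℤ) - ((k + 1 : ℕ) : ℤ) by omega]
  · intro k hk hk'
    rw [Finset.mem_range] at hk
    rw [Finset.mem_Ico] at hk'
    rcases Nat.eq_zero_or_pos k with rfl | hk0
    · rw [show r - (r + 1 - 1 - 0) = 0 by omega, taylorCoeff_harmonicSeries]; simp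
    · rw [multHarm_of_neg (by omega)]; simp

theorem taylorCoeff_logCoeff (Q n r : ℕ) :
    ((Q : ℂ) + 1) * taylorCoeff r (fun s => logCoeff (Q + 1) s n)
      = (multHarm ((r : ℤ) - 1) 1 Q : ℂ) *
          (Real.log n + Real.eulerMascheroniConstant + (harmonic (Q + 1) : ℂ))
        + ∑ s ∈ Finset.Icc 2 r, (multHarm ((r : ℤ) - (s : ℤ)) 1 Q : ℂ) * riemannZeta s
        - (r + 1) * (multHarm r 1 Q : ℂ) := by
  have hQ : (Q : ℂ) + 1 ≠ 0 := by exact_mod_cast Nat.succ_ne_zero Q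
  have h1 := (differentiable_risingCoeff (Q + 1)).analyticAt 0
  have h2 : AnalyticAt ℂ harmonicSeries 0 :=
    differentiableOn_harmonicSeries.analyticAt (Metric.isOpen_ball.mem_nhds (by simp))
  have e : (fun s => logCoeff (Q + 1) s n) = fun s => (risingCoeff (Q + 1) s *
      (Real.log n + Real.eulerMascheroniConstant + (harmonic (Q + 1) : ℂ))
      + risingCoeff (Q + 1) s * harmonicSeries s) - deriv (risingCoeff (Q + 1)) s := by
    funext s
    rw [logCoeff]
    ring
  rw [e, taylorCoeff_sub r ((h1.fun_mul analyticAt_const).fun_add (h1.fun_mul h2)) h1.deriv,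
    taylorCoeff_add r (h1.fun_mul analyticAt_const) (h1.fun_mul h2), taylorCoeff_mul_const,
    taylorCoeff_mul r h1 h2, taylorCoeff_deriv,
    ← sum_multHarm_mul_taylorCoeff_harmonicSeries]
  simp only [taylorCoeff_risingCoeff]
  have e2 : ∑ i ∈ Finset.range (r + 1), (multHarm ((i : ℤ) - 1) 1 Q : ℂ) * (1 / ((Q : ℂ) + 1)) *
      taylorCoeff (r - i) harmonicSeries = (1 / ((Q : ℂ) + 1)) * ∑ i ∈ Finset.range (r + 1),
      (multHarm ((i : ℤ) - 1) 1 Q : ℂ) * taylorCoeff (r - i) harmonicSeries := by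
    rw [Finset.mul_sum]
    exact Finset.sum_congr rfl fun i _ => by ring
  rw [e2, show ((r + 1 : ℕ) : ℤ) - 1 = r by push_cast; ring]
  field_simp

/-- One formula for both cases of the definition: for `r ≥ q` the sums `S_{r,1,q-2}` and
`S_{r-1,1,q-2}` are empty, and so is `S_{r-s,1,q-2}` for `s < r - q + 2`. -/
theorem coeffD_eq {p q r : ℕ} (hq : 2 ≤ q) : coeffD p q r
    = (-1) ^ r * ((p ! : ℂ) / ((p - r)! : ℂ)) *
      ((multHarm ((r : ℤ) - 1) 1 ((q : ℤ) - 2) : ℂ) *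
          (Real.eulerMascheroniConstant + (harmonic (q - 1) : ℂ))
        + ∑ s ∈ Finset.Icc 2 r, (multHarm ((r : ℤ) - (s : ℤ)) 1 ((q : ℤ) - 2) : ℂ) * riemannZeta s
        - (r + 1) * (multHarm r 1 ((q : ℤ) - 2) : ℂ)
        - ((p : ℂ) - r) * (multHarm r 1 ((q : ℤ) - 2) : ℂ)) := by
  rw [coeffD]
  congr 1
  split_ifs with h
  · rw [ratD_eq hq h]
    push_cast
    ring
  · obtain ⟨Q, rfl⟩ := Nat.exists_eq_add_of_le' hq
    rw [show ((Q + 2 : ℕ) : ℤ) - 2 = Q by push_cast; ring, multHarm_of_lt (by omega : Q < r),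
      show (r : ℤ) - 1 = ((r - 1 : ℕ) : ℤ) by omega, multHarm_of_lt (by omega : Q < r - 1)]
    simp only [Rat.cast_zero, zero_mul, mul_zero, sub_zero, zero_add]
    refine Finset.sum_subset (Finset.Icc_subset_Icc_left (by omega)) fun s hs hs' => ?_
    rw [Finset.mem_Icc] at hs hs'
    rw [show (r : ℤ) - (s : ℤ) = ((r - s : ℕ) : ℤ) by omega, multHarm_of_lt (by omega : Q < r - s)]
    simp

theorem logPoly_pred (p : ℕ) {q : ℕ} (hq : 2 ≤ q) (n : ℕ) :
    logPoly p q (q - 1) n = 1 / ((q : ℂ) - 1) *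
      ∑ r ∈ Finset.Icc 0 p, coeffD p q r * (Real.log n : ℂ) ^ (p - r) := by
  obtain ⟨Q, rfl⟩ := Nat.exists_eq_add_of_le' hq
  have hQ : (Q : ℂ) + 1 ≠ 0 := by exact_mod_cast Nat.succ_ne_zero Q
  have hQ2 : ((Q + 2 : ℕ) : ℤ) - 2 = Q := by push_cast; ring
  have hQ3 : ((Q + 2 : ℕ) : ℂ) - 1 = Q + 1 := by push_cast; ring
  have e : (fun s => expansionCoeff (Q + 2) (Q + 1) s n) = fun s => logCoeff (Q + 1) s n := by
    funext s
    rw [expansionCoeff, if_pos (by omega)]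
  have hr : Finset.Icc 0 p = Finset.range (p + 1) := by ext x; simp
  simp only [coeffD_eq (by omega : 2 ≤ Q + 2), hQ2, hQ3, show Q + 2 - 1 = Q + 1 by omega, hr]
  rw [eq_comm, one_div, inv_mul_eq_iff_eq_mul₀ hQ, logPoly, Finset.mul_sum]
  have e1 : ∀ r ∈ Finset.range (p + 1), ((Q : ℂ) + 1) * ((-1) ^ r * ((p ! : ℂ) / ((p - r)! : ℂ)) *
      taylorCoeff r (fun s => expansionCoeff (Q + 2) (Q + 1) s n) * (Real.log n : ℂ) ^ (p - r))
      = (-1) ^ r * ((p ! : ℂ) / ((p - r)! : ℂ)) * (multHarm ((r : ℤ) - 1) 1 Q : ℂ)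
          * (Real.log n : ℂ) ^ (p - r + 1)
        + (-1) ^ r * ((p ! : ℂ) / ((p - r)! : ℂ)) *
          ((multHarm ((r : ℤ) - 1) 1 Q : ℂ) *
            (Real.eulerMascheroniConstant + (harmonic (Q + 1) : ℂ))
          + ∑ s ∈ Finset.Icc 2 r, (multHarm ((r : ℤ) - (s : ℤ)) 1 Q : ℂ) * riemannZeta s
          - (r + 1) * (multHarm r 1 Q : ℂ)) * (Real.log n : ℂ) ^ (p - r) := by
    intro r _
    have := taylorCoeff_logCoeff Q n r
    rw [e, pow_succ]
    linear_combination ((-1) ^ r * ((p ! : ℂ) / ((p - r)! : ℂ)) * (Real.log n : ℂ) ^ (p - r)) * this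
  rw [Finset.sum_congr rfl e1, Finset.sum_add_distrib]
  simp only [mul_sub, sub_mul, Finset.sum_sub_distrib]
  -- The `log n` inside `logCoeff` raises the power by one. Shifting `r` restores it and produces
  -- the term `-(p-r) S_r` of `coeffD`; the end terms vanish because `S_{-1} = 0` and `p - r = 0` at
  -- `r = p`.
  have e2 : ∑ r ∈ Finset.range (p + 1), (-1) ^ r * ((p ! : ℂ) / ((p - r)! : ℂ)) *
        (multHarm ((r : ℤ) - 1) 1 Q : ℂ) * (Real.log n : ℂ) ^ (p - r + 1)
      = -∑ r ∈ Finset.range (p + 1), (-1) ^ r * ((p ! : ℂ) / ((p - r)! : ℂ)) *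
        (((p : ℂ) - r) * (multHarm r 1 Q : ℂ)) * (Real.log n : ℂ) ^ (p - r) := by
    rw [Finset.sum_range_succ', Finset.sum_range_succ, multHarm_of_neg (by simp)]
    simp only [sub_self, Rat.cast_zero, mul_zero, zero_mul, add_zero]
    rw [← Finset.sum_neg_distrib]
    refine Finset.sum_congr rfl fun r hr => ?_
    obtain ⟨d, rfl⟩ := Nat.exists_eq_add_of_lt (Finset.mem_range.1 hr)
    rw [show r + d + 1 - (r + 1) = d by omega, show r + d + 1 - r = d + 1 by omega,
      show ((r + 1 : ℕ) : ℤ) - 1 = r by push_cast; ring, Nat.factorial_succ d]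
    have h1 : (d ! : ℂ) ≠ 0 := by exact_mod_cast Nat.factorial_ne_zero d
    have h2 : (d : ℂ) + 1 ≠ 0 := by exact_mod_cast Nat.succ_ne_zero d
    push_cast
    field_simp
    ring
  rw [e2]
  simp only [mul_sub, sub_mul, Finset.sum_sub_distrib]
  ring

/-! ### Assembly of the expansion and its consequences. -/

theorem sum_Icc_one_eq_sum_range {M : Type*} [AddCommMonoid M] (f : ℕ → M) (n : ℕ) :
    ∑ i ∈ Finset.Icc 1 n, f i = ∑ i ∈ Finset.range n, f (i + 1) := by
  rw [Finset.range_eq_Ico, Finset.sum_Ico_add']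
  rfl

theorem riemannZeta_one_sub_natCast {k : ℕ} (hk : 1 ≤ k) :
    riemannZeta (1 - (k : ℂ)) = -((-1) ^ k * (bernoulli k : ℂ) / k) := by
  obtain ⟨j, rfl⟩ := Nat.exists_eq_add_of_le' hk
  rw [show (1 : ℂ) - ((j + 1 : ℕ) : ℂ) = -(j : ℂ) by push_cast; ring,
    riemannZeta_neg_nat_eq_bernoulli, pow_succ]
  push_cast
  ring

theorem sum_logPoly_range (p m n : ℕ) {q : ℕ} (hq : 2 ≤ q) :
    ∑ i ∈ Finset.range (q + m), logPoly p q i n * (1 / (n : ℂ) ^ i)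
      = riemannZeta q * (Real.log n : ℂ) ^ p
        + ∑ i ∈ Finset.Icc 1 (q - 2),
            riemannZeta ((q : ℂ) - (i : ℂ)) / ((i : ℂ) * (n : ℂ) ^ i) *
              ∑ r ∈ Finset.Icc 1 (min i p), (coeffC p i r : ℂ) * (Real.log n : ℂ) ^ (p - r)
        + 1 / (((q : ℂ) - 1) * (n : ℂ) ^ (q - 1)) *
            ∑ r ∈ Finset.Icc 0 p, coeffD p q r * (Real.log n : ℂ) ^ (p - r)
        - ∑ k ∈ Finset.Icc 1 m,
            ((-1) ^ k * (bernoulli k : ℂ) / ((k : ℂ) * ((k : ℂ) + (q : ℂ) - 1)) *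
              ∑ r ∈ Finset.Icc 1 p, (coeffC p (k + q - 1) r : ℂ) * (Real.log n : ℂ) ^ (p - r))
            * (1 / (n : ℂ) ^ (k + q - 1)) := by
  rw [Finset.sum_range_add, sub_eq_add_neg, ← Finset.sum_neg_distrib]
  congr 1
  · obtain ⟨Q, rfl⟩ := Nat.exists_eq_add_of_le' hq
    rw [Finset.sum_range_succ, Finset.sum_range_succ', logPoly_zero p hq, add_comm (∑ _ ∈ _, _)]
    congr 1
    · rw [sum_Icc_one_eq_sum_range, Nat.add_sub_cancel, pow_zero]
      congr 1
      · ring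
      · refine Finset.sum_congr rfl fun i hi => ?_
        have := Finset.mem_range.1 hi
        rw [logPoly_of_ne p (by omega) (by omega)]
        have e : ∑ r ∈ Finset.Icc 1 (min (i + 1) p),
            (coeffC p (i + 1) r : ℂ) * (Real.log n : ℂ) ^ (p - r)
            = ∑ r ∈ Finset.Icc 1 p, (coeffC p (i + 1) r : ℂ) * (Real.log n : ℂ) ^ (p - r) := by
          refine Finset.sum_subset (Finset.Icc_subset_Icc_right (min_le_right _ _)) fun r hr hr' => ?_
          rw [Finset.mem_Icc] at hr hr'
          rw [coeffC_of_lt p (by omega) (by omega)]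
          simp
        rw [e]
        ring
    · have := logPoly_pred p hq n
      rw [show Q + 2 - 1 = Q + 1 by omega] at this ⊢
      rw [this, one_div, one_div, one_div, mul_inv]
      ring
  · rw [sum_Icc_one_eq_sum_range]
    refine Finset.sum_congr rfl fun k _ => ?_
    have e1 : (q : ℂ) - ((q + k : ℕ) : ℂ) = 1 - ((k + 1 : ℕ) : ℂ) := by push_cast; ring
    have e2 : ((k + 1 : ℕ) : ℂ) + (q : ℂ) - 1 = ((q + k : ℕ) : ℂ) := by push_cast; ring
    rw [logPoly_of_ne p (by omega) (by omega), e1, riemannZeta_one_sub_natCast (by omega), e2,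
      show k + 1 + q - 1 = q + k by omega, ← div_div]
    ring

theorem sum_zetaDeriv_range (p m n : ℕ) {q : ℕ} (hq : 2 ≤ q) :
    ∑ j ∈ Finset.range m, (-1) ^ p * ((q + j - 1).choose j : ℂ) * zetaDeriv p (-(j : ℂ))
        * (1 / (n : ℂ) ^ (q + j))
      = ∑ k ∈ Finset.Icc 1 m, (-1) ^ p * ((k + q - 2).choose (q - 1) : ℂ)
          * zetaDeriv p (1 - (k : ℂ)) * (1 / (n : ℂ) ^ (k + q - 1)) := by
  rw [sum_Icc_one_eq_sum_range]
  refine Finset.sum_congr rfl fun j _ => ?_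
  rw [show j + 1 + q - 1 = q + j by omega, show j + 1 + q - 2 = q + j - 1 by omega,
    show (1 : ℂ) - ((j + 1 : ℕ) : ℂ) = -(j : ℂ) by push_cast; ring,
    ← Nat.choose_symm_of_eq_add (show q + j - 1 = j + (q - 1) by omega)]

theorem eventually_one_le_log : ∀ᶠ n : ℕ in atTop, 1 ≤ Real.log n :=
  (Real.tendsto_log_atTop.comp tendsto_natCast_atTop_atTop).eventually_ge_atTop 1

theorem isBigO_log_pow_mul_one_div_pow {a b N N' : ℕ} (hab : a ≤ b) (hN : N ≤ N') :
    (fun n : ℕ => (Real.log n : ℂ) ^ a * (1 / (n : ℂ) ^ N'))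
      =O[atTop] fun n : ℕ => Real.log n ^ b / (n : ℝ) ^ N := by
  refine IsBigO.of_bound 1 ?_
  filter_upwards [eventually_one_le_log, eventually_ge_atTop 1] with n hl hn
  have hn' : (1 : ℝ) ≤ n := by exact_mod_cast hn
  rw [one_mul, norm_mul, norm_div, norm_one, norm_pow, norm_pow, Complex.norm_natCast,
    Complex.norm_real, Real.norm_of_nonneg (by linarith), Real.norm_of_nonneg (by positivity),
    div_eq_mul_one_div (Real.log n ^ b)]
  gcongr

/-- The coefficient vanishes at `s = 0` for `i ≥ q`, so at least one derivative falls on it and at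
most `p - 1` logarithms remain. -/
theorem isBigO_logPoly_mul {p : ℕ} (hp : 1 ≤ p) {q i N : ℕ} (hq : 1 ≤ q) (hi : q ≤ i) (hN : N ≤ i) :
    (fun n : ℕ => logPoly p q i n * (1 / (n : ℂ) ^ i))
      =O[atTop] fun n : ℕ => Real.log n ^ (p - 1) / (n : ℝ) ^ N := by
  have e : (fun n : ℕ => logPoly p q i n * (1 / (n : ℂ) ^ i))
      = fun n : ℕ => ∑ r ∈ Finset.Icc 1 p, (riemannZeta ((q : ℂ) - i) / i * (coeffC p i r : ℂ)) *
        ((Real.log n : ℂ) ^ (p - r) * (1 / (n : ℂ) ^ i)) := by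
    funext n
    rw [logPoly_of_ne p (by omega) (by omega), Finset.mul_sum, Finset.sum_mul]
    exact Finset.sum_congr rfl fun r _ => by ring
  rw [e]
  refine IsBigO.fun_sum fun r hr => ?_
  exact (isBigO_log_pow_mul_one_div_pow (by have := Finset.mem_Icc.1 hr; omega) hN).const_mul_left _

/-- The expansion of `logPowSum p q n` to order `n ^ (-(m + q - 1))`. -/
theorem isBigO_logPowSum_sub (p q m : ℕ) (hp : 1 ≤ p) (hq : 2 ≤ q) :
    (fun n : ℕ => (logPowSum p q n : ℂ) -
      (riemannZeta q * (Real.log n : ℂ) ^ p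
        + ∑ i ∈ Finset.Icc 1 (q - 2),
            riemannZeta ((q : ℂ) - (i : ℂ)) / ((i : ℂ) * (n : ℂ) ^ i) *
              ∑ r ∈ Finset.Icc 1 (min i p), (coeffC p i r : ℂ) * (Real.log n : ℂ) ^ (p - r)
        + 1 / (((q : ℂ) - 1) * (n : ℂ) ^ (q - 1)) *
            ∑ r ∈ Finset.Icc 0 p, coeffD p q r * (Real.log n : ℂ) ^ (p - r)
        - ∑ k ∈ Finset.Icc 1 m,
            ((-1) ^ k * (bernoulli k : ℂ) / ((k : ℂ) * ((k : ℂ) + (q : ℂ) - 1)) *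
                ∑ r ∈ Finset.Icc 1 p,
                  (coeffC p (k + q - 1) r : ℂ) * (Real.log n : ℂ) ^ (p - r)
              - (-1) ^ p * ((k + q - 2).choose (q - 1) : ℂ) * zetaDeriv p (1 - (k : ℂ)))
            * (1 / (n : ℂ) ^ (k + q - 1))))
      =O[atTop] fun n : ℕ => Real.log (n : ℝ) ^ (p - 1) / (n : ℝ) ^ (m + q) := by
  obtain ⟨C, hC⟩ := norm_logPowSum_sub_le p (by omega : 1 ≤ q) m
  have h1 : (fun n : ℕ => (logPowSum p q n : ℂ) -
      (∑ i ∈ Finset.range (q + m + 2), logPoly p q i n * (1 / (n : ℂ) ^ i)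
        + ∑ j ∈ Finset.range (q + m + 4), (-1) ^ p * ((q + j - 1).choose j : ℂ)
          * zetaDeriv p (-(j : ℂ)) * (1 / (n : ℂ) ^ (q + j))))
      =O[atTop] fun n : ℕ => Real.log (n : ℝ) ^ (p - 1) / (n : ℝ) ^ (m + q) := by
    refine (IsBigO.of_bound C (g := fun n : ℕ => (Real.log n : ℂ) ^ 0 * (1 / (n : ℂ) ^ (m + q))) ?_).trans
      (isBigO_log_pow_mul_one_div_pow (Nat.zero_le _) le_rfl)
    filter_upwards [eventually_ge_atTop 1] with n hn
    simpa using hC n hn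
  -- The uniform expansion carries two surplus terms of the first family and `q + 4` of the second;
  -- all of them are within the error.
  have h2 : (fun n : ℕ => ∑ i ∈ Finset.range 2,
        logPoly p q (q + m + i) n * (1 / (n : ℂ) ^ (q + m + i)))
      =O[atTop] fun n : ℕ => Real.log (n : ℝ) ^ (p - 1) / (n : ℝ) ^ (m + q) :=
    IsBigO.fun_sum fun i _ => isBigO_logPoly_mul hp (by omega) (by omega) (by omega)
  have h3 : (fun n : ℕ => ∑ j ∈ Finset.range (q + 4),
        (-1) ^ p * ((q + (m + j) - 1).choose (m + j) : ℂ) * zetaDeriv p (-((m + j : ℕ) : ℂ))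
          * (1 / (n : ℂ) ^ (q + (m + j))))
      =O[atTop] fun n : ℕ => Real.log (n : ℝ) ^ (p - 1) / (n : ℝ) ^ (m + q) := by
    refine IsBigO.fun_sum fun j _ => ?_
    have := (isBigO_log_pow_mul_one_div_pow (a := 0) (b := p - 1) (N := m + q)
      (N' := q + (m + j)) (Nat.zero_le _) (by omega)).const_mul_left
      ((-1) ^ p * ((q + (m + j) - 1).choose (m + j) : ℂ) * zetaDeriv p (-((m + j : ℕ) : ℂ)))
    simpa only [pow_zero, one_mul] using this
  refine ((h1.add h2).add h3).congr_left fun n => ?_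
  rw [Finset.sum_range_add _ (q + m) 2, show q + m + 4 = m + (q + 4) by ring,
    Finset.sum_range_add _ m (q + 4), sum_logPoly_range p m n hq, sum_zetaDeriv_range p m n hq]
  simp only [sub_mul, Finset.sum_sub_distrib]
  ring

theorem tendsto_log_pow_mul_one_div_pow (a : ℕ) {N : ℕ} (hN : 1 ≤ N) :
    Tendsto (fun n : ℕ => (Real.log n : ℂ) ^ a * (1 / (n : ℂ) ^ N)) atTop (nhds 0) := by
  have h1 : Tendsto (fun n : ℕ => Real.log n ^ a / (n : ℝ) ^ 1) atTop (nhds 0) := by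
    simpa [Function.comp_def] using (Real.isLittleO_pow_log_id_atTop (n := a)).tendsto_div_nhds_zero.comp
      tendsto_natCast_atTop_atTop
  exact (isBigO_log_pow_mul_one_div_pow le_rfl hN).trans_tendsto h1

/-- The case `m = 0`: as `q ≥ 2`, every other term is a power of `log n` over a positive power of
`n`. -/
theorem tendsto_logPowSum_sub (p q : ℕ) (hp : 1 ≤ p) (hq : 2 ≤ q) :
    Tendsto (fun n : ℕ => (logPowSum p q n : ℂ) - riemannZeta q * (Real.log n : ℂ) ^ p)
      atTop (nhds 0) := by
  have h0 : Tendsto (fun n : ℕ => Real.log n ^ (p - 1) / (n : ℝ) ^ (0 + q)) atTop (nhds 0) := by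
    have := (tendsto_log_pow_mul_one_div_pow (p - 1) (by omega : 1 ≤ 0 + q)).norm
    rw [norm_zero] at this
    refine this.congr' ?_
    filter_upwards [eventually_one_le_log] with n hl
    rw [norm_mul, norm_div, norm_one, norm_pow, norm_pow, Complex.norm_natCast,
      Complex.norm_real, Real.norm_of_nonneg (by linarith), mul_one_div]
  have h1 := (isBigO_logPowSum_sub p q 0 hp hq).trans_tendsto h0
  have h2 : Tendsto (fun n : ℕ => ∑ i ∈ Finset.Icc 1 (q - 2), ∑ r ∈ Finset.Icc 1 (min i p),
      riemannZeta ((q : ℂ) - (i : ℂ)) / i * (coeffC p i r : ℂ) *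
        ((Real.log n : ℂ) ^ (p - r) * (1 / (n : ℂ) ^ i))) atTop (nhds 0) := by
    rw [← Finset.sum_const_zero (M := ℂ) (s := Finset.Icc 1 (q - 2))]
    refine tendsto_finsetSum _ fun i hi => ?_
    rw [← Finset.sum_const_zero (M := ℂ) (s := Finset.Icc 1 (min i p))]
    refine tendsto_finsetSum _ fun r _ => ?_
    simpa using (tendsto_log_pow_mul_one_div_pow (p - r) (Finset.mem_Icc.1 hi).1).const_mul
      (riemannZeta ((q : ℂ) - (i : ℂ)) / i * (coeffC p i r : ℂ))
  have h3 : Tendsto (fun n : ℕ => ∑ r ∈ Finset.Icc 0 p, 1 / ((q : ℂ) - 1) * coeffD p q r *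
        ((Real.log n : ℂ) ^ (p - r) * (1 / (n : ℂ) ^ (q - 1)))) atTop (nhds 0) := by
    rw [← Finset.sum_const_zero (M := ℂ) (s := Finset.Icc 0 p)]
    refine tendsto_finsetSum _ fun r _ => ?_
    simpa using (tendsto_log_pow_mul_one_div_pow (p - r) (by omega : 1 ≤ q - 1)).const_mul
      (1 / ((q : ℂ) - 1) * coeffD p q r)
  have h4 := (h1.add h2).add h3
  rw [add_zero, add_zero] at h4
  refine h4.congr fun n => ?_
  have e2 : ∑ i ∈ Finset.Icc 1 (q - 2), ∑ r ∈ Finset.Icc 1 (min i p),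
      riemannZeta ((q : ℂ) - (i : ℂ)) / i * (coeffC p i r : ℂ) *
        ((Real.log n : ℂ) ^ (p - r) * (1 / (n : ℂ) ^ i))
      = ∑ i ∈ Finset.Icc 1 (q - 2),
            riemannZeta ((q : ℂ) - (i : ℂ)) / ((i : ℂ) * (n : ℂ) ^ i) *
              ∑ r ∈ Finset.Icc 1 (min i p), (coeffC p i r : ℂ) * (Real.log n : ℂ) ^ (p - r) := by
    refine Finset.sum_congr rfl fun i _ => ?_
    rw [Finset.mul_sum]
    exact Finset.sum_congr rfl fun r _ => by rw [← div_div]; ring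
  have e3 : ∑ r ∈ Finset.Icc 0 p, 1 / ((q : ℂ) - 1) * coeffD p q r *
        ((Real.log n : ℂ) ^ (p - r) * (1 / (n : ℂ) ^ (q - 1)))
      = 1 / (((q : ℂ) - 1) * (n : ℂ) ^ (q - 1)) *
            ∑ r ∈ Finset.Icc 0 p, coeffD p q r * (Real.log n : ℂ) ^ (p - r) := by
    rw [Finset.mul_sum]
    exact Finset.sum_congr rfl fun r _ => by rw [← div_div]; ring
  rw [e2, e3, Finset.Icc_eq_empty (by omega : ¬ 1 ≤ 0), Finset.sum_empty]
  ring

theorem coeffC_one_one {i : ℕ} (hi : 1 ≤ i) : coeffC 1 i 1 = -1 := by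
  obtain ⟨m, rfl⟩ := Nat.exists_eq_add_of_le' hi
  rw [coeffC, show ((m + 1 : ℕ) : ℤ) - 1 = m by push_cast; ring]
  simp [multHarm_zero]

/-- In `coeffD_eq` the bracket is `-1 - 1` at `r = 0`, and `γ + H_{q-1} - 2 H_{q-2} = γ - H_{q-1} +
2/(q-1)` at `r = 1`. -/
theorem sum_coeffD_one {q : ℕ} (hq : 2 ≤ q) (x : ℂ) :
    ∑ r ∈ Finset.Icc 0 1, coeffD 1 q r * x ^ (1 - r) = -(2 * x + (constC (q - 1) : ℂ)) := by
  have hr : Finset.Icc 0 1 = Finset.range 2 := rfl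
  obtain ⟨Q, rfl⟩ := Nat.exists_eq_add_of_le' hq
  have hQ : (Q : ℂ) + 1 ≠ 0 := by exact_mod_cast Nat.succ_ne_zero Q
  rw [hr, Finset.sum_range_succ, Finset.sum_range_one, coeffD_eq hq, coeffD_eq hq,
    show ((Q + 2 : ℕ) : ℤ) - 2 = Q by push_cast; ring, show Q + 2 - 1 = Q + 1 by omega, constC,
    harmonic_succ, harmonic_eq_multHarm]
  simp [multHarm_zero, multHarm_of_neg]
  field_simp
  ring

theorem mainTheorem6 :
    -- the case `p = 1`
    (∀ q : ℕ, 2 ≤ q →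
      (∀ m : ℕ,
        (fun n : ℕ => (logPowSum 1 q n : ℂ) -
          (riemannZeta q * (Real.log n : ℂ)
            - ∑ i ∈ Finset.Icc 1 (q - 2),
                riemannZeta ((q : ℂ) - (i : ℂ)) / ((i : ℂ) * (n : ℂ) ^ i)
            - (2 * (Real.log n : ℂ) + (constC (q - 1) : ℂ)) / (((q : ℂ) - 1) * (n : ℂ) ^ (q - 1))
            + ∑ k ∈ Finset.Icc 1 m,
                ((-1) ^ k * (bernoulli k : ℂ) / ((k : ℂ) * ((k : ℂ) + (q : ℂ) - 1))
                  - ((k + q - 2).choose (q - 1) : ℂ) * zetaDeriv 1 (1 - (k : ℂ)))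
                * (1 / (n : ℂ) ^ (k + q - 1))))
          =O[atTop] fun n : ℕ => 1 / (n : ℝ) ^ (m + q)) ∧
      Tendsto (fun n : ℕ => (logPowSum 1 q n : ℂ) - riemannZeta q * (Real.log n : ℂ))
        atTop (nhds 0)) ∧
    -- the general case
    (∀ p q : ℕ, 1 ≤ p → 2 ≤ q →
      (∀ m : ℕ,
        (fun n : ℕ => (logPowSum p q n : ℂ) -
          (riemannZeta q * (Real.log n : ℂ) ^ p
            + ∑ i ∈ Finset.Icc 1 (q - 2),
                riemannZeta ((q : ℂ) - (i : ℂ)) / ((i : ℂ) * (n : ℂ) ^ i) *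
                  ∑ r ∈ Finset.Icc 1 (min i p), (coeffC p i r : ℂ) * (Real.log n : ℂ) ^ (p - r)
            + 1 / (((q : ℂ) - 1) * (n : ℂ) ^ (q - 1)) *
                ∑ r ∈ Finset.Icc 0 p, coeffD p q r * (Real.log n : ℂ) ^ (p - r)
            - ∑ k ∈ Finset.Icc 1 m,
                ((-1) ^ k * (bernoulli k : ℂ) / ((k : ℂ) * ((k : ℂ) + (q : ℂ) - 1)) *
                    ∑ r ∈ Finset.Icc 1 p,
                      (coeffC p (k + q - 1) r : ℂ) * (Real.log n : ℂ) ^ (p - r)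
                  - (-1) ^ p * ((k + q - 2).choose (q - 1) : ℂ) * zetaDeriv p (1 - (k : ℂ)))
                * (1 / (n : ℂ) ^ (k + q - 1))))
          =O[atTop] fun n : ℕ => Real.log (n : ℝ) ^ (p - 1) / (n : ℝ) ^ (m + q)) ∧
      Tendsto (fun n : ℕ => (logPowSum p q n : ℂ) - riemannZeta q * (Real.log n : ℂ) ^ p)
        atTop (nhds 0)) := by
  refine ⟨fun q hq => ⟨fun m => ?_, ?_⟩,
    fun p q hp hq => ⟨fun m => isBigO_logPowSum_sub p q m hp hq, tendsto_logPowSum_sub p q hp hq⟩⟩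
  · refine (isBigO_logPowSum_sub 1 q m le_rfl hq).congr (fun n => ?_) fun n => by simp
    rw [sum_coeffD_one hq]
    have e1 : ∑ i ∈ Finset.Icc 1 (q - 2),
        riemannZeta ((q : ℂ) - (i : ℂ)) / ((i : ℂ) * (n : ℂ) ^ i) *
          ∑ r ∈ Finset.Icc 1 (min i 1), (coeffC 1 i r : ℂ) * (Real.log n : ℂ) ^ (1 - r)
        = -∑ i ∈ Finset.Icc 1 (q - 2),
          riemannZeta ((q : ℂ) - (i : ℂ)) / ((i : ℂ) * (n : ℂ) ^ i) := by
      rw [← Finset.sum_neg_distrib]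
      refine Finset.sum_congr rfl fun i hi => ?_
      have hi' := (Finset.mem_Icc.1 hi).1
      rw [min_eq_right hi', Finset.Icc_self, Finset.sum_singleton, coeffC_one_one hi']
      simp
    have e2 : ∑ k ∈ Finset.Icc 1 m,
        ((-1) ^ k * (bernoulli k : ℂ) / ((k : ℂ) * ((k : ℂ) + (q : ℂ) - 1)) *
            ∑ r ∈ Finset.Icc 1 1, (coeffC 1 (k + q - 1) r : ℂ) * (Real.log n : ℂ) ^ (1 - r)
          - (-1) ^ 1 * ((k + q - 2).choose (q - 1) : ℂ) * zetaDeriv 1 (1 - (k : ℂ)))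
        * (1 / (n : ℂ) ^ (k + q - 1))
        = -∑ k ∈ Finset.Icc 1 m,
          ((-1) ^ k * (bernoulli k : ℂ) / ((k : ℂ) * ((k : ℂ) + (q : ℂ) - 1))
            - ((k + q - 2).choose (q - 1) : ℂ) * zetaDeriv 1 (1 - (k : ℂ)))
          * (1 / (n : ℂ) ^ (k + q - 1)) := by
      rw [← Finset.sum_neg_distrib]
      refine Finset.sum_congr rfl fun k hk => ?_
      have hk' := (Finset.mem_Icc.1 hk).1
      rw [Finset.Icc_self, Finset.sum_singleton, coeffC_one_one (by omega)]
      push_cast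
      ring
    rw [e1, e2]
    ring
  · simpa using tendsto_logPowSum_sub 1 q le_rfl hq
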